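/- **Setting.** Let $X$ be a compact smooth manifold of real dimension $2n$ with a closed real 3-form $H$. On $T_X\oplus T_X^*$ use the pairing $\langle V+\xi,W+\eta\rangle=\xi(W)+\eta(V)$, the Clifford action $(V+\xi)\cdot\rho=i_V\rho+\xi\wedge\rho$ on $\wedge^\bullet T_X^*$, the bracket $[V+\xi,W+\eta]=[V,W]+\mathcal L_V\eta-\mathcal L_W\xi-\tfrac12 d(i_V\eta-i_W\xi)+i_Wi_VH$, and the twisted differential $d=d_{\mathrm{dR}}-H\wedge$. Everything is extended complex linearly to the complexifications. Let $J$ be a generalized complex structure on $X$: a smooth endomorphism of $T_X\oplus T_X^*$ with $J^2=-1$, $\langle Ja,Jb\rangle=\langle a,b\rangle$, whose $+i$-eigenbundle $L$ satisfies $[L,L]\subset L$. Let $G$ be a generalized Hermitian metric: a smooth endomorphism with $G^2=1$, $GJ=JG$ and $\langle G\cdot,\cdot\rangle$ symmetric and positive definite. The pairing identifies $L^*$ with $\bar L$. Put $$U^{-n}(X)=\{\rho\mid L\cdot\rho=0\},\qquad U^{j}(X)=\wedge^{j+n}\bar L\cdot U^{-n}(X),$$ so that $\wedge^\bullet T_X^*\otimes\mathbb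 C=\bigoplus_{j=-n}^nU^j(X)$ (and $U^j(X)=0$ for $|j|>n$). Let $\pi_j$ be the projection onto $U^j(X)$, and let $\partial=\pi_{j-1}\circ d$ and $\bar\partial=\pi_{j+1}\circ d$ on $U^j(X)$. Let $\epsilon$ be a smooth section of $\wedge^2L^*$, locally $\epsilon=\tfrac12\epsilon_{ij}\,l^i\cdot l^j$ with $\epsilon_{ij}=-\epsilon_{ji}$, where $(l_i)$ is a frame of $L$ and $(l^i)$ is the dual frame of $\bar L$. It acts on forms by the Clifford action $\epsilon\cdot$, and as a bundle map $\epsilon:L\to\bar L$, $\epsilon(l_p)=\epsilon_{ip}l^i$, extended by $0$ on $\bar L$. Let $\epsilon^*\in\wedge^2L$ be its complex conjugate, and put $L_\epsilon=(1+\epsilon)(L)$, so that $\overline{L_\epsilon}=(1+\epsilon^*)(\bar L)$. Assume that $\epsilon$ is an integrable generalized Beltrami differential, that is, $[L_\epsilon,L_\epsilon]\subset L_\epsilon$, and that $\|\epsilon\|_{L^\infty}<1$, where $\|\epsilon\|_{L^\infty}$ is the supremum over $x\in X$ of the operator norm of $\epsilon_x:L_x\to\bar L_x$ for the Hermitian inner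 product $\langle Ga,\bar b\rangle$. Let $X_\epsilon$ be $X$ with the generalized complex structure whose $+i$-eigenbundle is $L_\epsilon$, let $U^j(X_\epsilon)$ be defined by $L_\epsilon$ as above, and let $\bar\partial_t$ be the $\bar\partial$-operator of $X_\epsilon$: on $U^j(X_\epsilon)$ it is $d$ followed by the projection onto $U^{j+1}(X_\epsilon)$. For $0\le k\le 2n$ let $\mathcal E:U^{k-n}(X)\to U^{k-n}(X_\epsilon)$ and $1-\epsilon\epsilon^*:U^{k-n}(X)\to U^{k-n}(X)$ be the linear bundle maps with $$\mathcal E(a_1\cdots a_k\cdot\rho_0)=(1+\epsilon^*)(a_1)\cdots(1+\epsilon^*)(a_k)\cdot\Big(\sum_{i\ge0}\tfrac1{i!}\epsilon^i\cdot\rho_0\Big),$$ $$(1-\epsilon\epsilon^*)(a_1\cdots a_k\cdot\rho_0)=(a_1-\epsilon(\epsilon^*(a_1)))\cdots(a_k-\epsilon(\epsilon^*(a_k)))\cdot\rho_0$$ for $a_1,\dots,a_k\in\bar L$ and $\rho_0\in U^{-n}(X)$, and let $[\partial,\epsilon\cdot]=\partial\circ\epsilon\cdot-\epsilon\cdot\circ\partial$.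 **Theorem.** For every $0\le k\le 2n$ and every smooth section $\sigma$ of $U^{k-n}(X)$, $$\bar\partial_t(\mathcal E(\sigma))=0\iff\big([\partial,\epsilon\cdot]+\bar\partial\big)\circ(1-\epsilon\epsilon^*)(\sigma)=0 .$$ -/

import Mathlib

open scoped Manifold ContDiff TensorProduct

namespace GenCx

noncomputable section

/-! ### Linear algebra of `T ⊕ T*` and of the mixed forms at a point

The manifolds below are modelled on `ℝ^{2n}` and Mathlib's `TangentSpace 𝓘(ℝ, Model n) x` is by
definition `Model n`, so that the fibre constructions are written over `Model n`. None of them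
depends on the coordinates (where a basis is used, the result is independent of it). -/

/-- The model space `ℝ^{2n}`, which is also the tangent space at each point. -/
abbrev Model (n : ℕ) : Type := EuclideanSpace ℝ (Fin (2 * n))

/-- The fibre of `T_X ⊕ T_X^*` (real). -/
abbrev GT (n : ℕ) : Type := Model n × (Model n →L[ℝ] ℝ)

/-- The fibre of `(T_X ⊕ T_X^*) ⊗ ℂ`. -/
abbrev GTC (n : ℕ) : Type := ℂ ⊗[ℝ] GT n

/-- The fibre of `⋀^• T_X^* ⊗ ℂ`: families of complex valued alternating forms, one in each degree
(those of degree `> 2n` vanish automatically). -/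
def MF (n : ℕ) : Type := (k : ℕ) → (Model n [⋀^Fin k]→L[ℝ] ℂ)

instance (n : ℕ) : AddCommGroup (MF n) :=
  inferInstanceAs (AddCommGroup ((k : ℕ) → (Model n [⋀^Fin k]→L[ℝ] ℂ)))

instance (n : ℕ) : Module ℂ (MF n) :=
  inferInstanceAs (Module ℂ ((k : ℕ) → (Model n [⋀^Fin k]→L[ℝ] ℂ)))

variable {n : ℕ}

@[simp] lemma MF.add_apply (ρ τ : MF n) (k : ℕ) : (ρ + τ) k = ρ k + τ k := rfl

@[simp] lemma MF.smul_apply (c : ℂ) (ρ : MF n) (k : ℕ) : (c • ρ) k = c • ρ k := rfl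

@[simp] lemma MF.real_smul_apply (r : ℝ) (ρ : MF n) (k : ℕ) : (r • ρ) k = (r : ℂ) • ρ k := rfl

@[simp] lemma MF.zero_apply (k : ℕ) : (0 : MF n) k = 0 := rfl

@[simp] lemma MF.neg_apply (ρ : MF n) (k : ℕ) : (-ρ) k = -ρ k := rfl

@[simp] lemma MF.sub_apply (ρ τ : MF n) (k : ℕ) : (ρ - τ) k = ρ k - τ k := rfl

/-- The pairing `⟨X + ξ, Y + η⟩ = ξ(Y) + η(X)`. -/
def pair : LinearMap.BilinForm ℝ (GT n) :=
  LinearMap.mk₂ ℝ (fun a b => a.2 b.1 + b.2 a.1)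
    (by intro a b c; simp; ring) (by intro r a b; simp; ring)
    (by intro a b c; simp; ring) (by intro r a b; simp; ring)

/-- The complex bilinear extension of the pairing. -/
def pairC : LinearMap.BilinForm ℂ (GTC n) := LinearMap.BilinForm.baseChange ℂ pair

/-- Complex conjugation on a complexification. -/
def conjAux : GTC n →ₗ[ℝ] GTC n :=
  TensorProduct.map Complex.conjAe.toLinearMap LinearMap.id

lemma conjAux_smul (c : ℂ) (a : GTC n) :
    conjAux (c • a) = (starRingEnd ℂ) c • conjAux a := by
  induction a using TensorProduct.induction_on with
  | zero => simp
  | tmul z v => simp [conjAux, TensorProduct.smul_tmul']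
  | add a b ha hb => simp only [smul_add, map_add, ha, hb]

/-- Complex conjugation on `(T_X ⊕ T_X^*) ⊗ ℂ`, as a conjugate linear map. -/
def conjGT : GTC n →ₛₗ[starRingEnd ℂ] GTC n where
  toFun := conjAux
  map_add' := map_add _
  map_smul' := conjAux_smul

/-- Real part of an element of `(T_X ⊕ T_X^*) ⊗ ℂ`. -/
def reGT : GTC n →ₗ[ℝ] GT n :=
  (TensorProduct.lid ℝ (GT n)).toLinearMap ∘ₗ TensorProduct.map Complex.reLm LinearMap.id

/-- Imaginary part of an element of `(T_X ⊕ T_X^*) ⊗ ℂ`. -/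
def imGT : GTC n →ₗ[ℝ] GT n :=
  (TensorProduct.lid ℝ (GT n)).toLinearMap ∘ₗ TensorProduct.map Complex.imLm LinearMap.id

/-- Exterior multiplication `ξ ∧ ρ` by a real covector. -/
def wedgeOne (ξ : Model n →L[ℝ] ℝ) (ρ : MF n) : MF n
  | 0 => 0
  | k + 1 => ContinuousAlternatingMap.alternatizeUncurryFin
      ((Complex.ofRealCLM.comp ξ).smulRight (ρ k))

/-- Contraction `i_v ρ` by a real vector. -/
def contr (v : Model n) (ρ : MF n) : MF n := fun k => (ρ (k + 1)).curryLeft v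

/-- The Clifford action `(X + ξ) · ρ = i_X ρ + ξ ∧ ρ` of a real element. -/
def cliffEnd (a : GT n) : Module.End ℂ (MF n) where
  toFun ρ := contr a.1 ρ + wedgeOne a.2 ρ
  map_add' := by
    intro ρ τ
    funext k
    cases k <;> ext v
    · simp [contr, wedgeOne]
    · simp [contr, wedgeOne, ContinuousAlternatingMap.alternatizeUncurryFin_apply,
        Finset.sum_add_distrib]
      ring
  map_smul' := by
    intro c ρ
    funext k
    cases k <;> ext v
    · simp [contr, wedgeOne]
    · simp [contr, wedgeOne, ContinuousAlternatingMap.alternatizeUncurryFin_apply,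
        Finset.mul_sum, mul_left_comm]

lemma cliffEnd_apply (a : GT n) (ρ : MF n) :
    cliffEnd a ρ = contr a.1 ρ + wedgeOne a.2 ρ := rfl

/-- The Clifford action of the real bundle, as a real linear map. -/
def cliffR : GT n →ₗ[ℝ] Module.End ℂ (MF n) where
  toFun := cliffEnd
  map_add' := by
    intro a b
    refine LinearMap.ext fun ρ => ?_
    rw [LinearMap.add_apply, cliffEnd_apply, cliffEnd_apply, cliffEnd_apply]
    funext k
    cases k <;> ext v
    · simp [contr, wedgeOne]
    · simp [contr, wedgeOne, ContinuousAlternatingMap.alternatizeUncurryFin_apply,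
        Finset.sum_add_distrib, add_mul]
      ring
  map_smul' := by
    intro c a
    refine LinearMap.ext fun ρ => ?_
    rw [LinearMap.smul_apply, RingHom.id_apply, cliffEnd_apply, cliffEnd_apply]
    funext k
    cases k <;> ext v
    · simp [contr, wedgeOne]
    · simp [contr, wedgeOne, ContinuousAlternatingMap.alternatizeUncurryFin_apply,
        Finset.mul_sum]
      refine congrArg Finset.univ.sum (funext fun i => ?_)
      ring

/-- The Clifford action of `(T_X ⊕ T_X^*) ⊗ ℂ` on complex mixed forms. -/
def cliff : GTC n →ₗ[ℂ] Module.End ℂ (MF n) := LinearMap.liftBaseChange ℂ cliffR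

/-- The iterated Clifford product `l₀ · l₁ ⋯ l_{m-1} · ρ`. -/
def cliffProd {m : ℕ} (l : Fin m → GTC n) (ρ : MF n) : MF n :=
  (List.ofFn fun i => cliff (l i)).prod ρ

/-- The canonical line `U^{-n} = {ρ | L · ρ = 0}` of a subspace `L` of `(T ⊕ T*) ⊗ ℂ`. -/
def pureSpinors (L : Submodule ℂ (GTC n)) : Submodule ℂ (MF n) :=
  ⨅ a ∈ L, LinearMap.ker (cliff a)

/-- `U^j = ⋀^{j+n} L̄ · U^{-n}`, for an integer `j` (it is zero for `j < -n`). -/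
def U (L : Submodule ℂ (GTC n)) (j : ℤ) : Submodule ℂ (MF n) :=
  Submodule.span ℂ {θ | ∃ (m : ℕ) (l : Fin m → GTC n) (ρ : MF n), (m : ℤ) = j + n ∧
    (∀ i, l i ∈ L.map conjGT) ∧ ρ ∈ pureSpinors L ∧ θ = cliffProd l ρ}

open Classical in
/-- The projection onto `U^j` along the sum of all the other `U^i`. (If `(T ⊕ T*) ⊗ ℂ` is the sum
of the isotropic subspaces `L` and `L̄`, then `⋀^• T^*` is the direct sum of the `U^i` and `proj`
is this projection; it is used for such `L` only.) -/
def proj (L : Submodule ℂ (GTC n)) (j : ℤ) (θ : MF n) : MF n :=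
  if h : ∃ τ ∈ U L j, θ - τ ∈ ⨆ (i : ℤ) (_ : i ≠ j), U L i then h.choose else 0

/-- The linear relation spanned by the pairs
`(l₁ ⋯ l_k · ρ, P(l₁) ⋯ P(l_k) · A(ρ))` with `l_i ∈ L̄` and `ρ ∈ U^{-n}`. -/
def multGraph (L : Submodule ℂ (GTC n)) (k : ℕ) (P : GTC n →ₗ[ℂ] GTC n)
    (A : MF n → MF n) : Submodule ℂ (MF n × MF n) :=
  Submodule.span ℂ {p | ∃ (l : Fin k → GTC n) (ρ : MF n), (∀ i, l i ∈ L.map conjGT) ∧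
    ρ ∈ pureSpinors L ∧ p = (cliffProd l ρ, cliffProd (fun i => P (l i)) (A ρ))}

open Classical in
/-- The linear map on `U^{k-n} = ⋀^k L̄ · U^{-n}` with
`l₁ ⋯ l_k · ρ ↦ P(l₁) ⋯ P(l_k) · A(ρ)` for `l_i ∈ L̄`, `ρ ∈ U^{-n}`. -/
def multExt (L : Submodule ℂ (GTC n)) (k : ℕ) (P : GTC n →ₗ[ℂ] GTC n)
    (A : MF n → MF n) (θ : MF n) : MF n :=
  if h : ∃ τ, (θ, τ) ∈ multGraph L k P A then h.choose else 0

/-- The `i`-th coordinate vector, as an element of `T ⊕ T*`. -/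
def vecE (i : Fin (2 * n)) : GT n := (EuclideanSpace.single i 1, 0)

/-- The `i`-th coordinate covector, as an element of `T ⊕ T*`. -/
def covE (i : Fin (2 * n)) : GT n := (0, EuclideanSpace.proj i)

/-- An element `ε` of `⋀² L*`, `L* = L̄`, is given by the skew map `l ↦ ε(l)` from `L` to `L̄`,
extended by `0` on `L̄`. If `ε = ½ ε_{ij} l^i · l^j`, then `ε(l_p) = ε_{ip} l^i`. -/
structure IsTwoVector (L : Submodule ℂ (GTC n)) (ε : GTC n →ₗ[ℂ] GTC n) : Prop where
  map_L : ∀ a ∈ L, ε a ∈ L.map conjGT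
  map_Lbar : ∀ a ∈ L.map conjGT, ε a = 0
  skew : ∀ a b, pairC (ε a) b = -pairC a (ε b)

/-- The Clifford action `ε · ρ` of a two-vector: since
`½ ε_{ij} l^i · l^j = ½ ∑_j ε(l_j) · l^j` and `ε(L̄) = 0`, it is `½ ∑_a ε(e_a) · e^a · ρ` for any
basis `(e_a)` of `(T ⊕ T*) ⊗ ℂ` with dual basis `(e^a)`; here `(∂_i, dx^i)` with dual basis
`(dx^i, ∂_i)`. -/
def twoAct (ε : GTC n →ₗ[ℂ] GTC n) : Module.End ℂ (MF n) :=
  (1 / 2 : ℂ) • ∑ i : Fin (2 * n),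
    (cliff (ε (1 ⊗ₜ[ℝ] vecE i)) * cliff (1 ⊗ₜ[ℝ] covE i) +
      cliff (ε (1 ⊗ₜ[ℝ] covE i)) * cliff (1 ⊗ₜ[ℝ] vecE i))

/-- `e^ε · ρ = ∑_i (1/i!) ε^i · ρ`; the terms with `i > n` vanish, because `L̄` has dimension `2n`
and so `ε^i = 0` for `i > n`. -/
def expAct (ε : GTC n →ₗ[ℂ] GTC n) (ρ : MF n) : MF n :=
  ∑ i ∈ Finset.range (n + 1), ((i.factorial : ℂ)⁻¹) • ((twoAct ε) ^ i) ρ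

/-- `ε* ∈ ⋀² L`: the complex conjugate of `ε`, that is, the two-vector with
`(1 + ε*)(L̄) = conj ((1 + ε)(L))`. -/
def epsStar (ε : GTC n →ₗ[ℂ] GTC n) : GTC n →ₗ[ℂ] GTC n :=
  conjGT.comp (ε.comp conjGT)

/-- `L_ε = (1 + ε)(L)`. -/
def defL (L : Submodule ℂ (GTC n)) (ε : GTC n →ₗ[ℂ] GTC n) : Submodule ℂ (GTC n) :=
  L.map (LinearMap.id + ε)

/-- The extension map `𝓔` on `U^{k-n}`:
`l₁ ⋯ l_k · ρ₀ ↦ (1 + ε*)(l₁) ⋯ (1 + ε*)(l_k) · (e^ε · ρ₀)`. -/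
def extMap (L : Submodule ℂ (GTC n)) (ε : GTC n →ₗ[ℂ] GTC n) (k : ℕ) : MF n → MF n :=
  multExt L k (LinearMap.id + epsStar ε) (expAct ε)

/-- The operator `1 - εε*` on `U^{k-n}`:
`l₁ ⋯ l_k · ρ₀ ↦ (1 - εε*)(l₁) ⋯ (1 - εε*)(l_k) · ρ₀`. -/
def oneSubMap (L : Submodule ℂ (GTC n)) (ε : GTC n →ₗ[ℂ] GTC n) (k : ℕ) : MF n → MF n :=
  multExt L k (LinearMap.id - ε ∘ₗ epsStar ε) id

/-- `h ∧ ρ` for a real three-form `h`, as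
`(1/6) ∑ h(∂_i, ∂_j, ∂_k) dx^i ∧ dx^j ∧ dx^k ∧ ρ`. -/
def wedgeThree (h : Model n [⋀^Fin 3]→L[ℝ] ℝ) (ρ : MF n) : MF n :=
  (1 / 6 : ℂ) • ∑ i : Fin (2 * n), ∑ j : Fin (2 * n), ∑ k : Fin (2 * n),
    ((h ![EuclideanSpace.single i 1, EuclideanSpace.single j 1,
        EuclideanSpace.single k 1] : ℝ) : ℂ) •
      wedgeOne (EuclideanSpace.proj i) (wedgeOne (EuclideanSpace.proj j)
        (wedgeOne (EuclideanSpace.proj k) ρ))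

/-! ### Calculus on the manifold, read in the charts -/

variable {X : Type*} [TopologicalSpace X] [ChartedSpace (Model n) X]

/-- The derivative of the inverse of the chart at `x`, at the point `y` of the model. -/
def chartD (x : X) (y : Model n) : Model n →L[ℝ] Model n :=
  mfderiv 𝓘(ℝ, Model n) 𝓘(ℝ, Model n) (extChartAt 𝓘(ℝ, Model n) x).symm y

/-- The expression of an `F`-valued differential form in the chart at `x`: its pullback by the
inverse of the chart. -/
def localForm {F : Type*} [NormedAddCommGroup F] [NormedSpace ℝ F] {k : ℕ}
    (θ : X → Model n [⋀^Fin k]→L[ℝ] F) (x : X) (y : Model n) : Model n [⋀^Fin k]→L[ℝ] F :=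
  (θ ((extChartAt 𝓘(ℝ, Model n) x).symm y)).compContinuousLinearMap (chartD x y)

/-- The form `θ` is smooth at `x`. -/
def FormSmoothAt {F : Type*} [NormedAddCommGroup F] [NormedSpace ℝ F] {k : ℕ}
    (θ : X → Model n [⋀^Fin k]→L[ℝ] F) (x : X) : Prop :=
  ContDiffAt ℝ ∞ (localForm θ x) (extChartAt 𝓘(ℝ, Model n) x x)

/-- The exterior derivative of a differential form on `X`. -/
def extD {F : Type*} [NormedAddCommGroup F] [NormedSpace ℝ F] {k : ℕ}
    (θ : X → Model n [⋀^Fin k]→L[ℝ] F) (x : X) : Model n [⋀^Fin (k + 1)]→L[ℝ] F :=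
  (extDeriv (localForm θ x) (extChartAt 𝓘(ℝ, Model n) x x)).compContinuousLinearMap
    (mfderiv 𝓘(ℝ, Model n) 𝓘(ℝ, Model n) (extChartAt 𝓘(ℝ, Model n) x) x)

/-- A mixed form is smooth if all its components are. -/
def MFSmooth (σ : X → MF n) : Prop := ∀ (x : X) (k : ℕ), FormSmoothAt (fun z => σ z k) x

/-- The twisted de Rham differential `d_H σ = dσ - H ∧ σ`. -/
def dH (H : X → Model n [⋀^Fin 3]→L[ℝ] ℝ) (σ : X → MF n) (x : X) : MF n
  | 0 => -wedgeThree (H x) (σ x) 0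
  | k + 1 => extD (fun z => σ z k) x - wedgeThree (H x) (σ x) (k + 1)

/-- The expression in the chart at `x` of a section of `T_X ⊕ T_X^*`. -/
def localGT (a : X → GT n) (x : X) (y : Model n) : GT n :=
  ((chartD x y).inverse (a ((extChartAt 𝓘(ℝ, Model n) x).symm y)).1,
    (a ((extChartAt 𝓘(ℝ, Model n) x).symm y)).2.comp (chartD x y))

/-- The section `a` of `T_X ⊕ T_X^*` is smooth at `x`. -/
def GTSmoothAt (a : X → GT n) (x : X) : Prop :=
  ContDiffAt ℝ ∞ (localGT a x) (extChartAt 𝓘(ℝ, Model n) x x)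

/-- The section `a` of `(T_X ⊕ T_X^*) ⊗ ℂ` is smooth at `x`. -/
def GTCSmoothAt (a : X → GTC n) (x : X) : Prop :=
  GTSmoothAt (fun z => reGT (a z)) x ∧ GTSmoothAt (fun z => imGT (a z)) x

/-- The section of `T_X ⊕ T_X^*` on the domain of the chart at `x` with constant expression `w` in
that chart. -/
def constSec (x : X) (w : GT n) (z : X) : GT n :=
  let D := chartD x (extChartAt 𝓘(ℝ, Model n) x z)
  (D w.1, w.2.comp D.inverse)

/-- A bundle endomorphism `A` of `T_X ⊕ T_X^*` is smooth: its matrix in the chart at each point is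
smooth at this point. -/
def EndSmooth (A : X → GT n →ₗ[ℝ] GT n) : Prop :=
  ∀ (x : X) (w : GT n), GTSmoothAt (fun z => A z (constSec x w z)) x

/-- A bundle endomorphism of `(T_X ⊕ T_X^*) ⊗ ℂ` is smooth. -/
def EndCSmooth (A : X → GTC n →ₗ[ℂ] GTC n) : Prop :=
  ∀ (x : X) (w : GT n), GTCSmoothAt (fun z => A z (1 ⊗ₜ[ℝ] constSec x w z)) x

/-- A covector as a form of degree one. -/
def toForm (ξ : Model n →L[ℝ] ℝ) : Model n [⋀^Fin 1]→L[ℝ] ℝ :=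
  ContinuousAlternatingMap.ofSubsingleton ℝ (Model n) ℝ 0 ξ

/-- A form of degree one as a covector. -/
def ofForm (θ : Model n [⋀^Fin 1]→L[ℝ] ℝ) : Model n →L[ℝ] ℝ :=
  (ContinuousAlternatingMap.ofSubsingleton ℝ (Model n) ℝ 0).symm θ

/-- The differential of a function. -/
def dFun (f : X → ℝ) (x : X) : Model n →L[ℝ] ℝ :=
  mfderiv 𝓘(ℝ, Model n) 𝓘(ℝ, ℝ) f x

/-- The Lie derivative `L_V η = d i_V η + i_V d η` of a one-form. -/
def lieOne (V : X → Model n) (η : X → (Model n →L[ℝ] ℝ)) (x : X) : Model n →L[ℝ] ℝ :=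
  dFun (fun z => η z (V z)) x + ofForm ((extD (fun z => toForm (η z)) x).curryLeft (V x))

/-- The `H`-twisted Courant bracket
`[X + ξ, Y + η]_H = [X, Y] + L_X η - L_Y ξ - ½ d (i_X η - i_Y ξ) + i_Y i_X H`. -/
def courant (H : X → Model n [⋀^Fin 3]→L[ℝ] ℝ) (a b : X → GT n) (x : X) : GT n :=
  (VectorField.mlieBracket 𝓘(ℝ, Model n) (fun z => (a z).1) (fun z => (b z).1) x,
    lieOne (fun z => (a z).1) (fun z => (b z).2) x
      - lieOne (fun z => (b z).1) (fun z => (a z).2) x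
      - (1 / 2 : ℝ) • dFun (fun z => (b z).2 (a z).1 - (a z).2 (b z).1) x
      + ofForm (((H x).curryLeft (a x).1).curryLeft (b x).1))

/-- The complex bilinear extension of the Courant bracket. -/
def courantC (H : X → Model n [⋀^Fin 3]→L[ℝ] ℝ) (a b : X → GTC n) (x : X) : GTC n :=
  (1 : ℂ) ⊗ₜ[ℝ] (courant H (fun z => reGT (a z)) (fun z => reGT (b z)) x
      - courant H (fun z => imGT (a z)) (fun z => imGT (b z)) x)
    + Complex.I ⊗ₜ[ℝ] (courant H (fun z => reGT (a z)) (fun z => imGT (b z)) x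
      + courant H (fun z => imGT (a z)) (fun z => reGT (b z)) x)

/-- `[L, L]_H ⊂ L` for a subbundle `L` of `(T_X ⊕ T_X^*) ⊗ ℂ`: for sections `a`, `b` of `L` which
are smooth at `x`, the value of `[a, b]_H` at `x` lies in `L_x`. -/
def Involutive (H : X → Model n [⋀^Fin 3]→L[ℝ] ℝ) (L : X → Submodule ℂ (GTC n)) : Prop :=
  ∀ a b : X → GTC n, (∀ z, a z ∈ L z) → (∀ z, b z ∈ L z) →
    ∀ x, GTCSmoothAt a x → GTCSmoothAt b x → courantC H a b x ∈ L x

/-- A closed real three-form. -/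
structure IsClosedThreeForm (H : X → Model n [⋀^Fin 3]→L[ℝ] ℝ) : Prop where
  smooth : ∀ x, FormSmoothAt H x
  closed : ∀ x, extD H x = 0

/-- The `+i`-eigenspace of an endomorphism of `T ⊕ T*`. -/
def eigL (J : GT n →ₗ[ℝ] GT n) : Submodule ℂ (GTC n) :=
  Module.End.eigenspace (J.baseChange ℂ : Module.End ℂ (GTC n)) Complex.I

/-- An (integrable, `H`-twisted) generalized complex structure on `X`. -/
structure IsGenComplex (H : X → Model n [⋀^Fin 3]→L[ℝ] ℝ) (J : X → GT n →ₗ[ℝ] GT n) : Prop where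
  smooth : EndSmooth J
  sq : ∀ x a, J x (J x a) = -a
  orth : ∀ x a b, pair (J x a) (J x b) = pair a b
  integrable : Involutive H fun x => eigL (J x)

/-- A generalized Hermitian metric: `G² = 1`, `GJ = JG`, and `⟨G·, ·⟩` is symmetric and positive
definite. -/
structure IsGenHermitian (J G : X → GT n →ₗ[ℝ] GT n) : Prop where
  smooth : EndSmooth G
  sq : ∀ x a, G x (G x a) = a
  comm : ∀ x a, G x (J x a) = J x (G x a)
  symm : ∀ x a b, pair (G x a) b = pair a (G x b)
  pos : ∀ x a, a ≠ 0 → 0 < pair (G x a) a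

/-- The norm of the Hermitian inner product `⟨G a, b̄⟩` on `(T ⊕ T*) ⊗ ℂ`. -/
def normG (G : GT n →ₗ[ℝ] GT n) (a : GTC n) : ℝ :=
  Real.sqrt (pairC (G.baseChange ℂ a) (conjGT a)).re

/-- `‖ε‖_{L^∞}`: the supremum over `x ∈ X` of the operator norm of `ε_x : L_x → L_x^*`. -/
def linfNorm (J G : X → GT n →ₗ[ℝ] GT n) (ε : X → GTC n →ₗ[ℂ] GTC n) : ENNReal :=
  ⨆ (x : X) (l : GTC n) (_ : l ∈ eigL (J x)),
    ENNReal.ofReal (normG (G x) (ε x l) / normG (G x) l)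

/-- A generalized Beltrami differential on `(X, J)`: a smooth section `ε` of `⋀² L*` which is
integrable, that is, `L_ε = (1 + ε)(L)` is closed under the Courant bracket. -/
structure IsBeltrami (H : X → Model n [⋀^Fin 3]→L[ℝ] ℝ) (J : X → GT n →ₗ[ℝ] GT n)
    (ε : X → GTC n →ₗ[ℂ] GTC n) : Prop where
  smooth : EndCSmooth ε
  two : ∀ x, IsTwoVector (eigL (J x)) (ε x)
  integrable : Involutive H fun x => defL (eigL (J x)) (ε x)

/-- `∂ = π_{j-1} ∘ d_H` on sections of `U^j`. -/
def del (H : X → Model n [⋀^Fin 3]→L[ℝ] ℝ) (L : X → Submodule ℂ (GTC n)) (j : ℤ)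
    (σ : X → MF n) (x : X) : MF n :=
  proj (L x) (j - 1) (dH H σ x)

/-- `∂̄ = π_{j+1} ∘ d_H` on sections of `U^j`. -/
def delbar (H : X → Model n [⋀^Fin 3]→L[ℝ] ℝ) (L : X → Submodule ℂ (GTC n)) (j : ℤ)
    (σ : X → MF n) (x : X) : MF n :=
  proj (L x) (j + 1) (dH H σ x)

/-- `[∂, ε·] = ∂ ∘ ε· - ε· ∘ ∂` on sections of `U^j` (`ε·` maps `U^j` to `U^{j+2}`). -/
def commDel (H : X → Model n [⋀^Fin 3]→L[ℝ] ℝ) (L : X → Submodule ℂ (GTC n))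
    (ε : X → GTC n →ₗ[ℂ] GTC n) (j : ℤ) (σ : X → MF n) (x : X) : MF n :=
  del H L (j + 2) (fun z => twoAct (ε z) (σ z)) x - twoAct (ε x) (del H L j σ x)

end

end GenCx

open GenCx

/-! Let `kerFil c L m`, "level `m`", consist of the forms killed by any `m` elements of `L`. For
complementary isotropic `L` and `M` it is the sum of the graded pieces of degree less than `m`,
where `U^j` is given degree `j + n`. So a form of level `k + 2` has zero component in degree `k + 1`
exactly if it has level `k + 1` (`mem_kerFil_iff_comp`). The filtration depends on `L` alone, while
the grading also depends on the conjugate of `L`; this is what makes the filtration easy to follow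
under deformation.

Two facts carry the proof. If `L` is isotropic and involutive, the twisted differential raises the
level by at most one (`dH_mem_kerFil`): the derived bracket formula (`cliff_cliff_dH`) expresses `b
· a · dρ` through the differentials of `a · b · ρ`, `b · ρ`, `a · ρ` and the action of the bracket
of `a` and `b`, so induction on the level applies. And `e^ε` is invertible and turns the action of
`a` into that of `a + ε(a)`, so it matches the filtrations of `L` and `L_ε` level by level
(`texp_mem_kerFil_iff`).

The extension map factors as `e^ε ∘ (1 - εε*) ∘ e^β` with `β = ε* - ε*εε*` in `⋀² L` (`extMap_eq`).
Since `β` contracts twice, `𝓔(σ)` and `e^ε τ`, where `τ = (1 - εε*)σ`, differ by a form of level `k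
- 1` for `L_ε`. Its differential does not reach degree `k + 1`. Hence `∂̄_t 𝓔(σ)` vanishes if and
only if `d(e^ε τ)` has level `k + 1` for `L_ε`, that is, if and only if `e^{-ε} d e^ε τ` has level
`k + 1` for `L`, that is, if and only if its component of degree `k + 1` is zero.

It remains to compute this component. The filtration by the conjugate of `L` shows that `d` lowers
the degree by at most one (`comp_dH_eq_zero`). Therefore only the terms of `e^{-ε} d e^ε τ` with at
most one factor `ε` contribute, and they add up to `[∂, ε]τ + ∂̄τ` (`comp_texp_neg`).

The norm bound enters through `disjoint_defL`: it makes `L_ε` and its conjugate complementary, so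
that the grading of `X_ε` exists. -/

namespace GenCx

noncomputable section

/-! ### Clifford modules with a polarization -/

section Clifford

variable {V S : Type*} [AddCommGroup V] [Module ℂ V] [AddCommGroup S] [Module ℂ S]

/-- The vectors killed by all `m`-fold products of elements of `L`. -/
def kerFil (c : V →ₗ[ℂ] Module.End ℂ S) (L : Submodule ℂ V) : ℕ → Submodule ℂ S
  | 0 => ⊥
  | m + 1 => ⨅ a ∈ L, (kerFil c L m).comap (c a)

lemma mem_kerFil_succ {c : V →ₗ[ℂ] Module.End ℂ S} {L : Submodule ℂ V} {m : ℕ} {ρ : S} :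
    ρ ∈ kerFil c L (m + 1) ↔ ∀ a ∈ L, c a ρ ∈ kerFil c L m := by
  simp [kerFil]

lemma mem_kerFil_one {c : V →ₗ[ℂ] Module.End ℂ S} {L : Submodule ℂ V} {ρ : S} :
    ρ ∈ kerFil c L 1 ↔ ∀ a ∈ L, c a ρ = 0 := by
  simp [kerFil]

lemma kerFil_le_succ (c : V →ₗ[ℂ] Module.End ℂ S) (L : Submodule ℂ V) (m : ℕ) :
    kerFil c L m ≤ kerFil c L (m + 1) := by
  induction m with
  | zero => simp [kerFil]
  | succ m ih =>
    intro ρ hρ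
    rw [mem_kerFil_succ] at hρ ⊢
    exact fun a ha => ih (hρ a ha)

lemma kerFil_mono (c : V →ₗ[ℂ] Module.End ℂ S) (L : Submodule ℂ V) : Monotone (kerFil c L) :=
  monotone_nat_of_le_succ (kerFil_le_succ c L)

/-- `⋀^m M` applied to the vectors killed by `L`. -/
def gradeNat (c : V →ₗ[ℂ] Module.End ℂ S) (L M : Submodule ℂ V) : ℕ → Submodule ℂ S
  | 0 => kerFil c L 1
  | m + 1 => ⨆ a ∈ M, (gradeNat c L M m).map (c a)

/-- The grading by the number of elements of `M`, indexed by the integers. -/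
def grade (c : V →ₗ[ℂ] Module.End ℂ S) (L M : Submodule ℂ V) : ℤ → Submodule ℂ S
  | .ofNat m => gradeNat c L M m
  | .negSucc _ => ⊥

/-- A Clifford module with two complementary isotropic subspaces and adapted dual bases. -/
structure Polarization (B : LinearMap.BilinForm ℂ V) (c : V →ₗ[ℂ] Module.End ℂ S)
    (L M : Submodule ℂ V) {d : ℕ} (l l' : Fin d → V) : Prop where
  cliff : ∀ a b, c a * c b + c b * c a = B a b • (1 : Module.End ℂ S)
  symm : ∀ a b, B a b = B b a
  mem_left : ∀ i, l i ∈ L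
  mem_right : ∀ i, l' i ∈ M
  iso_left : ∀ a ∈ L, ∀ b ∈ L, B a b = 0
  iso_right : ∀ a ∈ M, ∀ b ∈ M, B a b = 0
  dual : ∀ i j, B (l i) (l' j) = if i = j then 1 else 0
  expand : ∀ a, ∑ i, B (l' i) a • l i + ∑ i, B (l i) a • l' i = a

namespace Polarization

variable {B : LinearMap.BilinForm ℂ V} {c : V →ₗ[ℂ] Module.End ℂ S}
    {L M : Submodule ℂ V} {d : ℕ} {l l' : Fin d → V}

lemma apply_apply (h : Polarization B c L M l l') (a b : V) (ρ : S) :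
    c a (c b ρ) = B a b • ρ - c b (c a ρ) := by
  have := congrArg (fun f : Module.End ℂ S => f ρ) (h.cliff a b)
  simp only [LinearMap.add_apply, Module.End.mul_apply, LinearMap.smul_apply,
    Module.End.one_apply] at this
  exact eq_sub_of_add_eq this

lemma swap (h : Polarization B c L M l l') : Polarization B c M L l' l where
  cliff := h.cliff
  symm := h.symm
  mem_left := h.mem_right
  mem_right := h.mem_left
  iso_left := h.iso_right
  iso_right := h.iso_left
  dual i j := by rw [h.symm, h.dual]; simp [eq_comm]
  expand a := by rw [add_comm]; exact h.expand a

lemma expand_left (h : Polarization B c L M l l') {a : V} (ha : a ∈ L) :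
    ∑ i, B (l' i) a • l i = a := by
  conv_rhs => rw [← h.expand a]
  simp [h.iso_left _ (h.mem_left _) a ha]

lemma expand_right (h : Polarization B c L M l l') {a : V} (ha : a ∈ M) :
    ∑ i, B (l i) a • l' i = a := h.swap.expand_left ha

/-- The number operator. -/
def number (c : V →ₗ[ℂ] Module.End ℂ S) (l l' : Fin d → V) : Module.End ℂ S :=
  ∑ i, c (l' i) * c (l i)

lemma number_apply (ρ : S) : number c l l' ρ = ∑ i, c (l' i) (c (l i) ρ) := by
  simp [number, LinearMap.sum_apply]

/-- Moving `c a` to the left past `c (l i)` leaves the contraction `B (l i) a`, and past `c (l' i)`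
only a sign because `M` is isotropic. The contractions reassemble `a` by `expand_right`, so creation
by `M` adds one to the eigenvalue. -/
lemma number_raise (h : Polarization B c L M l l') {a : V} (ha : a ∈ M) (ρ : S) :
    number c l l' (c a ρ) = c a (number c l l' ρ) + c a ρ := by
  have h1 : ∀ i, c (l' i) (c (l i) (c a ρ)) =
      c a (c (l' i) (c (l i) ρ)) + c (B (l i) a • l' i) ρ := fun i => by
    rw [h.apply_apply (l i), map_sub, h.apply_apply (l' i) a,
      h.iso_right _ (h.mem_right i) _ ha]
    simp only [map_smul, LinearMap.smul_apply, zero_smul]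
    abel
  rw [number_apply, number_apply, map_sum, Finset.sum_congr rfl fun i _ => h1 i,
    Finset.sum_add_distrib, ← LinearMap.sum_apply, ← map_sum c, h.expand_right ha]

lemma number_gradeNat (h : Polarization B c L M l l') {m : ℕ} {u : S}
    (hu : u ∈ gradeNat c L M m) : number c l l' u = (m : ℂ) • u := by
  induction m generalizing u with
  | zero =>
    rw [gradeNat, mem_kerFil_one] at hu
    simp [number_apply, hu _ (h.mem_left _)]
  | succ m ih =>
    have : gradeNat c L M (m + 1) ≤
        LinearMap.ker (number c l l' - ((m + 1 : ℕ) : ℂ) • (1 : Module.End ℂ S)) := by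
      refine iSup₂_le fun a ha => ?_
      rintro _ ⟨v, hv, rfl⟩
      simp only [LinearMap.mem_ker, LinearMap.sub_apply, LinearMap.smul_apply,
        Module.End.one_apply]
      rw [h.number_raise ha, ih hv, map_smul]
      push_cast
      module
    simpa [sub_eq_zero] using this hu

lemma number_grade (h : Polarization B c L M l l') {j : ℤ} {u : S}
    (hu : u ∈ grade c L M j) : number c l l' u = (j : ℂ) • u := by
  cases j with
  | ofNat m => simpa using h.number_gradeNat hu
  | negSucc m =>
    have : u = 0 := by simpa [grade] using hu
    simp [this]

lemma raise {a : V} (ha : a ∈ M) {j : ℤ} {u : S} (hu : u ∈ grade c L M j) :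
    c a u ∈ grade c L M (j + 1) := by
  cases j with
  | ofNat m =>
    change c a u ∈ gradeNat c L M (m + 1)
    change u ∈ gradeNat c L M m at hu
    rw [gradeNat]
    exact Submodule.mem_iSup_of_mem a
      (Submodule.mem_iSup_of_mem ha (Submodule.mem_map_of_mem hu))
  | negSucc m =>
    have : u = 0 := by simpa [grade] using hu
    simp [this]

lemma lower (h : Polarization B c L M l l') {a : V} (ha : a ∈ L) {j : ℤ} {u : S}
    (hu : u ∈ grade c L M j) : c a u ∈ grade c L M (j - 1) := by
  cases j with
  | negSucc m =>
    have : u = 0 := by simpa [grade] using hu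
    simp [this]
  | ofNat m =>
    change u ∈ gradeNat c L M m at hu
    induction m generalizing u with
    | zero =>
      rw [gradeNat, mem_kerFil_one] at hu
      simp [hu a ha]
    | succ m ih =>
      have : gradeNat c L M (m + 1) ≤ (grade c L M m).comap (c a) := by
        refine iSup₂_le fun b hb => ?_
        rintro _ ⟨v, hv, rfl⟩
        rw [Submodule.mem_comap, h.apply_apply]
        refine Submodule.sub_mem _ (Submodule.smul_mem _ _ hv) ?_
        have := raise hb (ih hv)
        simpa using this
      simpa using this hu

lemma grade_le_kerFil (h : Polarization B c L M l l') (m : ℕ) :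
    grade c L M m ≤ kerFil c L (m + 1) := by
  induction m with
  | zero => exact le_rfl
  | succ m ih =>
    intro u hu
    rw [mem_kerFil_succ]
    intro a ha
    apply ih
    simpa using h.lower ha hu

/-- The graded pieces lie in eigenspaces of the number operator with distinct eigenvalues. -/
lemma iSupIndep_grade (h : Polarization B c L M l l') : iSupIndep (grade c L M) := by
  have := (number c l l').eigenspaces_iSupIndep.comp (f := fun j : ℤ => (j : ℂ)) Int.cast_injective
  refine this.mono fun j u hu => ?_
  rw [Function.comp_apply, Module.End.mem_eigenspace_iff]
  exact h.number_grade hu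

/-- Induction on the set of annihilators that may act nontrivially on `θ`. The relation between `l
i` and `l' i` splits `θ` into two terms whose relevant inner vectors are also killed by `l i`, so
`i` can be dropped. No dimension count for `S` is needed. -/
lemma mem_iSup_grade (h : Polarization B c L M l l') (s : Finset (Fin d)) (θ : S)
    (hθ : ∀ i ∉ s, c (l i) θ = 0) :
    θ ∈ ⨆ m : ℕ, ⨆ _ : m ≤ s.card, grade c L M m := by
  induction s using Finset.induction_on generalizing θ with
  | empty =>
    refine Submodule.mem_iSup_of_mem 0 (Submodule.mem_iSup_of_mem le_rfl ?_)
    change θ ∈ kerFil c L 1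
    rw [mem_kerFil_one]
    intro a ha
    rw [← h.expand_left ha]
    simp [hθ]
  | insert i s hi ih =>
    have key : θ = c (l' i) (c (l i) θ) + c (l i) (c (l' i) θ) := by
      rw [h.apply_apply (l i), h.dual]; simp
    rw [key]
    refine Submodule.add_mem _ ?_ ?_
    · have h1 := ih (c (l i) θ) (by
        intro j hj
        rw [h.apply_apply, h.iso_left _ (h.mem_left _) _ (h.mem_left _)]
        by_cases hij : j = i
        · subst hij
          -- With the same isotropic vector twice the relation reads `u = -u`, so the square of `c
          -- (l j)` is zero.
          have h2 := h.apply_apply (l j) (l j) θ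
          rw [h.iso_left _ (h.mem_left _) _ (h.mem_left _), zero_smul, zero_sub,
            eq_neg_iff_add_eq_zero, ← two_smul ℂ, smul_eq_zero] at h2
          simp [h2.resolve_left two_ne_zero]
        · rw [hθ j (by simp [hij, hj])]; simp)
      have h2 : (⨆ m : ℕ, ⨆ _ : m ≤ s.card, grade c L M m) ≤
          (⨆ m : ℕ, ⨆ _ : m ≤ (insert i s).card, grade c L M m).comap (c (l' i)) := by
        refine iSup₂_le fun m hm u hu => ?_
        refine Submodule.mem_iSup_of_mem (m + 1) (Submodule.mem_iSup_of_mem ?_ ?_)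
        · rw [Finset.card_insert_of_notMem hi]; omega
        · exact_mod_cast raise (h.mem_right i) hu
      exact h2 h1
    · have h1 := ih (c (l i) (c (l' i) θ)) (by
        intro j hj
        by_cases hij : j = i
        · subst hij
          have h2 := h.apply_apply (l j) (l j) (c (l' j) θ)
          rwa [h.iso_left _ (h.mem_left _) _ (h.mem_left _), zero_smul, zero_sub,
            eq_neg_iff_add_eq_zero, ← two_smul ℂ, smul_eq_zero_iff_right two_ne_zero] at h2
        · rw [h.apply_apply, h.iso_left _ (h.mem_left _) _ (h.mem_left _),
            h.apply_apply (l j) (l' i), h.dual, if_neg hij, hθ j (by simp [hij, hj])]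
          simp)
      refine (iSup₂_le fun m hm => ?_ :
        (⨆ m : ℕ, ⨆ _ : m ≤ s.card, grade c L M m) ≤ _) h1
      refine le_iSup₂_of_le m ?_ le_rfl
      rw [Finset.card_insert_of_notMem hi]; omega

lemma iSup_grade_le (h : Polarization B c L M l l') :
    ⨆ m : ℕ, ⨆ _ : m ≤ d, grade c L M m = ⊤ := by
  rw [eq_top_iff]
  intro θ _
  simpa using h.mem_iSup_grade Finset.univ θ (by simp)

lemma iSup_grade (h : Polarization B c L M l l') : ⨆ j, grade c L M j = ⊤ := by
  rw [eq_top_iff, ← h.iSup_grade_le]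
  exact iSup₂_le fun m _ => le_iSup (grade c L M) (m : ℤ)

/-- The degrees from `0` to `d` already span `S`, and a further piece is independent of them. -/
lemma grade_eq_bot (h : Polarization B c L M l l') {j : ℤ} (hj : (d : ℤ) < j) :
    grade c L M j = ⊥ := by
  have := h.iSupIndep_grade j
  rw [← le_bot_iff]
  refine this le_rfl ?_
  refine le_top.trans ?_
  rw [← h.iSup_grade_le]
  refine iSup₂_le fun m hm => le_iSup₂_of_le (m : ℤ) ?_ le_rfl
  omega

lemma isCompl_grade (h : Polarization B c L M l l') (j : ℤ) :
    IsCompl (grade c L M j) (⨆ (i : ℤ) (_ : i ≠ j), grade c L M i) := by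
  refine ⟨h.iSupIndep_grade j, codisjoint_iff_le_sup.2 ?_⟩
  rw [← h.iSup_grade]
  refine iSup_le fun i => ?_
  by_cases hi : i = j
  · exact hi ▸ le_sup_left
  · exact le_sup_of_le_right (le_iSup₂_of_le i hi le_rfl)

/-- The component of degree `j`. -/
def comp (h : Polarization B c L M l l') (j : ℤ) : Module.End ℂ S :=
  (grade c L M j).projection _ (h.isCompl_grade j)

lemma comp_mem (h : Polarization B c L M l l') (j : ℤ) (θ : S) : h.comp j θ ∈ grade c L M j :=
  Submodule.projection_apply_mem _ _

lemma comp_self (h : Polarization B c L M l l') {j : ℤ} {u : S} (hu : u ∈ grade c L M j) :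
    h.comp j u = u :=
  Submodule.projection_apply_of_mem_left _ hu

lemma comp_of_ne (h : Polarization B c L M l l') {i j : ℤ} (hij : i ≠ j) {u : S}
    (hu : u ∈ grade c L M i) : h.comp j u = 0 :=
  (Submodule.projection_apply_eq_zero_iff _).2
    (Submodule.mem_iSup_of_mem i (Submodule.mem_iSup_of_mem hij hu))

lemma sub_comp_mem (h : Polarization B c L M l l') (j : ℤ) (θ : S) :
    θ - h.comp j θ ∈ ⨆ (i : ℤ) (_ : i ≠ j), grade c L M i := by
  rw [← Submodule.projection_apply_eq_zero_iff (h.isCompl_grade j), map_sub, sub_eq_zero]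
  exact (h.comp_self (h.comp_mem j θ)).symm

/-- Linear maps that agree on homogeneous elements agree. -/
lemma hom_ext (h : Polarization B c L M l l') {W : Type*} [AddCommGroup W] [Module ℂ W]
    {f g : S →ₗ[ℂ] W} (hfg : ∀ j, ∀ u ∈ grade c L M j, f u = g u) : f = g := by
  refine LinearMap.ext fun θ => ?_
  have : (⨆ j, grade c L M j) ≤ LinearMap.eqLocus f g := iSup_le fun j u hu => hfg j u hu
  exact this (h.iSup_grade ▸ Submodule.mem_top)

/-- A homogeneous operator shifts the components. -/
lemma comp_shift (h : Polarization B c L M l l') {A : Module.End ℂ S} {s : ℤ}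
    (hA : ∀ j, ∀ u ∈ grade c L M j, A u ∈ grade c L M (j + s)) (j : ℤ) (θ : S) :
    h.comp j (A θ) = A (h.comp (j - s) θ) := by
  have : h.comp j ∘ₗ A = A ∘ₗ h.comp (j - s) := by
    refine h.hom_ext fun i u hu => ?_
    simp only [LinearMap.comp_apply]
    by_cases hi : i = j - s
    · subst hi
      rw [h.comp_self hu, h.comp_self]
      simpa using hA _ u hu
    · rw [h.comp_of_ne hi hu, h.comp_of_ne _ (hA _ u hu), map_zero]
      omega
  exact LinearMap.congr_fun this θ

lemma eq_sum_comp (h : Polarization B c L M l l') (θ : S) :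
    θ = ∑ m ∈ Finset.range (d + 1), h.comp m θ := by
  have : LinearMap.id = ∑ m ∈ Finset.range (d + 1), h.comp m := by
    refine h.hom_ext fun j u hu => ?_
    rw [LinearMap.sum_apply, LinearMap.id_apply]
    cases j with
    | negSucc m =>
      have : u = 0 := by simpa [grade] using hu
      simp [this]
    | ofNat m =>
      by_cases hm : m ≤ d
      · rw [Finset.sum_eq_single_of_mem m (by simp; omega)
          (fun i _ hi => h.comp_of_ne (by simpa using hi.symm) hu)]
        exact (h.comp_self hu).symm
      · have : u = 0 := by
          rw [h.grade_eq_bot (by simp; omega)] at hu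
          simpa using hu
        simp [this]
  have h2 := LinearMap.congr_fun this θ
  simpa [LinearMap.sum_apply] using h2

lemma eq_zero_of_left (h : Polarization B c L M l l') {j : ℤ} (hj : j ≠ 0) {u : S}
    (hu : u ∈ grade c L M j) (h0 : ∀ a ∈ L, c a u = 0) : u = 0 := by
  have := h.number_grade hu
  rw [number_apply, Finset.sum_eq_zero (fun i _ => by rw [h0 _ (h.mem_left i), map_zero])] at this
  exact (smul_eq_zero.1 this.symm).resolve_left (by exact_mod_cast hj)

/-- On a vector killed by `M` each `c (l' i) * c (l i)` is the identity, so the number operator acts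
by `d`; on degree `j` it acts by `j`. -/
lemma eq_zero_of_right (h : Polarization B c L M l l') {j : ℤ} (hj : j ≠ d) {u : S}
    (hu : u ∈ grade c L M j) (h0 : ∀ a ∈ M, c a u = 0) : u = 0 := by
  have := h.number_grade hu
  have h1 : ∀ i, c (l' i) (c (l i) u) = u := fun i => by
    rw [h.apply_apply, h.symm, h.dual, h0 _ (h.mem_right i)]; simp
  rw [number_apply, Finset.sum_congr rfl (fun i _ => h1 i), Finset.sum_const, Finset.card_univ,
    Fintype.card_fin, ← Nat.cast_smul_eq_nsmul ℂ, ← sub_eq_zero, ← sub_smul] at this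
  refine (smul_eq_zero.1 this).resolve_left ?_
  exact sub_ne_zero.2 (by exact_mod_cast hj.symm)

/-- Taking components commutes with `c a` up to a shift of degree, so by induction the component in
question is killed by `L`, which in nonzero degree forces it to vanish. With `mem_kerFil_of_comp`
this identifies level `m` with the sum of the degrees below `m`. -/
lemma comp_eq_zero_of_mem_kerFil (h : Polarization B c L M l l') {m : ℕ} {θ : S}
    (hθ : θ ∈ kerFil c L m) {j : ℤ} (hj : (m : ℤ) ≤ j) : h.comp j θ = 0 := by
  induction m generalizing θ j with
  | zero =>
    have : θ = 0 := by simpa [kerFil] using hθ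
    simp [this]
  | succ m ih =>
    refine h.eq_zero_of_left (j := j) (by omega) (h.comp_mem j θ) fun a ha => ?_
    have := h.comp_shift (A := c a) (s := -1) (fun j u hu => h.lower ha hu) (j - 1) θ
    rw [show j - 1 - -1 = j by ring] at this
    rw [← this]
    exact ih (mem_kerFil_succ.1 hθ a ha) (by omega)

lemma mem_kerFil_of_comp (h : Polarization B c L M l l') {m : ℕ} {θ : S}
    (hθ : ∀ j : ℤ, (m : ℤ) ≤ j → h.comp j θ = 0) : θ ∈ kerFil c L m := by
  rw [h.eq_sum_comp θ]
  refine Submodule.sum_mem _ fun i _ => ?_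
  by_cases hi : m ≤ i
  · rw [hθ i (by exact_mod_cast hi)]; exact Submodule.zero_mem _
  · exact kerFil_mono c L (by omega : i + 1 ≤ m) (h.grade_le_kerFil i (h.comp_mem i θ))

/-- Two consecutive levels differ by a single graded piece. This converts the vanishing of a `∂̄`
component into membership in the filtration, a condition that no longer mentions `M`. -/
lemma mem_kerFil_iff_comp (h : Polarization B c L M l l') {m : ℕ} {θ : S}
    (hθ : θ ∈ kerFil c L (m + 1)) : θ ∈ kerFil c L m ↔ h.comp m θ = 0 := by
  refine ⟨fun hm => h.comp_eq_zero_of_mem_kerFil hm le_rfl, fun h0 =>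
    h.mem_kerFil_of_comp fun j hj => ?_⟩
  rcases hj.eq_or_lt with rfl | hlt
  · exact h0
  · exact h.comp_eq_zero_of_mem_kerFil hθ (by push_cast; omega)

lemma kerFil_eq_top (h : Polarization B c L M l l') {m : ℕ} (hm : d < m) :
    kerFil c L m = ⊤ := by
  rw [eq_top_iff]
  intro θ _
  refine h.mem_kerFil_of_comp fun j hj => ?_
  have := h.comp_mem j θ
  rw [h.grade_eq_bot (by omega)] at this
  simpa using this

/-- After `m` creations the degree exceeds `d`, where nothing is left. -/
lemma grade_le_kerFil_right (h : Polarization B c L M l l') {j : ℤ} {m : ℕ}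
    (hj : (d : ℤ) < j + m) : grade c L M j ≤ kerFil c M m := by
  induction m generalizing j with
  | zero => rw [h.grade_eq_bot (by simpa using hj)]; exact bot_le
  | succ m ih =>
    intro u hu
    rw [mem_kerFil_succ]
    exact fun a ha => ih (by push_cast at hj; omega) (raise ha hu)

/-- The mirror image of `comp_eq_zero_of_mem_kerFil`: the filtration by `M` counts degrees downwards
from `d`. It serves to bound degrees from below. -/
lemma comp_eq_zero_of_mem_kerFil_right (h : Polarization B c L M l l') {m : ℕ} {θ : S}
    (hθ : θ ∈ kerFil c M m) {j : ℤ} (hj : j + m ≤ d) : h.comp j θ = 0 := by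
  induction m generalizing θ j with
  | zero =>
    have : θ = 0 := by simpa [kerFil] using hθ
    simp [this]
  | succ m ih =>
    push_cast at hj
    refine h.eq_zero_of_right (j := j) (by omega) (h.comp_mem j θ) fun a ha => ?_
    have := h.comp_shift (A := c a) (s := 1) (fun j u hu => raise ha hu) (j + 1) θ
    rw [show j + 1 - 1 = j by ring] at this
    rw [← this]
    exact ih (mem_kerFil_succ.1 hθ a ha) (by omega)

end Polarization

end Clifford

end

noncomputable section

/-! ### Truncated exponential series of nilpotent operators -/

section Exponential

/-- The factor `m` in `H` turns `1 / m!` into `1 / (m - 1)!`, and the sum is reindexed; `t N = 0`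
makes the truncation harmless, and `m = 0` contributes nothing to `h`. Both the ordinary and the
normal ordered exponential obey a rule of this shape. -/
lemma map_sum_inv_factorial {W W' : Type*} [AddCommGroup W] [Module ℂ W] [AddCommGroup W']
    [Module ℂ W'] (t : ℕ → W) (f g h : W →ₗ[ℂ] W')
    (H : ∀ m, f (t m) = g (t m) + (m : ℂ) • h (t (m - 1))) {N : ℕ} (hN : t N = 0) :
    f (∑ m ∈ Finset.range N, ((m.factorial : ℂ)⁻¹) • t m) =
      g (∑ m ∈ Finset.range N, ((m.factorial : ℂ)⁻¹) • t m) +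
        h (∑ m ∈ Finset.range N, ((m.factorial : ℂ)⁻¹) • t m) := by
  have h1 : ∑ m ∈ Finset.range N, ((m.factorial : ℂ)⁻¹) • t m =
      ∑ m ∈ Finset.range (N + 1), ((m.factorial : ℂ)⁻¹) • t m := by
    rw [Finset.sum_range_succ, hN, smul_zero, add_zero]
  have h2 : ∑ m ∈ Finset.range (N + 1), ((m.factorial : ℂ)⁻¹) • ((m : ℂ) • h (t (m - 1))) =
      h (∑ m ∈ Finset.range N, ((m.factorial : ℂ)⁻¹) • t m) := by
    rw [Finset.sum_range_succ', map_sum]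
    simp only [Nat.cast_zero, zero_smul, smul_zero, add_zero, map_smul, Nat.add_sub_cancel]
    refine Finset.sum_congr rfl fun m _ => ?_
    rw [smul_smul, Nat.factorial_succ]
    congr 1
    have : (m.factorial : ℂ) ≠ 0 := by exact_mod_cast m.factorial_ne_zero
    have : ((m : ℂ) + 1) ≠ 0 := by exact_mod_cast m.succ_ne_zero
    push_cast
    field_simp
  rw [← h2, h1, map_sum, map_sum, ← Finset.sum_add_distrib]
  refine Finset.sum_congr rfl fun m _ => ?_
  rw [map_smul, map_smul, H, smul_add]

variable {A : Type*} [Ring A] [Algebra ℂ A]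

/-- The truncated exponential series. -/
def texp (N : ℕ) (x : A) : A := ∑ m ∈ Finset.range N, ((m.factorial : ℂ)⁻¹) • x ^ m

lemma texp_neg_mul_texp {N : ℕ} {x : A} (hx : x ^ N = 0) : texp N (-x) * texp N x = 1 := by
  -- `IsNilpotent.exp` has rational coefficients; the rational action is obtained by restricting the
  -- complex one.
  let : Module ℚ A := Module.compHom A (algebraMap ℚ ℂ)
  have e : ∀ y : A, y ^ N = 0 → IsNilpotent.exp y = texp N y := fun y hy => by
    rw [IsNilpotent.exp_eq_sum hy, texp]
    refine Finset.sum_congr rfl fun m _ => ?_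
    change (algebraMap ℚ ℂ _) • (y ^ m) = _
    simp
  rw [← e x hx, ← e (-x) (by rw [neg_pow, hx, mul_zero])]
  exact IsNilpotent.exp_neg_mul_exp_self ⟨N, hx⟩

lemma texp_mul_texp_neg {N : ℕ} {x : A} (hx : x ^ N = 0) : texp N x * texp N (-x) = 1 := by
  have := texp_neg_mul_texp (x := -x) (N := N) (by rw [neg_pow, hx, mul_zero])
  rwa [neg_neg] at this

/-- Conjugation of `y` by `e^x` is the exponential of the commutator with `x`. Its series stops
after `y + z`, because `z = [x, y]` commutes with `x`. -/
lemma texp_mul {N : ℕ} {x y z : A} (hx : x ^ N = 0) (hy : x * y = y * x + z)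
    (hz : x * z = z * x) : texp N x * y = (y + z) * texp N x := by
  have H : ∀ m : ℕ, x ^ m * y = y * x ^ m + (m : ℂ) • (z * x ^ (m - 1)) := by
    intro m
    induction m with
    | zero => simp
    | succ m ih =>
      have h1 : x * z * x ^ (m - 1) * (m : ℂ) • 1 = z * x ^ m * (m : ℂ) • 1 := by
        rw [hz]
        cases m with
        | zero => simp
        | succ m => rw [Nat.add_sub_cancel, mul_assoc, mul_assoc, ← mul_assoc x, ← pow_succ',
            mul_assoc]
      rw [pow_succ', mul_assoc, ih, mul_add, ← mul_assoc, hy, add_mul, mul_assoc, ← pow_succ',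
        mul_smul_comm, ← mul_assoc, add_assoc, Nat.add_sub_cancel]
      congr 1
      rw [mul_smul_comm, mul_smul_comm, mul_one, mul_one] at h1
      rw [h1]
      push_cast
      rw [add_smul, one_smul, add_comm]
  have := map_sum_inv_factorial (fun m => x ^ m) (LinearMap.mulRight ℂ y) (LinearMap.mulLeft ℂ y)
    (LinearMap.mulLeft ℂ z) (fun m => by simpa using H m) hx
  rw [add_mul]
  exact this

end Exponential

/-! ### Clifford operators of endomorphisms and normal ordered exponentials -/

section TwoVectors

variable {V S : Type*} [AddCommGroup V] [Module ℂ V] [AddCommGroup S] [Module ℂ S]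

/-- Two families which are dual with respect to `B`. -/
structure IsDualPair (B : LinearMap.BilinForm ℂ V) {κ : Type*} [Fintype κ] (e f : κ → V) :
    Prop where
  left : ∀ a, ∑ i, B (f i) a • e i = a
  right : ∀ a, ∑ i, B (e i) a • f i = a

/-- The sum evaluates `Φ` on the canonical tensor of `B`, so the choice of dual families does not
matter. This permits the coordinate frame in definitions, an adapted frame in algebra, and a frame
constant in a chart for smoothness. -/
lemma IsDualPair.sum_eq {B : LinearMap.BilinForm ℂ V} {κ κ' : Type*} [Fintype κ] [Fintype κ']
    {e f : κ → V} {e' f' : κ' → V} (hs : ∀ a b, B a b = B b a) (h : IsDualPair B e f)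
    (h' : IsDualPair B e' f') {W : Type*} [AddCommGroup W] [Module ℂ W] (Φ : V →ₗ[ℂ] V →ₗ[ℂ] W) :
    ∑ i, Φ (e i) (f i) = ∑ j, Φ (e' j) (f' j) := by
  have h1 : ∀ i, Φ (e i) (f i) = ∑ j, B (f' j) (e i) • Φ (e' j) (f i) := fun i => by
    conv_lhs => rw [← h'.left (e i)]
    simp [LinearMap.sum_apply]
  rw [Finset.sum_congr rfl fun i _ => h1 i, Finset.sum_comm]
  refine Finset.sum_congr rfl fun j _ => ?_
  conv_rhs => rw [← h.right (f' j)]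
  simp only [map_sum, map_smul]
  exact Finset.sum_congr rfl fun i _ => by rw [hs]

/-- The Clifford action of a skew endomorphism. -/
def twoOp (c : V →ₗ[ℂ] Module.End ℂ S) {κ : Type*} [Fintype κ] (e f : κ → V) (A : V →ₗ[ℂ] V) :
    Module.End ℂ S := (1 / 2 : ℂ) • ∑ i, c (A (e i)) * c (f i)

/-- The terms of the normal ordered exponential of an endomorphism. -/
def nTerm (c : V →ₗ[ℂ] Module.End ℂ S) {κ : Type*} [Fintype κ] (e f : κ → V) (A : V →ₗ[ℂ] V) :
    ℕ → Module.End ℂ S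
  | 0 => 1
  | m + 1 => ∑ i, c (A (e i)) * nTerm c e f A m * c (f i)

/-- The normal ordered exponential of an endomorphism. -/
def nOrd (c : V →ₗ[ℂ] Module.End ℂ S) {κ : Type*} [Fintype κ] (e f : κ → V) (A : V →ₗ[ℂ] V)
    (N : ℕ) : Module.End ℂ S :=
  ∑ m ∈ Finset.range N, ((m.factorial : ℂ)⁻¹) • nTerm c e f A m

variable {B : LinearMap.BilinForm ℂ V} {c : V →ₗ[ℂ] Module.End ℂ S} {κ κ' : Type*} [Fintype κ]
  [Fintype κ'] {e f : κ → V} {e' f' : κ' → V} {A : V →ₗ[ℂ] V}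

lemma IsDualPair.twoOp_eq (hs : ∀ a b, B a b = B b a) (h : IsDualPair B e f)
    (h' : IsDualPair B e' f') : twoOp c e f A = twoOp c e' f' A := by
  have := h.sum_eq hs h'
    (((LinearMap.mul ℂ (Module.End ℂ S)).compl₁₂ (c ∘ₗ A) c))
  simp only [LinearMap.compl₁₂_apply, LinearMap.comp_apply, LinearMap.mul_apply'] at this
  rw [twoOp, twoOp, this]

lemma IsDualPair.nTerm_eq (hs : ∀ a b, B a b = B b a) (h : IsDualPair B e f)
    (h' : IsDualPair B e' f') (m : ℕ) : nTerm c e f A m = nTerm c e' f' A m := by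
  induction m with
  | zero => rfl
  | succ m ih =>
    have := h.sum_eq hs h'
      (((LinearMap.mul ℂ (Module.End ℂ S)).compl₁₂
        (LinearMap.mulRight ℂ (nTerm c e' f' A m) ∘ₗ c ∘ₗ A) c))
    simp only [LinearMap.compl₁₂_apply, LinearMap.comp_apply, LinearMap.mul_apply',
      LinearMap.mulRight_apply] at this
    rw [nTerm, nTerm, ih, this]

/-- Moving `c a` past the two factors gives two contractions. Since `A` is skew, each of them sums
to `c (A a)`, which cancels the factor one half in `twoOp`. -/
lemma IsDualPair.twoOp_mul
    (hc : ∀ a b, c a * c b + c b * c a = B a b • (1 : Module.End ℂ S)) (h : IsDualPair B e f)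
    (hA : ∀ a b, B (A a) b = -B a (A b)) (a : V) :
    twoOp c e f A * c a = c a * twoOp c e f A + c (A a) := by
  have hc' : ∀ a b, c a * c b = B a b • (1 : Module.End ℂ S) - c b * c a :=
    fun a b => eq_sub_of_add_eq (hc a b)
  have h1 : ∀ i, c (A (e i)) * c (f i) * c a =
      c a * (c (A (e i)) * c (f i)) + (c (B (f i) a • A (e i)) + c (B (e i) (A a) • f i)) := by
    intro i
    rw [mul_assoc, hc' (f i) a, mul_sub, ← mul_assoc, hc' (A (e i)) a, hA]
    simp only [map_smul, sub_mul, mul_smul_comm, mul_one, smul_mul_assoc, one_mul, neg_smul,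
      neg_mul, mul_assoc]
    abel
  have h2 : ∑ i, (c (B (f i) a • A (e i)) + c (B (e i) (A a) • f i)) = (2 : ℂ) • c (A a) := by
    rw [Finset.sum_add_distrib, ← map_sum c, ← map_sum c, h.right]
    simp only [← map_smul A]
    rw [← map_sum A, h.left, two_smul]
  rw [twoOp, smul_mul_assoc, Finset.sum_mul, Finset.sum_congr rfl fun i _ => h1 i,
    Finset.sum_add_distrib, h2, smul_add, smul_smul, mul_smul_comm, Finset.mul_sum]
  norm_num

namespace Polarization

variable {L M : Submodule ℂ V} {d : ℕ} {l l' : Fin d → V}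

lemma isDualPair (h : Polarization B c L M l l') :
    IsDualPair B (Sum.elim l l') (Sum.elim l' l) where
  left a := by simpa using h.expand a
  right a := by simpa using h.swap.expand a

lemma twoOp_of_left (h : Polarization B c L M l l') (he : IsDualPair B e f)
    (hA : ∀ a ∈ M, A a = 0) : twoOp c e f A = (1 / 2 : ℂ) • ∑ i, c (A (l i)) * c (l' i) := by
  rw [he.twoOp_eq h.symm h.isDualPair, twoOp]
  simp [hA _ (h.mem_right _)]

lemma twoOp_of_right (h : Polarization B c L M l l') (he : IsDualPair B e f)
    (hA : ∀ a ∈ L, A a = 0) : twoOp c e f A = (1 / 2 : ℂ) • ∑ i, c (A (l' i)) * c (l i) :=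
  h.swap.twoOp_of_left he hA

lemma nTerm_succ (h : Polarization B c L M l l') (he : IsDualPair B e f)
    (hA : ∀ a ∈ L, A a = 0) (m : ℕ) :
    nTerm c e f A (m + 1) = ∑ i, c (A (l' i)) * nTerm c e f A m * c (l i) := by
  rw [he.nTerm_eq h.symm h.isDualPair, he.nTerm_eq h.symm h.isDualPair, nTerm]
  simp [hA _ (h.mem_left _)]

lemma twoOp_raise (h : Polarization B c L M l l') (he : IsDualPair B e f)
    (hA : ∀ a ∈ M, A a = 0) (hA' : ∀ a, A a ∈ M) (j : ℤ) (u : S) (hu : u ∈ grade c L M j) :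
    twoOp c e f A u ∈ grade c L M (j + 2) := by
  rw [h.twoOp_of_left he hA, LinearMap.smul_apply, LinearMap.sum_apply]
  refine Submodule.smul_mem _ _ (Submodule.sum_mem _ fun i _ => ?_)
  have := raise (hA' (l i)) (raise (h.mem_right i) hu)
  rwa [add_assoc] at this

/-- The operator consists of two lowerings. The truncated subtraction is correct because `kerFil c L
0 = ⊥`: from levels `0` and `1` the result is zero. -/
lemma twoOp_mem_kerFil (h : Polarization B c L M l l') (he : IsDualPair B e f)
    (hA : ∀ a ∈ L, A a = 0) (hA' : ∀ a, A a ∈ L) {m : ℕ} {ρ : S} (hρ : ρ ∈ kerFil c L m) :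
    twoOp c e f A ρ ∈ kerFil c L (m - 2) := by
  have key : ∀ (m : ℕ) (ρ : S) (a : V), a ∈ L → ρ ∈ kerFil c L m → c a ρ ∈ kerFil c L (m - 1) := by
    intro m ρ a ha hρ
    cases m with
    | zero =>
      have : ρ = 0 := by simpa [kerFil] using hρ
      simp [this]
    | succ m => exact mem_kerFil_succ.1 hρ a ha
  rw [h.twoOp_of_right he hA, LinearMap.smul_apply, LinearMap.sum_apply]
  exact Submodule.smul_mem _ _ (Submodule.sum_mem _ fun i _ =>
    key _ _ _ (hA' (l' i)) (key _ _ _ (h.mem_left i) hρ))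

/-- Each factor raises the degree by two, and degrees range from `0` to `d`. -/
lemma twoOp_pow_eq_zero_of_left (h : Polarization B c L M l l') (he : IsDualPair B e f)
    (hA : ∀ a ∈ M, A a = 0) (hA' : ∀ a, A a ∈ M) {N : ℕ} (hN : d < 2 * N) :
    twoOp c e f A ^ N = 0 := by
  have key : ∀ (m : ℕ) (j : ℤ), ∀ u ∈ grade c L M j,
      (twoOp c e f A ^ m) u ∈ grade c L M (j + 2 * m) := by
    intro m
    induction m with
    | zero => intro j u hu; simpa using hu
    | succ m ih =>
      intro j u hu
      rw [pow_succ', Module.End.mul_apply]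
      have := h.twoOp_raise he hA hA' _ _ (ih j u hu)
      convert this using 2
      push_cast; ring
  refine h.hom_ext fun j u hu => ?_
  have h2 := key N j u hu
  cases j with
  | negSucc m =>
    have : u = 0 := by simpa [grade] using hu
    simp [this]
  | ofNat m =>
    rw [h.grade_eq_bot (by simp; omega)] at h2
    simpa using h2

lemma nTerm_mem_grade (h : Polarization B c L M l l') (he : IsDualPair B e f)
    (hA : ∀ a ∈ L, A a = 0) (hA' : ∀ a, A a ∈ M) (m : ℕ) (j : ℤ) (u : S)
    (hu : u ∈ grade c L M j) : nTerm c e f A m u ∈ grade c L M j := by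
  induction m generalizing j u with
  | zero => simpa [nTerm] using hu
  | succ m ih =>
    rw [h.nTerm_succ he hA, LinearMap.sum_apply]
    refine Submodule.sum_mem _ fun i _ => ?_
    simpa using raise (hA' (l' i)) (ih _ _ (h.lower (h.mem_left i) hu))

lemma nTerm_apply_eq_zero (h : Polarization B c L M l l') (he : IsDualPair B e f)
    (hA : ∀ a ∈ L, A a = 0) {m : ℕ} {ρ : S} (hρ : ρ ∈ kerFil c L m) :
    nTerm c e f A m ρ = 0 := by
  induction m generalizing ρ with
  | zero =>
    have : ρ = 0 := by simpa [kerFil] using hρ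
    simp [this]
  | succ m ih =>
    rw [h.nTerm_succ he hA, LinearMap.sum_apply]
    refine Finset.sum_eq_zero fun i _ => ?_
    simp [ih (mem_kerFil_succ.1 hρ _ (h.mem_left i))]

lemma nTerm_eq_zero (h : Polarization B c L M l l') (he : IsDualPair B e f)
    (hA : ∀ a ∈ L, A a = 0) {m : ℕ} (hm : d < m) : nTerm c e f A m = 0 :=
  LinearMap.ext fun _ => h.nTerm_apply_eq_zero he hA (h.kerFil_eq_top hm ▸ Submodule.mem_top)

lemma mul_eq (h : Polarization B c L M l l') (a b : V) :
    c a * c b = B a b • (1 : Module.End ℂ S) - c b * c a := eq_sub_of_add_eq (h.cliff a b)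

lemma mul_eq_of_right (h : Polarization B c L M l l') {a b : V} (ha : a ∈ M) (hb : b ∈ M) :
    c a * c b = - (c b * c a) := by
  rw [h.mul_eq, h.iso_right a ha b hb, zero_smul, zero_sub]

/-- In the `m`-th term the `m` creators `c (A _)` stand to the left of the `m` annihilators. Moving
`c a` with `a` in `M` to the left, it anticommutes with the creators and contracts with one
annihilator at a time. Each of the `m` contractions replaces a creator by `c (A a)`. -/
lemma nTerm_mul (h : Polarization B c L M l l') (he : IsDualPair B e f)
    (hA : ∀ a ∈ L, A a = 0) (hA' : ∀ a, A a ∈ M) {a : V} (ha : a ∈ M) (m : ℕ) :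
    nTerm c e f A m * c a =
      c a * nTerm c e f A m + (m : ℂ) • (c (A a) * nTerm c e f A (m - 1)) := by
  induction m with
  | zero => simp [nTerm]
  | succ m ih =>
    have h1 : ∀ i, c (A (l' i)) * nTerm c e f A m * c (l i) * c a =
        c (A (B (l i) a • l' i)) * nTerm c e f A m +
        (c a * (c (A (l' i)) * nTerm c e f A m * c (l i)) +
        (m : ℂ) • (c (A a) * (c (A (l' i)) * nTerm c e f A (m - 1) * c (l i)))) := by
      intro i
      rw [mul_assoc, h.mul_eq (l i) a, mul_sub, ← mul_assoc, mul_assoc (c (A (l' i))) _ (c a), ih]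
      simp only [mul_add, add_mul, mul_smul_comm, smul_mul_assoc, ← mul_assoc, map_smul, mul_one,
        h.mul_eq_of_right (hA' (l' i)) ha, h.mul_eq_of_right (hA' (l' i)) (hA' a), neg_mul,
        smul_neg]
      abel
    rw [h.nTerm_succ he hA, Finset.sum_mul, Finset.sum_congr rfl fun i _ => h1 i,
      Finset.sum_add_distrib, Finset.sum_add_distrib, ← Finset.sum_mul, ← map_sum c, ← map_sum A,
      h.expand_right ha, ← Finset.mul_sum, ← Finset.smul_sum, ← Finset.mul_sum,
      Nat.add_sub_cancel]
    cases m with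
    | zero => simp [add_comm]
    | succ m =>
      rw [Nat.add_sub_cancel, ← h.nTerm_succ he hA m]
      push_cast
      module

/-- The transposed rule: an annihilator enters from the left and contracts with the creators, which
produces the transpose `a'` of `A` at `a`. -/
lemma mul_nTerm (h : Polarization B c L M l l') (he : IsDualPair B e f)
    (hA : ∀ a ∈ L, A a = 0) {a a' : V} (ha : a ∈ L) (ha' : a' ∈ L)
    (haa : ∀ b, B a (A b) = B a' b) (m : ℕ) :
    c a * nTerm c e f A m =
      nTerm c e f A m * c a + (m : ℂ) • (nTerm c e f A (m - 1) * c a') := by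
  induction m with
  | zero => simp [nTerm]
  | succ m ih =>
    have h1 : ∀ i, c a * (c (A (l' i)) * nTerm c e f A m * c (l i)) =
        nTerm c e f A m * c (B (l' i) a' • l i) +
        (c (A (l' i)) * nTerm c e f A m * c (l i) * c a +
        (m : ℂ) • (c (A (l' i)) * nTerm c e f A (m - 1) * c (l i) * c a')) := by
      intro i
      rw [← mul_assoc, ← mul_assoc, h.mul_eq a, sub_mul, sub_mul, mul_assoc (c (A (l' i))) (c a),
        ih, haa, h.symm a']
      simp only [mul_add, add_mul, mul_smul_comm, smul_mul_assoc, one_mul, map_smul, mul_assoc,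
        h.swap.mul_eq_of_right ha (h.mem_left i), h.swap.mul_eq_of_right ha' (h.mem_left i),
        mul_neg, smul_neg]
      abel
    rw [h.nTerm_succ he hA, Finset.mul_sum, Finset.sum_congr rfl fun i _ => h1 i,
      Finset.sum_add_distrib, Finset.sum_add_distrib, ← Finset.mul_sum, ← map_sum c,
      h.expand_left ha', ← Finset.sum_mul, ← Finset.smul_sum, ← Finset.sum_mul,
      Nat.add_sub_cancel]
    cases m with
    | zero => simp [add_comm]
    | succ m =>
      rw [Nat.add_sub_cancel, ← h.nTerm_succ he hA m]
      push_cast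
      module

/-- Summing `nTerm_mul` shows that the normal ordered exponential of `A` extends `1 + A`
multiplicatively from `M`. Neither a logarithm nor an inverse of `1 + A` is needed. -/
lemma nOrd_mul (h : Polarization B c L M l l') (he : IsDualPair B e f)
    (hA : ∀ a ∈ L, A a = 0) (hA' : ∀ a, A a ∈ M) {a : V} (ha : a ∈ M) {N : ℕ} (hN : d < N) :
    nOrd c e f A N * c a = c (a + A a) * nOrd c e f A N := by
  have := map_sum_inv_factorial (nTerm c e f A) (LinearMap.mulRight ℂ (c a))
    (LinearMap.mulLeft ℂ (c a)) (LinearMap.mulLeft ℂ (c (A a)))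
    (fun m => by simpa using h.nTerm_mul he hA hA' ha m) (h.nTerm_eq_zero he hA hN)
  rw [map_add, add_mul]
  exact this

lemma mul_nOrd (h : Polarization B c L M l l') (he : IsDualPair B e f)
    (hA : ∀ a ∈ L, A a = 0) {a a' : V} (ha : a ∈ L) (ha' : a' ∈ L)
    (haa : ∀ b, B a (A b) = B a' b) {N : ℕ} (hN : d < N) :
    c a * nOrd c e f A N = nOrd c e f A N * c (a + a') := by
  have := map_sum_inv_factorial (nTerm c e f A) (LinearMap.mulLeft ℂ (c a))
    (LinearMap.mulRight ℂ (c a)) (LinearMap.mulRight ℂ (c a'))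
    (fun m => by simpa using h.mul_nTerm he hA ha ha' haa m) (h.nTerm_eq_zero he hA hN)
  rw [map_add, mul_add]
  exact this

lemma nOrd_mem_grade (h : Polarization B c L M l l') (he : IsDualPair B e f)
    (hA : ∀ a ∈ L, A a = 0) (hA' : ∀ a, A a ∈ M) (N : ℕ) {j : ℤ} {u : S}
    (hu : u ∈ grade c L M j) : nOrd c e f A N u ∈ grade c L M j := by
  rw [nOrd, LinearMap.sum_apply]
  exact Submodule.sum_mem _ fun m _ => Submodule.smul_mem _ _ (h.nTerm_mem_grade he hA hA' m j u hu)

lemma nOrd_of_mem_kerFil_one (h : Polarization B c L M l l') (he : IsDualPair B e f)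
    (hA : ∀ a ∈ L, A a = 0) {N : ℕ} (hN : 0 < N) {u : S}
    (hu : u ∈ kerFil c L 1) : nOrd c e f A N u = u := by
  obtain ⟨N, rfl⟩ : ∃ K, N = K + 1 := ⟨N - 1, by omega⟩
  rw [nOrd, LinearMap.sum_apply, Finset.sum_range_succ', Finset.sum_eq_zero]
  · simp [nTerm]
  · intro m _
    rw [LinearMap.smul_apply, h.nTerm_apply_eq_zero he hA (kerFil_mono c L (by omega) hu),
      smul_zero]

/-- Every term of the series beyond the first contains at least one double contraction. -/
lemma texp_twoOp_sub_mem (h : Polarization B c L M l l') (he : IsDualPair B e f)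
    (hA : ∀ a ∈ L, A a = 0) (hA' : ∀ a, A a ∈ L) {N : ℕ} (hN : 0 < N) {m : ℕ} {ρ : S}
    (hρ : ρ ∈ kerFil c L m) : texp N (twoOp c e f A) ρ - ρ ∈ kerFil c L (m - 2) := by
  obtain ⟨N, rfl⟩ : ∃ K, N = K + 1 := ⟨N - 1, by omega⟩
  have hpow : ∀ i, (twoOp c e f A ^ i) ρ ∈ kerFil c L m := by
    intro i
    induction i with
    | zero => simpa using hρ
    | succ i ih =>
      rw [pow_succ', Module.End.mul_apply]
      exact kerFil_mono c L (by omega) (h.twoOp_mem_kerFil he hA hA' ih)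
  rw [texp, LinearMap.sum_apply, Finset.sum_range_succ']
  simp only [Nat.factorial_zero, Nat.cast_one, inv_one, one_smul, pow_zero, Module.End.one_apply,
    add_sub_cancel_right]
  refine Submodule.sum_mem _ fun i _ => ?_
  rw [LinearMap.smul_apply, pow_succ', Module.End.mul_apply]
  exact Submodule.smul_mem _ _ (h.twoOp_mem_kerFil he hA hA' (hpow i))

end Polarization

end TwoVectors

end

noncomputable section

/-! ### Deformation of a polarization by skew maps -/

section Deformation

variable {V S : Type*} [AddCommGroup V] [Module ℂ V] [AddCommGroup S] [Module ℂ S]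
  {B : LinearMap.BilinForm ℂ V} {c : V →ₗ[ℂ] Module.End ℂ S} {κ : Type*} [Fintype κ]
  {e f : κ → V} {ε ε' : V →ₗ[ℂ] V} {L M : Submodule ℂ V} {d : ℕ} {l l' : Fin d → V}

/-- A skew endomorphism from `L` to `M`, extended by zero on `M`. -/
structure IsSkewMap (B : LinearMap.BilinForm ℂ V) (M : Submodule ℂ V) (ε : V →ₗ[ℂ] V) : Prop where
  mem : ∀ a, ε a ∈ M
  ker : ∀ a ∈ M, ε a = 0
  skew : ∀ a b, B (ε a) b = -B a (ε b)

/-- The operator which multiplies the elements of `M` by `1 - εε'`. -/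
def oneSubOp (c : V →ₗ[ℂ] Module.End ℂ S) (e f : κ → V) (ε η : V →ₗ[ℂ] V) (N : ℕ) :
    Module.End ℂ S := nOrd c e f (-(ε ∘ₗ η)) N

/-- The two-vector whose exponential corrects for the contractions in
`(1 + ε')(a₁) ⋯ (1 + ε')(a_k)`. -/
def contrMap (ε ε' : V →ₗ[ℂ] V) : V →ₗ[ℂ] V := ε' - ε' ∘ₗ ε ∘ₗ ε'

lemma IsSkewMap.contrMap (hε : IsSkewMap B M ε) (hε' : IsSkewMap B L ε') :
    IsSkewMap B L (contrMap ε ε') where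
  mem a := L.sub_mem (hε'.mem _) (hε'.mem _)
  ker a ha := by simp [GenCx.contrMap, hε'.ker a ha]
  skew a b := by
    simp only [GenCx.contrMap, LinearMap.sub_apply, LinearMap.comp_apply, map_sub, hε'.skew, hε.skew]
    ring

namespace Polarization

/-- The commutator of `ε` with `a` is `ε a`, which lies in `M`; a second commutator vanishes because
`ε` kills `M`. -/
lemma texp_twoOp_mul (h : Polarization B c L M l l') (he : IsDualPair B e f) {N : ℕ}
    (hε : IsSkewMap B M ε) (hN : d < 2 * N) (a : V) :
    texp N (twoOp c e f ε) * c a = c (a + ε a) * texp N (twoOp c e f ε) := by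
  rw [map_add]
  refine texp_mul (h.twoOp_pow_eq_zero_of_left he hε.ker hε.mem hN)
    (he.twoOp_mul h.cliff hε.skew a) ?_
  rw [he.twoOp_mul h.cliff hε.skew, hε.ker _ (hε.mem a), map_zero, add_zero]

/-- By `texp_twoOp_mul` the action of `a + ε a` on `e^ε ρ` is `e^ε` applied to `a · ρ`, so the
levels are compared one factor at a time. At level `0` the claim is the injectivity of `e^ε`. -/
lemma texp_mem_kerFil_iff (h : Polarization B c L M l l') (he : IsDualPair B e f) {N : ℕ}
    (hε : IsSkewMap B M ε) (hN : d < 2 * N) (m : ℕ) (ρ : S) :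
    texp N (twoOp c e f ε) ρ ∈ kerFil c (L.map (LinearMap.id + ε)) m ↔ ρ ∈ kerFil c L m := by
  induction m generalizing ρ with
  | zero =>
    simp only [kerFil, Submodule.mem_bot]
    refine ⟨fun h0 => ?_, fun h0 => by rw [h0, map_zero]⟩
    have := texp_neg_mul_texp (h.twoOp_pow_eq_zero_of_left he hε.ker hε.mem hN)
    have h1 := LinearMap.congr_fun this ρ
    rwa [Module.End.mul_apply, h0, map_zero, Module.End.one_apply, eq_comm] at h1
  | succ m ih =>
    rw [mem_kerFil_succ, mem_kerFil_succ]
    have h1 : ∀ a, c (a + ε a) (texp N (twoOp c e f ε) ρ) = texp N (twoOp c e f ε) (c a ρ) :=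
      fun a => (LinearMap.congr_fun (h.texp_twoOp_mul he hε hN a) ρ).symm
    constructor
    · intro H a ha
      rw [← ih, ← h1]
      exact H _ ⟨a, ha, rfl⟩
    · rintro H _ ⟨a, ha, rfl⟩
      rw [LinearMap.add_apply, LinearMap.id_apply, h1, ih]
      exact H a ha

/-- The component of degree `k + 1` of `e^{-ε} ∑_q δ_q`. -/
lemma comp_texp_neg (h : Polarization B c L M l l') (he : IsDualPair B e f)
    (hε : IsSkewMap B M ε) (N : ℕ) (k : ℤ) (δ : ℕ → S)
    (hδ : ∀ (q : ℕ) (j : ℤ), j < k + 2 * q - 1 → h.comp j (δ q) = 0) :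
    h.comp (k + 1) (texp (N + 2) (-twoOp c e f ε) (∑ q ∈ Finset.range (N + 2), δ q)) =
      h.comp (k + 1) (δ 1) - twoOp c e f ε (h.comp (k - 1) (δ 0)) + h.comp (k + 1) (δ 0) := by
  have hE := h.twoOp_raise he hε.ker hε.mem
  set E := twoOp c e f ε
  have hpow : ∀ (p : ℕ) (j : ℤ) (θ : S), h.comp j ((E ^ p) θ) = (E ^ p) (h.comp (j - 2 * p) θ) := by
    intro p
    induction p with
    | zero => intro j θ; simp
    | succ p ih =>
      intro j θ
      rw [pow_succ', Module.End.mul_apply, Module.End.mul_apply, h.comp_shift hE, ih]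
      congr 4
      push_cast; ring
  set Δ := ∑ q ∈ Finset.range (N + 2), δ q with hΔ
  -- A term of the exponential with `p` factors `ε` needs the component of `Δ` in degree `k + 1 -
  -- 2p`, whereas `δ q` starts in degree `k + 2q - 1`. So only `p + q ≤ 1` survives. The ranges `N +
  -- 2` guarantee that the terms with index `0` and `1` are present.
  have hhigh : ∀ p : ℕ, h.comp (k + 1 - 2 * ((p + 2 : ℕ) : ℤ)) Δ = 0 := by
    intro p
    rw [hΔ, map_sum]
    exact Finset.sum_eq_zero fun q _ => hδ q _ (by push_cast; omega)
  have h0 : h.comp (k + 1) Δ = h.comp (k + 1) (δ 1) + h.comp (k + 1) (δ 0) := by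
    rw [hΔ, map_sum, Finset.sum_range_succ', Finset.sum_range_succ', Finset.sum_eq_zero, zero_add]
    exact fun q _ => hδ _ _ (by push_cast; omega)
  have h1 : h.comp (k + 1 - 2) Δ = h.comp (k - 1) (δ 0) := by
    rw [show k + 1 - 2 = k - 1 by ring, hΔ, map_sum, Finset.sum_range_succ', Finset.sum_eq_zero,
      zero_add]
    exact fun q _ => hδ _ _ (by push_cast; omega)
  rw [texp, LinearMap.sum_apply, map_sum, Finset.sum_range_succ', Finset.sum_range_succ',
    Finset.sum_eq_zero, zero_add]
  · simp only [zero_add, Nat.factorial_zero, Nat.factorial_one,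
      Nat.cast_one, inv_one, one_smul, pow_zero, pow_one, Module.End.one_apply,
      LinearMap.neg_apply, map_neg, h.comp_shift hE, h0, h1]
    abel
  · intro p _
    rw [LinearMap.smul_apply, map_smul, neg_pow, Module.End.mul_apply]
    have : ∀ θ : S, ((-1 : Module.End ℂ S) ^ (p + 1 + 1)) θ = ((-1 : ℂ) ^ (p + 1 + 1)) • θ := by
      intro θ
      rcases neg_one_pow_eq_or (Module.End ℂ S) (p + 1 + 1) with h' | h'
      · rcases Nat.even_or_odd (p + 1 + 1) with h2 | h2
        · simp [h2.neg_one_pow]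
        · simp [h2.neg_one_pow]
      · rcases Nat.even_or_odd (p + 1 + 1) with h2 | h2
        · simp [h2.neg_one_pow]
        · simp [h2.neg_one_pow]
    rw [this, map_smul, hpow, hhigh, map_zero, smul_zero, smul_zero]

lemma oneSubOp_mul (h : Polarization B c L M l l') (he : IsDualPair B e f)
    (hε : IsSkewMap B M ε) (hε' : IsSkewMap B L ε') {N : ℕ} (hN : d < N) {a : V} (ha : a ∈ M) :
    oneSubOp c e f ε ε' N * c a = c (a - ε (ε' a)) * oneSubOp c e f ε ε' N := by
  have := h.nOrd_mul he (A := -(ε ∘ₗ ε')) (fun a ha => by simp [hε'.ker a ha])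
    (fun a => M.neg_mem (hε.mem _)) ha hN
  simpa [oneSubOp, sub_eq_add_neg] using this

/-- The transpose of `εε'` with respect to `B` is `ε'ε`, the two signs from skewness cancelling; so
`mul_nOrd` applies with `a' = -ε'(ε a)`. -/
lemma mul_oneSubOp (h : Polarization B c L M l l') (he : IsDualPair B e f)
    (hε : IsSkewMap B M ε) (hε' : IsSkewMap B L ε') {N : ℕ} (hN : d < N) {a : V} (ha : a ∈ L) :
    c a * oneSubOp c e f ε ε' N = oneSubOp c e f ε ε' N * c (a - ε' (ε a)) := by
  have := h.mul_nOrd he (A := -(ε ∘ₗ ε')) (a' := -ε' (ε a)) (fun a ha => by simp [hε'.ker a ha])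
    ha (L.neg_mem (hε'.mem _)) (fun b => by simp [hε.skew, hε'.skew]) hN
  simpa [oneSubOp, sub_eq_add_neg] using this

lemma oneSubOp_mem_grade (h : Polarization B c L M l l') (he : IsDualPair B e f)
    (hε : IsSkewMap B M ε) (hε' : IsSkewMap B L ε') (N : ℕ) {j : ℤ} {u : S} (hu : u ∈ grade c L M j) :
    oneSubOp c e f ε ε' N u ∈ grade c L M j :=
  h.nOrd_mem_grade he (fun a ha => by simp [hε'.ker a ha]) (fun a => M.neg_mem (hε.mem _)) N hu

lemma oneSubOp_of_mem_kerFil_one (h : Polarization B c L M l l') (he : IsDualPair B e f)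
    (hε' : IsSkewMap B L ε') {N : ℕ} (hN : 0 < N) {u : S} (hu : u ∈ kerFil c L 1) :
    oneSubOp c e f ε ε' N u = u :=
  h.nOrd_of_mem_kerFil_one he (fun a ha => by simp [hε'.ker a ha]) hN hu

lemma oneSubOp_mem_kerFil (h : Polarization B c L M l l') (he : IsDualPair B e f)
    (hε : IsSkewMap B M ε) (hε' : IsSkewMap B L ε') {N : ℕ} (hN : d < N) {m : ℕ} {ρ : S}
    (hρ : ρ ∈ kerFil c L m) :
    oneSubOp c e f ε ε' N ρ ∈ kerFil c L m := by
  induction m generalizing ρ with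
  | zero =>
    have : ρ = 0 := by simpa [kerFil] using hρ
    simp [this]
  | succ m ih =>
    rw [mem_kerFil_succ] at hρ ⊢
    intro a ha
    rw [← Module.End.mul_apply, h.mul_oneSubOp he hε hε' hN ha, Module.End.mul_apply]
    exact ih (hρ _ (L.sub_mem ha (hε'.mem _)))

/-- The inner exponential adds `contrMap ε ε' a = ε' a - ε'(ε(ε' a))` to `a`. By `mul_oneSubOp` this
is exactly what `1 - εε'` turns into `ε' a` when it is moved past; this explains the choice of
`contrMap`. -/
lemma oneSubOp_texp_mul (h : Polarization B c L M l l') (he : IsDualPair B e f)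
    (hε : IsSkewMap B M ε) (hε' : IsSkewMap B L ε') {N K : ℕ} (hN : d < N) (hK : d < 2 * K)
    {a : V} (ha : a ∈ M) :
    oneSubOp c e f ε ε' N * texp K (twoOp c e f (contrMap ε ε')) * c a =
      c (a - ε (ε' a) + ε' a) *
        (oneSubOp c e f ε ε' N * texp K (twoOp c e f (contrMap ε ε'))) := by
  rw [mul_assoc, h.swap.texp_twoOp_mul he (hε.contrMap hε') hK, ← mul_assoc, map_add, mul_add,
    h.oneSubOp_mul he hε hε' hN ha]
  have := h.mul_oneSubOp he hε hε' hN (hε'.mem a)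
  rw [show contrMap ε ε' a = ε' a - ε' (ε (ε' a)) from rfl, ← this, ← add_mul, ← map_add,
    mul_assoc]

/-- Applying `1 + ε` to `a - ε(ε' a) + ε' a` gives `a + ε' a`: the image of `ε' a` cancels the
correction, and `ε` kills the remaining terms, which lie in `M`. So the triple product has the
multiplicative rule of the extension map. -/
lemma texp_oneSubOp_texp_mul (h : Polarization B c L M l l') (he : IsDualPair B e f)
    (hε : IsSkewMap B M ε) (hε' : IsSkewMap B L ε') {N K : ℕ} (hN : d < N) (hK : d < 2 * K)
    {a : V} (ha : a ∈ M) :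
    texp K (twoOp c e f ε) * (oneSubOp c e f ε ε' N * texp K (twoOp c e f (contrMap ε ε'))) * c a =
      c (a + ε' a) * (texp K (twoOp c e f ε) *
        (oneSubOp c e f ε ε' N * texp K (twoOp c e f (contrMap ε ε')))) := by
  rw [mul_assoc, h.oneSubOp_texp_mul he hε hε' hN hK ha, ← mul_assoc, h.texp_twoOp_mul he hε hK,
    mul_assoc]
  congr 2
  simp only [map_add, map_sub, hε.ker a ha, hε.ker _ (hε.mem _)]
  abel

lemma texp_contrMap_of_mem_kerFil_one (h : Polarization B c L M l l') (he : IsDualPair B e f)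
    (hε : IsSkewMap B M ε) (hε' : IsSkewMap B L ε') {K : ℕ} (hK : 0 < K) {u : S} (hu : u ∈ kerFil c L 1) :
    texp K (twoOp c e f (contrMap ε ε')) u = u := by
  have := h.texp_twoOp_sub_mem he (hε.contrMap hε').ker (hε.contrMap hε').mem hK hu
  simpa [kerFil, sub_eq_zero] using this

end Polarization

end Deformation

end

noncomputable section

/-! ### Frames adapted to complementary isotropic subspaces -/

section Frames

variable {V S : Type*} [AddCommGroup V] [Module ℂ V] [FiniteDimensional ℂ V] [AddCommGroup S]
  [Module ℂ S] {B : LinearMap.BilinForm ℂ V} {c : V →ₗ[ℂ] Module.End ℂ S} {L M : Submodule ℂ V}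

omit [FiniteDimensional ℂ V] in
lemma flip_domRestrict_injective (hnd : ∀ a, (∀ b, B b a = 0) → a = 0)
    (hM : ∀ a ∈ M, ∀ b ∈ M, B a b = 0) (hLM : IsCompl L M) :
    Function.Injective (B.domRestrict₁₂ L M).flip := by
  rw [injective_iff_map_eq_zero]
  intro m hm
  ext1
  refine hnd _ fun b => ?_
  obtain ⟨p, hp, q, hq, rfl⟩ := Submodule.mem_sup.1
    (hLM.sup_eq_top ▸ Submodule.mem_top : b ∈ L ⊔ M)
  have := LinearMap.congr_fun hm ⟨p, hp⟩
  simp only [LinearMap.flip_apply, LinearMap.domRestrict₁₂_apply, LinearMap.zero_apply] at this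
  rw [map_add, LinearMap.add_apply, this, hM q hq _ m.2, add_zero]

/-- Nondegeneracy embeds `M` into the dual of `L` and `L` into the dual of `M`. So both have half
the dimension, `M` is the dual of `L`, and a basis of `L` has a dual basis in `M`. -/
lemma exists_polarization_of_isCompl
    (hc : ∀ a b, c a * c b + c b * c a = B a b • (1 : Module.End ℂ S))
    (hs : ∀ a b, B a b = B b a) (hnd : ∀ a, (∀ b, B b a = 0) → a = 0) {d : ℕ}
    (hd : Module.finrank ℂ V = 2 * d) (hL : ∀ a ∈ L, ∀ b ∈ L, B a b = 0)
    (hM : ∀ a ∈ M, ∀ b ∈ M, B a b = 0) (hLM : IsCompl L M) :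
    Module.finrank ℂ L = d ∧ Module.finrank ℂ M = d ∧
    ∃ l l' : Fin d → V, Polarization B c L M l l' := by
  have h1 := flip_domRestrict_injective hnd hM hLM
  have h2 := flip_domRestrict_injective hnd hL hLM.symm
  have le1 := LinearMap.finrank_le_finrank_of_injective h1
  have le2 := LinearMap.finrank_le_finrank_of_injective h2
  rw [Subspace.dual_finrank_eq] at le1 le2
  have hadd := Submodule.finrank_add_eq_of_isCompl hLM
  have hL' : Module.finrank ℂ L = d := by omega
  have hM' : Module.finrank ℂ M = d := by omega
  refine ⟨hL', hM', ?_⟩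
  have heq : Module.finrank ℂ M = Module.finrank ℂ (Module.Dual ℂ L) := by
    rw [Subspace.dual_finrank_eq, hL', hM']
  let φ : M ≃ₗ[ℂ] Module.Dual ℂ L := LinearMap.linearEquivOfInjective _ h1 heq
  let b := Module.finBasisOfFinrankEq ℂ L hL'
  have hφ : ∀ (m : M) (p : L), φ m p = B p m := fun m p => rfl
  have hb : ∀ (p : L) i, B p (φ.symm (b.coord i) : M) = b.coord i p := fun p i => by
    rw [← hφ, LinearEquiv.apply_symm_apply]
  refine ⟨fun i => b i, fun i => φ.symm (b.coord i), hc, hs, fun i => (b i).2,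
    fun i => (φ.symm (b.coord i)).2, hL, hM, fun i j => ?_, fun a => ?_⟩
  · rw [hb]
    simp [Finsupp.single_apply]
  · obtain ⟨p, hp, q, hq, rfl⟩ := Submodule.mem_sup.1
      (hLM.sup_eq_top ▸ Submodule.mem_top : a ∈ L ⊔ M)
    congr 1
    · have : ∀ i, B (φ.symm (b.coord i) : M) (p + q) = b.repr ⟨p, hp⟩ i := fun i => by
        rw [map_add, hM _ (φ.symm (b.coord i)).2 q hq, add_zero, hs]
        exact hb ⟨p, hp⟩ i
      simp only [this]
      have h3 := congrArg Subtype.val (b.sum_repr ⟨p, hp⟩)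
      simpa only [Submodule.coe_sum, Submodule.coe_smul] using h3
    · have h0 : ∑ i, B (b i : V) q • φ.symm (b.coord i) = ⟨q, hq⟩ := by
        apply φ.injective
        refine b.ext fun j => ?_
        rw [map_sum, LinearMap.sum_apply, hφ]
        simp [Finsupp.single_apply]
      have h3 := congrArg Subtype.val h0
      simp only [Submodule.coe_sum, Submodule.coe_smul] at h3
      refine Eq.trans (Finset.sum_congr rfl fun i _ => ?_) h3
      rw [map_add, hL _ (b i).2 p hp, zero_add]

end Frames

variable {n : ℕ}

/-! ### The Clifford relation -/

lemma contr_contr (v : Model n) (ρ : MF n) : contr v (contr v ρ) = 0 := by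
  funext k
  ext w
  have := ContinuousAlternatingMap.curryLeft_same (ρ (k + 2)) v
  exact congrArg (fun f => f w) this

lemma wedgeOne_wedgeOne (ξ : Model n →L[ℝ] ℝ) (ρ : MF n) : wedgeOne ξ (wedgeOne ξ ρ) = 0 := by
  funext k
  match k with
  | 0 => rfl
  | 1 =>
    simp [wedgeOne]
    ext v
    simp [ContinuousAlternatingMap.alternatizeUncurryFin_apply]
  | k + 2 =>
    set ξc := Complex.ofRealCLM.comp ξ with hξc
    -- `ξ ⊗ ξ ⊗ ρ` is symmetric in its first two slots, so its double alternatization vanishes.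
    let F : Model n →L[ℝ] Model n →L[ℝ] Model n [⋀^Fin k]→L[ℝ] ℂ :=
      ξ.smulRight (ξc.smulRight (ρ k))
    have hF := ContinuousAlternatingMap.alternatizeUncurryFin_alternatizeUncurryFinCLM_comp_of_symmetric
      (f := F) (fun x y => by ext w; simp [F, hξc]; ring)
    rw [MF.zero_apply, ← hF]
    simp only [wedgeOne]
    congr 1
    ext v w
    simp [F, ContinuousAlternatingMap.alternatizeUncurryFin_apply, hξc, Finset.mul_sum]

/-- In the alternating sum for `ξ ∧ ρ` the term in which `ξ` takes `v` gives the right-hand side;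
the others cancel against `ξ ∧ i_v ρ`. -/
lemma contr_wedgeOne (v : Model n) (ξ : Model n →L[ℝ] ℝ) (ρ : MF n) :
    contr v (wedgeOne ξ ρ) + wedgeOne ξ (contr v ρ) = (ξ v : ℂ) • ρ := by
  funext k
  cases k with
  | zero =>
    ext w
    simp [contr, wedgeOne, ContinuousAlternatingMap.alternatizeUncurryFin_apply]
  | succ k =>
    ext w
    have hr : ∀ j : Fin (k + 1), (j.succ).removeNth (Matrix.vecCons v w) =
        (Matrix.vecCons v (j.removeNth w) : Fin (k + 1) → Model n) := fun j => by
      funext i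
      refine Fin.cases ?_ (fun i => ?_) i <;> simp [Fin.removeNth_apply]
    simp only [contr, wedgeOne, MF.add_apply, MF.smul_apply,
      ContinuousAlternatingMap.add_apply, ContinuousAlternatingMap.curryLeft_apply_apply,
      ContinuousAlternatingMap.alternatizeUncurryFin_apply, ContinuousAlternatingMap.smul_apply]
    rw [Fin.sum_univ_succ, add_assoc, ← Finset.sum_add_distrib, Finset.sum_eq_zero, add_zero]
    · simp
    · intro j _
      rw [hr]
      simp [pow_succ]

lemma cliffR_apply (a : GT n) (ρ : MF n) : cliffR a ρ = contr a.1 ρ + wedgeOne a.2 ρ := rfl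

lemma cliffR_sq (a : GT n) : cliffR a * cliffR a = (a.2 a.1 : ℂ) • (1 : Module.End ℂ (MF n)) := by
  refine LinearMap.ext fun ρ => ?_
  rw [Module.End.mul_apply, cliffR_apply, cliffR_apply]
  have h1 : ∀ τ τ' : MF n, contr a.1 (τ + τ') = contr a.1 τ + contr a.1 τ' := by
    intro τ τ'; funext k; ext w; simp [contr]
  have h2 : ∀ τ τ' : MF n, wedgeOne a.2 (τ + τ') = wedgeOne a.2 τ + wedgeOne a.2 τ' := by
    intro τ τ'
    have := (cliffR ((0, a.2) : GT n)).map_add τ τ'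
    have hc : ∀ τ : MF n, cliffR ((0, a.2) : GT n) τ = wedgeOne a.2 τ := by
      intro τ
      rw [cliffR_apply]
      have : contr (0 : Model n) τ = 0 := by funext k; ext w; simp [contr]
      simp [this]
    rwa [hc, hc, hc] at this
  rw [h1, h2, contr_contr, wedgeOne_wedgeOne, zero_add, add_zero, contr_wedgeOne]
  rfl

lemma pair_apply (a b : GT n) : pair a b = a.2 b.1 + b.2 a.1 := rfl

lemma pair_comm (a b : GT n) : pair a b = pair b a := by simp only [pair_apply]; ring

/-- Polarization of `cliffR_sq`. No factor `2` appears, because the pairing of `X + ξ` with itself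
is already `2 ξ(X)`. -/
lemma cliffR_mul_add (a b : GT n) :
    cliffR a * cliffR b + cliffR b * cliffR a = (pair a b : ℂ) • (1 : Module.End ℂ (MF n)) := by
  have h1 := cliffR_sq (a + b)
  have ha := cliffR_sq a
  have hb := cliffR_sq b
  rw [map_add, add_mul, mul_add, mul_add, ha, hb] at h1
  have : ((a + b).2 (a + b).1 : ℂ) = (a.2 a.1 : ℂ) + (b.2 b.1 : ℂ) + (pair a b : ℂ) := by
    simp only [pair_apply, Prod.fst_add, Prod.snd_add, add_apply, map_add]
    push_cast; ring
  rw [this, add_smul, add_smul] at h1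
  rw [← sub_eq_zero] at h1 ⊢
  rw [← h1]
  abel

lemma cliff_tmul (z : ℂ) (a : GT n) : cliff (z ⊗ₜ[ℝ] a) = z • cliffR a := by
  simp [cliff]

lemma pairC_tmul (z w : ℂ) (a b : GT n) :
    pairC (z ⊗ₜ[ℝ] a) (w ⊗ₜ[ℝ] b) = z * w * (pair a b : ℂ) := by
  simp [pairC, LinearMap.BilinForm.baseChange_tmul, mul_comm]

lemma cliff_mul_add (a b : GTC n) :
    cliff a * cliff b + cliff b * cliff a = pairC a b • (1 : Module.End ℂ (MF n)) := by
  induction a using TensorProduct.induction_on with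
  | zero => simp
  | add a a' ha ha' =>
    simp only [map_add, add_mul, mul_add, LinearMap.add_apply, add_smul, ← ha, ← ha']
    abel
  | tmul z a =>
    induction b using TensorProduct.induction_on with
    | zero => simp
    | add b b' hb hb' =>
      simp only [map_add, add_mul, mul_add, add_smul, ← hb, ← hb']
      abel
    | tmul w b =>
      rw [cliff_tmul, cliff_tmul, pairC_tmul, mul_smul, ← cliffR_mul_add]
      simp only [smul_mul_assoc, mul_smul_comm, smul_add, smul_smul, mul_comm w z]

lemma pairC_comm (a b : GTC n) : pairC a b = pairC b a := by
  induction a using TensorProduct.induction_on with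
  | zero => simp
  | add a a' ha ha' => simp only [map_add, LinearMap.add_apply, ha, ha']
  | tmul z a =>
    induction b using TensorProduct.induction_on with
    | zero => simp
    | add b b' hb hb' => simp only [map_add, LinearMap.add_apply, hb, hb']
    | tmul w b => rw [pairC_tmul, pairC_tmul, pair_comm, mul_comm z w]

/-! ### Complex conjugation -/

lemma conjGT_tmul (z : ℂ) (a : GT n) :
    conjGT (z ⊗ₜ[ℝ] a) = (starRingEnd ℂ z) ⊗ₜ[ℝ] a := rfl

lemma conjGT_conjGT (a : GTC n) : conjGT (conjGT a) = a := by
  induction a using TensorProduct.induction_on with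
  | zero => simp
  | add a a' ha ha' => rw [map_add, map_add, ha, ha']
  | tmul z a => simp [conjGT_tmul]

lemma mem_map_conjGT {L : Submodule ℂ (GTC n)} {a : GTC n} :
    a ∈ L.map conjGT ↔ conjGT a ∈ L := by
  constructor
  · rintro ⟨b, hb, rfl⟩
    rwa [conjGT_conjGT]
  · exact fun h => ⟨_, h, conjGT_conjGT a⟩

lemma pairC_conjGT (a b : GTC n) :
    pairC (conjGT a) (conjGT b) = starRingEnd ℂ (pairC a b) := by
  induction a using TensorProduct.induction_on with
  | zero => simp
  | add a a' ha ha' => simp only [map_add, LinearMap.add_apply, ha, ha']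
  | tmul z a =>
    induction b using TensorProduct.induction_on with
    | zero => simp
    | add b b' hb hb' => simp only [map_add, hb, hb']
    | tmul w b => simp [conjGT_tmul, pairC_tmul]

lemma reGT_tmul (z : ℂ) (a : GT n) : reGT (z ⊗ₜ[ℝ] a) = z.re • a := by
  simp [reGT]

lemma imGT_tmul (z : ℂ) (a : GT n) : imGT (z ⊗ₜ[ℝ] a) = z.im • a := by
  simp [imGT]

lemma re_add_im (a : GTC n) : (1 : ℂ) ⊗ₜ[ℝ] reGT a + Complex.I ⊗ₜ[ℝ] imGT a = a := by
  induction a using TensorProduct.induction_on with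
  | zero => simp
  | add a a' ha ha' =>
    conv_rhs => rw [← ha, ← ha']
    simp only [map_add, TensorProduct.tmul_add]
    abel
  | tmul z a =>
    rw [reGT_tmul, imGT_tmul, TensorProduct.tmul_smul, TensorProduct.tmul_smul,
      TensorProduct.smul_tmul', TensorProduct.smul_tmul', ← TensorProduct.add_tmul]
    congr 1
    simp

lemma reGT_conjGT (a : GTC n) : reGT (conjGT a) = reGT a := by
  induction a using TensorProduct.induction_on with
  | zero => simp
  | add a a' ha ha' => simp only [map_add, ha, ha']
  | tmul z a => simp [conjGT_tmul, reGT_tmul]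

lemma imGT_conjGT (a : GTC n) : imGT (conjGT a) = -imGT a := by
  induction a using TensorProduct.induction_on with
  | zero => simp
  | add a a' ha ha' => simp only [map_add, ha, ha']; abel
  | tmul z a =>
    rw [conjGT_tmul, imGT_tmul, imGT_tmul, Complex.conj_im]
    exact neg_smul z.im a

lemma smul_one_tmul (z : ℂ) (a : GT n) : z • ((1 : ℂ) ⊗ₜ[ℝ] a) = z ⊗ₜ[ℝ] a := by
  rw [TensorProduct.smul_tmul']; simp

/-! ### Dual pairs and adapted frames -/

lemma isDualPair_complexify {κ : Type*} [Fintype κ] {e f : κ → GT n}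
    (h1 : ∀ a, ∑ i, pair (f i) a • e i = a) (h2 : ∀ a, ∑ i, pair (e i) a • f i = a) :
    IsDualPair pairC (fun i => (1 : ℂ) ⊗ₜ[ℝ] e i) (fun i => (1 : ℂ) ⊗ₜ[ℝ] f i) := by
  have key : ∀ (e f : κ → GT n), (∀ a, ∑ i, pair (f i) a • e i = a) → ∀ a : GTC n,
      ∑ i, pairC ((1 : ℂ) ⊗ₜ[ℝ] f i) a • ((1 : ℂ) ⊗ₜ[ℝ] e i) = a := by
    intro e f h a
    induction a using TensorProduct.induction_on with
    | zero => simp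
    | add a a' ha ha' =>
      conv_rhs => rw [← ha, ← ha']
      simp only [map_add, add_smul, Finset.sum_add_distrib]
    | tmul z a =>
      conv_rhs => rw [← h a, TensorProduct.tmul_sum]
      refine Finset.sum_congr rfl fun i _ => ?_
      rw [pairC_tmul, smul_one_tmul, TensorProduct.tmul_smul, TensorProduct.smul_tmul']
      congr 1
      simp [mul_comm]
  exact ⟨key e f h1, key f e h2⟩

lemma sum_pair_vecE_covE (a : GT n) :
    ∑ i, pair (covE i) a • vecE i + ∑ i, pair (vecE i) a • covE i = a := by
  refine Prod.ext ?_ ?_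
  · simp only [pair_apply, vecE, covE, Prod.fst_add, Prod.fst_sum, Prod.smul_fst, smul_zero,
      Finset.sum_const_zero, add_zero, map_zero]
    ext j
    simp [Pi.single_apply]
  · simp only [pair_apply, vecE, covE, Prod.snd_add, Prod.snd_sum, Prod.smul_snd, smul_zero,
      Finset.sum_const_zero, zero_add, zero_apply]
    refine ContinuousLinearMap.ext fun v => ?_
    conv_rhs => rw [← (EuclideanSpace.basisFun (Fin (2 * n)) ℝ).sum_repr v]
    simp [mul_comm]

/-- The coordinate frame of `T ⊕ T*`. -/
def coordE : Fin (2 * n) ⊕ Fin (2 * n) → GT n := Sum.elim vecE covE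

/-- The frame dual to `coordE`. -/
def coordF : Fin (2 * n) ⊕ Fin (2 * n) → GT n := Sum.elim covE vecE

lemma sum_coordE (a : GT n) : ∑ i, pair (coordF i) a • coordE i = a := by
  simpa [coordE, coordF] using sum_pair_vecE_covE a

lemma sum_coordF (a : GT n) : ∑ i, pair (coordE i) a • coordF i = a := by
  have := sum_pair_vecE_covE a
  rw [add_comm] at this
  simpa [coordE, coordF] using this

lemma isDualPair_coord :
    IsDualPair (pairC (n := n)) (fun i => (1 : ℂ) ⊗ₜ[ℝ] coordE i)
      (fun i => (1 : ℂ) ⊗ₜ[ℝ] coordF i) :=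
  isDualPair_complexify sum_coordE sum_coordF

lemma twoAct_eq (ε : GTC n →ₗ[ℂ] GTC n) :
    twoAct ε = twoOp cliff (fun i => (1 : ℂ) ⊗ₜ[ℝ] coordE i)
      (fun i => (1 : ℂ) ⊗ₜ[ℝ] coordF i) ε := by
  rw [twoAct, twoOp]
  simp [coordE, coordF, Finset.sum_add_distrib]

lemma expAct_eq (ε : GTC n →ₗ[ℂ] GTC n) (ρ : MF n) :
    expAct ε ρ = texp (n + 1) (twoAct ε) ρ := by
  simp [expAct, texp, LinearMap.sum_apply]

lemma eq_zero_of_pairC {a : GTC n} (h : ∀ b, pairC b a = 0) : a = 0 := by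
  rw [← isDualPair_coord.left a]
  simp [h]

lemma finrank_GTC : Module.finrank ℂ (GTC n) = 4 * n := by
  rw [Module.finrank_baseChange, Module.finrank_prod]
  have : Module.finrank ℝ (Model n →L[ℝ] ℝ) = 2 * n := by
    rw [← (LinearMap.toContinuousLinearMap (𝕜 := ℝ) (E := Model n) (F' := ℝ)).finrank_eq]
    simp
  rw [this, finrank_euclideanSpace, Fintype.card_fin]
  ring

/-- Complementary isotropic subspaces have adapted frames. -/
lemma exists_polarization {L M : Submodule ℂ (GTC n)} (hL : ∀ a ∈ L, ∀ b ∈ L, pairC a b = 0)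
    (hM : ∀ a ∈ M, ∀ b ∈ M, pairC a b = 0) (hLM : IsCompl L M) :
    Module.finrank ℂ L = 2 * n ∧ Module.finrank ℂ M = 2 * n ∧
    ∃ l l' : Fin (2 * n) → GTC n, Polarization pairC cliff L M l l' :=
  exists_polarization_of_isCompl cliff_mul_add pairC_comm (fun _ => eq_zero_of_pairC)
    (by rw [finrank_GTC]; ring) hL hM hLM

/-! ### The grading of the mixed forms -/

lemma cliffProd_succ {m : ℕ} (l : Fin (m + 1) → GTC n) (ρ : MF n) :
    cliffProd l ρ = cliff (l 0) (cliffProd (fun i => l i.succ) ρ) := by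
  simp [cliffProd, List.ofFn_succ]

lemma cliffProd_mem_gradeNat {L M : Submodule ℂ (GTC n)} {m : ℕ} (l : Fin m → GTC n)
    (hl : ∀ i, l i ∈ M) {ρ : MF n} (hρ : ρ ∈ kerFil cliff L 1) :
    cliffProd l ρ ∈ gradeNat cliff L M m := by
  induction m with
  | zero =>
    have : cliffProd l ρ = ρ := by simp [cliffProd]
    rwa [this]
  | succ m ih =>
    rw [cliffProd_succ]
    exact Submodule.mem_iSup_of_mem _ (Submodule.mem_iSup_of_mem (hl 0)
      (Submodule.mem_map_of_mem (ih _ fun i => hl i.succ)))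

lemma gradeNat_le_span (L M : Submodule ℂ (GTC n)) (m : ℕ) :
    gradeNat cliff L M m ≤ Submodule.span ℂ {θ | ∃ (l : Fin m → GTC n) (ρ : MF n),
      (∀ i, l i ∈ M) ∧ ρ ∈ kerFil cliff L 1 ∧ θ = cliffProd l ρ} := by
  induction m with
  | zero =>
    intro ρ hρ
    exact Submodule.subset_span ⟨Fin.elim0, ρ, fun i => i.elim0, hρ, by simp [cliffProd]⟩
  | succ m ih =>
    refine iSup₂_le fun a ha => ?_
    refine (Submodule.map_mono ih).trans ?_
    rw [Submodule.map_span_le]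
    rintro _ ⟨l, ρ, hl, hρ, rfl⟩
    refine Submodule.subset_span ⟨Fin.cons a l, ρ, Fin.cases ha hl, hρ, ?_⟩
    rw [cliffProd_succ]
    simp

lemma U_eq_grade (L : Submodule ℂ (GTC n)) (j : ℤ) :
    U L j = grade cliff L (L.map conjGT) (j + n) := by
  refine le_antisymm (Submodule.span_le.2 ?_) ?_
  · rintro _ ⟨m, l, ρ, hm, hl, hρ, rfl⟩
    rw [← hm]
    exact cliffProd_mem_gradeNat l hl hρ
  · rcases hj : j + n with m | m
    · refine (gradeNat_le_span _ _ m).trans (Submodule.span_mono ?_)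
      rintro _ ⟨l, ρ, hl, hρ, rfl⟩
      exact ⟨m, l, ρ, hj.symm, hl, hρ, rfl⟩
    · exact bot_le

/-- The complement of a graded piece determines its component, so the element chosen in `proj` is
unique. The shift by `n` passes from `U^j` to the number of factors from the conjugate of `L`. -/
lemma proj_eq_comp {L : Submodule ℂ (GTC n)} {d : ℕ} {l l' : Fin d → GTC n}
    (h : Polarization pairC cliff L (L.map conjGT) l l') (j : ℤ) (θ : MF n) :
    proj L j θ = h.comp (j + n) θ := by
  have hsup : (⨆ (i : ℤ) (_ : i ≠ j), U L i) =
      ⨆ (i : ℤ) (_ : i ≠ j + n), grade cliff L (L.map conjGT) i := by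
    refine le_antisymm (iSup₂_le fun i hi => ?_) (iSup₂_le fun i hi => ?_)
    · rw [U_eq_grade]
      exact le_iSup₂_of_le (i + n) (by omega) le_rfl
    · refine le_iSup₂_of_le (i - n) (by omega) ?_
      rw [U_eq_grade, sub_add_cancel]
  have hex : ∃ τ ∈ U L j, θ - τ ∈ ⨆ (i : ℤ) (_ : i ≠ j), U L i :=
    ⟨h.comp (j + n) θ, by rw [U_eq_grade]; exact h.comp_mem _ _, by
      rw [hsup]; exact h.sub_comp_mem _ _⟩
  rw [proj, dif_pos hex]
  obtain ⟨h1, h2⟩ := hex.choose_spec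
  generalize hex.choose = τ at h1 h2
  rw [U_eq_grade] at h1
  rw [hsup] at h2
  have h3 := (Submodule.projection_apply_eq_zero_iff (h.isCompl_grade (j + n))).2 h2
  rw [map_sub, sub_eq_zero] at h3
  exact ((h3.trans (h.comp_self h1)).symm)

/-- An operator obeying the multiplicative rule contains the spanning pairs of `multGraph` in its
graph. So the relation is single valued and the choice in `multExt` is forced; well-definedness
comes from exhibiting `Φ`. -/
lemma multExt_eq {L : Submodule ℂ (GTC n)} {k : ℕ} {P : GTC n →ₗ[ℂ] GTC n} {A : MF n → MF n}
    {Φ : Module.End ℂ (MF n)} (hΦ : ∀ a ∈ L.map conjGT, Φ * cliff a = cliff (P a) * Φ)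
    (hA : ∀ ρ ∈ kerFil cliff L 1, Φ ρ = A ρ) {θ : MF n} (hθ : θ ∈ U L ((k : ℤ) - n)) :
    multExt L k P A θ = Φ θ := by
  have hprod : ∀ (m : ℕ) (l : Fin m → GTC n) (ρ : MF n), (∀ i, l i ∈ L.map conjGT) →
      ρ ∈ kerFil cliff L 1 → Φ (cliffProd l ρ) = cliffProd (fun i => P (l i)) (A ρ) := by
    intro m l ρ hl hρ
    induction m with
    | zero => simpa [cliffProd] using hA ρ hρ
    | succ m ih =>
      rw [cliffProd_succ, cliffProd_succ, ← Module.End.mul_apply, hΦ _ (hl 0),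
        Module.End.mul_apply, ih _ fun i => hl i.succ]
  have huniq : ∀ p ∈ multGraph L k P A, p.2 = Φ p.1 := by
    intro p hp
    refine Submodule.span_induction (p := fun p _ => p.2 = Φ p.1) ?_ (by simp) ?_ ?_ hp
    · rintro _ ⟨l, ρ, hl, hρ, rfl⟩
      exact (hprod k l ρ hl hρ).symm
    · intro x y _ _ hx hy
      rw [Prod.snd_add, Prod.fst_add, hx, hy, map_add]
    · intro z x _ hx
      rw [Prod.smul_snd, Prod.smul_fst, hx, map_smul]
  have hex : ∃ τ, (θ, τ) ∈ multGraph L k P A := by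
    refine ⟨Φ θ, ?_⟩
    refine Submodule.span_induction (p := fun θ _ => (θ, Φ θ) ∈ multGraph L k P A) ?_ ?_ ?_ ?_ hθ
    · rintro _ ⟨m, l, ρ, hm, hl, hρ, rfl⟩
      obtain rfl : m = k := by omega
      exact Submodule.subset_span ⟨l, ρ, hl, hρ, by rw [hprod m l ρ hl hρ]⟩
    · rw [map_zero]; exact Submodule.zero_mem _
    · intro x y _ _ hx hy
      rw [map_add]; exact Submodule.add_mem _ hx hy
    · intro z x _ hx
      rw [map_smul]; exact Submodule.smul_mem _ z hx
  rw [multExt, dif_pos hex]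
  exact huniq _ hex.choose_spec

end

noncomputable section

variable {n : ℕ}

/-! ### Eigenbundles and their deformations at a point -/

lemma conjGT_baseChange (J : GT n →ₗ[ℝ] GT n) (a : GTC n) :
    conjGT (J.baseChange ℂ a) = J.baseChange ℂ (conjGT a) := by
  induction a using TensorProduct.induction_on with
  | zero => simp
  | add a a' ha ha' => simp only [map_add, ha, ha']
  | tmul z a => simp [conjGT_tmul]

lemma mem_eigL {J : GT n →ₗ[ℝ] GT n} {a : GTC n} :
    a ∈ eigL J ↔ J.baseChange ℂ a = Complex.I • a := Module.End.mem_eigenspace_iff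

lemma mem_map_conj_eigL {J : GT n →ₗ[ℝ] GT n} {a : GTC n} :
    a ∈ (eigL J).map conjGT ↔ J.baseChange ℂ a = -Complex.I • a := by
  rw [mem_map_conjGT, mem_eigL, ← conjGT_baseChange]
  constructor
  · intro h
    have := congrArg conjGT h
    rwa [conjGT_conjGT, map_smulₛₗ, conjGT_conjGT, Complex.conj_I] at this
  · intro h
    rw [h, map_smulₛₗ, map_neg, Complex.conj_I, neg_neg]

/-- The projection onto the `+i`-eigenspace of a complex structure. -/
def projL (J : GT n →ₗ[ℝ] GT n) : GTC n →ₗ[ℂ] GTC n :=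
  (1 / 2 : ℂ) • (LinearMap.id - Complex.I • J.baseChange ℂ)

lemma projL_apply (J : GT n →ₗ[ℝ] GT n) (a : GTC n) :
    projL J a = (1 / 2 : ℂ) • (a - Complex.I • J.baseChange ℂ a) := rfl

section ComplexStructure

variable {J : GT n →ₗ[ℝ] GT n}

lemma baseChange_sq (hJ : ∀ a, J (J a) = -a) (a : GTC n) :
    J.baseChange ℂ (J.baseChange ℂ a) = -a := by
  induction a using TensorProduct.induction_on with
  | zero => simp
  | add a a' ha ha' => simp only [map_add, ha, ha']; abel
  | tmul z a => simp [hJ, TensorProduct.tmul_neg]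

lemma projL_mem (hJ : ∀ a, J (J a) = -a) (a : GTC n) : projL J a ∈ eigL J := by
  rw [mem_eigL, projL_apply, map_smul, map_sub, map_smul, baseChange_sq hJ, smul_comm]
  congr 1
  rw [smul_sub, smul_smul, Complex.I_mul_I]
  module

lemma sub_projL_mem (hJ : ∀ a, J (J a) = -a) (a : GTC n) :
    a - projL J a ∈ (eigL J).map conjGT := by
  rw [mem_map_conj_eigL, projL_apply, map_sub, map_smul, map_sub, map_smul, baseChange_sq hJ,
    ← sub_eq_zero]
  set b := J.baseChange ℂ a
  have : b - (1 / 2 : ℂ) • (b - Complex.I • -a) - -Complex.I • (a - (1 / 2 : ℂ) •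
      (a - Complex.I • b)) = ((1 / 2 : ℂ) * (1 + Complex.I * Complex.I)) • b := by module
  rw [this, Complex.I_mul_I]
  simp

lemma projL_of_mem {a : GTC n} (ha : a ∈ eigL J) : projL J a = a := by
  rw [projL_apply, mem_eigL.1 ha, smul_smul, Complex.I_mul_I]
  module

lemma isCompl_eigL (hJ : ∀ a, J (J a) = -a) : IsCompl (eigL J) ((eigL J).map conjGT) := by
  refine ⟨Submodule.disjoint_def.2 fun a h1 h2 => ?_, codisjoint_iff.2 (eq_top_iff.2 fun a _ => ?_)⟩
  · rw [mem_eigL] at h1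
    rw [mem_map_conj_eigL, h1, ← sub_eq_zero, ← sub_smul, smul_eq_zero] at h2
    refine h2.resolve_left ?_
    rw [sub_neg_eq_add, ← two_mul]
    simp
  · rw [← add_sub_cancel (projL J a) a]
    exact Submodule.add_mem_sup (projL_mem hJ a) (sub_projL_mem hJ a)

/-- Orthogonality gives `⟨a, b⟩ = i² ⟨a, b⟩`. -/
lemma pairC_eigL (hJ : ∀ a b, pair (J a) (J b) = pair a b) {a b : GTC n} (ha : a ∈ eigL J)
    (hb : b ∈ eigL J) : pairC a b = 0 := by
  have key : ∀ a b : GTC n, pairC (J.baseChange ℂ a) (J.baseChange ℂ b) = pairC a b := by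
    intro a b
    induction a using TensorProduct.induction_on with
    | zero => simp
    | add a a' ha ha' => simp only [map_add, LinearMap.add_apply, ha, ha']
    | tmul z a =>
      induction b using TensorProduct.induction_on with
      | zero => simp
      | add b b' hb hb' => simp only [map_add, hb, hb']
      | tmul w b => simp [pairC_tmul, hJ]
  have := key a b
  rw [mem_eigL.1 ha, mem_eigL.1 hb, map_smul, map_smul, LinearMap.smul_apply, smul_smul,
    Complex.I_mul_I, neg_smul, one_smul] at this
  linear_combination (-1 / 2 : ℂ) * this

end ComplexStructure

lemma pairC_conj_isotropic {L : Submodule ℂ (GTC n)} (hL : ∀ a ∈ L, ∀ b ∈ L, pairC a b = 0) :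
    ∀ a ∈ L.map conjGT, ∀ b ∈ L.map conjGT, pairC a b = 0 := by
  rintro _ ⟨a, ha, rfl⟩ _ ⟨b, hb, rfl⟩
  rw [pairC_conjGT, hL a ha b hb, map_zero]

section Deform

variable {L : Submodule ℂ (GTC n)} {ε : GTC n →ₗ[ℂ] GTC n}

lemma epsStar_apply (a : GTC n) : epsStar ε a = conjGT (ε (conjGT a)) := rfl

lemma IsTwoVector.isSkewMap (hε : IsTwoVector L ε) (hL : IsCompl L (L.map conjGT)) :
    IsSkewMap pairC (L.map conjGT) ε where
  mem a := by
    obtain ⟨p, hp, q, hq, rfl⟩ := Submodule.mem_sup.1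
      (hL.sup_eq_top ▸ Submodule.mem_top : a ∈ L ⊔ L.map conjGT)
    rw [map_add, hε.map_Lbar q hq, add_zero]
    exact hε.map_L p hp
  ker := hε.map_Lbar
  skew := hε.skew

lemma IsTwoVector.isSkewMap_epsStar (hε : IsTwoVector L ε) (hL : IsCompl L (L.map conjGT)) :
    IsSkewMap pairC L (epsStar ε) where
  mem a := by
    rw [epsStar_apply, ← mem_map_conjGT]
    exact (hε.isSkewMap hL).mem _
  ker a ha := by
    rw [epsStar_apply, hε.map_Lbar _ ⟨a, ha, rfl⟩, map_zero]
  skew a b := by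
    have := hε.skew (conjGT a) (conjGT b)
    have h2 := congrArg (starRingEnd ℂ) this
    rw [map_neg, ← pairC_conjGT, ← pairC_conjGT, conjGT_conjGT, conjGT_conjGT] at h2
    exact h2

lemma pairC_defL (hε : IsSkewMap pairC (L.map conjGT) ε)
    (hL : ∀ a ∈ L, ∀ b ∈ L, pairC a b = 0) :
    ∀ a ∈ defL L ε, ∀ b ∈ defL L ε, pairC a b = 0 := by
  rintro _ ⟨a, ha, rfl⟩ _ ⟨b, hb, rfl⟩
  simp only [LinearMap.add_apply, LinearMap.id_apply, map_add, hL a ha b hb, hε.skew a b,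
    pairC_conj_isotropic hL _ (hε.mem a) _ (hε.mem b)]
  ring

variable {J G : GT n →ₗ[ℝ] GT n}

lemma normG_sq (hsymm : ∀ a b, pair (G a) b = pair a (G b)) (a : GTC n) :
    (pairC (G.baseChange ℂ a) (conjGT a)).re =
      pair (G (reGT a)) (reGT a) + pair (G (imGT a)) (imGT a) := by
  conv_lhs => rw [← re_add_im a]
  simp only [map_add, LinearMap.baseChange_tmul, conjGT_tmul, LinearMap.add_apply, pairC_tmul]
  have := hsymm (reGT a) (imGT a)
  rw [pair_comm (reGT a)] at this
  simp

lemma normG_conjGT (hsymm : ∀ a b, pair (G a) b = pair a (G b)) (a : GTC n) :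
    normG G (conjGT a) = normG G a := by
  rw [normG, normG, normG_sq hsymm, normG_sq hsymm, reGT_conjGT, imGT_conjGT]
  simp

lemma normG_pos (hsymm : ∀ a b, pair (G a) b = pair a (G b)) (hpos : ∀ a, a ≠ 0 → 0 < pair (G a) a)
    {a : GTC n} (ha : a ≠ 0) : 0 < normG G a := by
  have hnn : ∀ a, 0 ≤ pair (G a) a := fun a => by
    by_cases h : a = 0
    · simp [h]
    · exact (hpos a h).le
  rw [normG, normG_sq hsymm, Real.sqrt_pos]
  by_cases h : reGT a = 0
  · have h2 : imGT a ≠ 0 := by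
      rintro h2
      apply ha
      rw [← re_add_im a, h, h2]
      simp
    exact add_pos_of_nonneg_of_pos (hnn _) (hpos _ h2)
  · exact add_pos_of_pos_of_nonneg (hpos _ h) (hnn _)

/-- If `l + ε l` is the conjugate of `m + ε m`, comparing parts in `L` and its conjugate gives `m =
conj (ε l)` and `conj l = ε m`. Conjugation preserves the norm, so `l ≠ 0` would give `|m| = |ε l| <
|l| = |ε m| < |m|`. -/
lemma disjoint_defL (hL : IsCompl L (L.map conjGT)) (hε : IsSkewMap pairC (L.map conjGT) ε)
    (hsymm : ∀ a b, pair (G a) b = pair a (G b))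
    (hlt : ∀ l ∈ L, l ≠ 0 → normG G (ε l) < normG G l) :
    Disjoint (defL L ε) ((defL L ε).map conjGT) := by
  rw [Submodule.disjoint_def]
  intro a h1 h2
  rw [mem_map_conjGT] at h2
  obtain ⟨l, hl, rfl⟩ := h1
  obtain ⟨m, hm, hme⟩ := h2
  simp only [LinearMap.add_apply, LinearMap.id_apply, map_add] at hme ⊢
  have e1 : m - conjGT (ε l) = conjGT l - ε m := by
    rw [sub_eq_sub_iff_add_eq_add, hme]
  have e2 : m - conjGT (ε l) = 0 := by
    refine Submodule.disjoint_def.1 hL.disjoint _ (L.sub_mem hm (mem_map_conjGT.1 (hε.mem l))) ?_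
    rw [e1]
    exact Submodule.sub_mem _ ⟨l, hl, rfl⟩ (hε.mem m)
  have e3 : conjGT l = ε m := by rwa [e2, eq_comm, sub_eq_zero] at e1
  rw [sub_eq_zero] at e2
  by_cases h0 : l = 0
  · simp [h0]
  · exfalso
    have hm0 : m ≠ 0 := by
      rintro rfl
      rw [map_zero] at e3
      exact h0 (by rw [← conjGT_conjGT l, e3, map_zero])
    have i1 := hlt l hl h0
    have i2 := hlt m hm hm0
    rw [← e3, normG_conjGT hsymm, e2, normG_conjGT hsymm] at i2
    exact lt_asymm i1 i2

lemma map_conj_defL (L : Submodule ℂ (GTC n)) (ε : GTC n →ₗ[ℂ] GTC n) :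
    (defL L ε).map conjGT = (L.map conjGT).map (LinearMap.id + epsStar ε) := by
  ext a
  constructor
  · rintro ⟨_, ⟨l, hl, rfl⟩, rfl⟩
    exact ⟨conjGT l, ⟨l, hl, rfl⟩, by simp [epsStar_apply, conjGT_conjGT]⟩
  · rintro ⟨_, ⟨l, hl, rfl⟩, rfl⟩
    exact ⟨_, ⟨l, hl, rfl⟩, by simp [epsStar_apply, conjGT_conjGT]⟩

lemma IsSkewMap.injective_id_add {M : Submodule ℂ (GTC n)} {ε : GTC n →ₗ[ℂ] GTC n}
    (hε : IsSkewMap pairC M ε) : Function.Injective (LinearMap.id + ε : GTC n →ₗ[ℂ] GTC n) := by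
  rw [injective_iff_map_eq_zero]
  intro a ha
  rw [LinearMap.add_apply, LinearMap.id_apply] at ha
  have h2 : ε a = 0 := by
    have := congrArg ε ha
    rwa [map_add, hε.ker _ (hε.mem a), add_zero, map_zero] at this
  rwa [h2, add_zero] at ha

/-- As `ε² = 0`, the map `1 + ε` is injective, and likewise for `ε*`. So both subspaces have half
the dimension and disjointness suffices. -/
lemma isCompl_defL (hiso : ∀ a ∈ L, ∀ b ∈ L, pairC a b = 0) (hL : IsCompl L (L.map conjGT))
    (hε : IsTwoVector L ε)
    (hsymm : ∀ a b, pair (G a) b = pair a (G b))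
    (hlt : ∀ l ∈ L, l ≠ 0 → normG G (ε l) < normG G l) :
    IsCompl (defL L ε) ((defL L ε).map conjGT) := by
  obtain ⟨h1, h2, -⟩ := exists_polarization hiso (pairC_conj_isotropic hiso) hL
  rw [Submodule.isCompl_iff_disjoint]
  · exact disjoint_defL hL (hε.isSkewMap hL) hsymm hlt
  · rw [map_conj_defL, defL,
      (Submodule.equivMapOfInjective _ (hε.isSkewMap hL).injective_id_add L).symm.finrank_eq,
      (Submodule.equivMapOfInjective _
        (hε.isSkewMap_epsStar hL).injective_id_add (L.map conjGT)).symm.finrank_eq,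
      h1, h2, finrank_GTC]
    omega

lemma normG_lt_of_linfNorm {X : Type*} {J G : X → GT n →ₗ[ℝ] GT n} {ε : X → GTC n →ₗ[ℂ] GTC n}
    (h : linfNorm J G ε < 1) (x : X) (hsymm : ∀ a b, pair (G x a) b = pair a (G x b))
    (hpos : ∀ a, a ≠ 0 → 0 < pair (G x a) a) {l : GTC n} (hl : l ∈ eigL (J x)) (h0 : l ≠ 0) :
    normG (G x) (ε x l) < normG (G x) l := by
  have h1 : ENNReal.ofReal (normG (G x) (ε x l) / normG (G x) l) < 1 :=
    lt_of_le_of_lt (le_iSup_of_le x (le_iSup₂_of_le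
      (f := fun l (_ : l ∈ eigL (J x)) => ENNReal.ofReal (normG (G x) (ε x l) / normG (G x) l))
      l hl le_rfl)) h
  rw [ENNReal.ofReal_lt_one, div_lt_one (normG_pos hsymm hpos h0)] at h1
  exact h1

end Deform

end

noncomputable section

variable {n : ℕ}

open Filter Topology

section Bilinear

variable {E F G K : Type*} [NormedAddCommGroup E] [NormedSpace ℝ E] [NormedAddCommGroup F]
  [NormedSpace ℝ F] [NormedAddCommGroup G] [NormedSpace ℝ G] [NormedAddCommGroup K]
  [NormedSpace ℝ K] (L : F →L[ℝ] G →L[ℝ] K) {u : E → F} {w : E → G} {p : E}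

lemma contDiffAt_bilin {m : WithTop ℕ∞} (hu : ContDiffAt ℝ m u p) (hw : ContDiffAt ℝ m w p) :
    ContDiffAt ℝ m (fun y => L (u y) (w y)) p :=
  (L.contDiff.contDiffAt.comp p hu).clm_apply hw

lemma hasFDerivAt_bilin (hu : DifferentiableAt ℝ u p) (hw : DifferentiableAt ℝ w p) :
    ∃ D : E →L[ℝ] K, HasFDerivAt (fun y => L (u y) (w y)) D p ∧
      ∀ v, D v = L (u p) (fderiv ℝ w p v) + L (fderiv ℝ u p v) (w p) :=
  ⟨_, L.hasFDerivAt_of_bilinear hu.hasFDerivAt hw.hasFDerivAt, fun v => by simp⟩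

end Bilinear

/-! ### Calculus of mixed forms on the model space -/

/-- Exterior multiplication by a covector as a continuous bilinear map. -/
def wedgeL (n k : ℕ) : (Model n →L[ℝ] ℝ) →L[ℝ] (Model n [⋀^Fin k]→L[ℝ] ℂ) →L[ℝ]
    (Model n [⋀^Fin (k + 1)]→L[ℝ] ℂ) :=
  (ContinuousLinearMap.compL ℝ _ _ _
    (ContinuousAlternatingMap.alternatizeUncurryFinCLM ℝ (Model n) ℂ)) ∘L
    ContinuousLinearMap.smulRightL ℝ (Model n) (Model n [⋀^Fin k]→L[ℝ] ℂ)

lemma wedgeL_apply (k : ℕ) (ξ : Model n →L[ℝ] ℝ) (ρ : MF n) :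
    wedgeL n k ξ (ρ k) = wedgeOne ξ ρ (k + 1) := by
  ext v
  simp [wedgeL, wedgeOne, ContinuousAlternatingMap.alternatizeUncurryFin_apply]

/-- Contraction with a vector as a continuous bilinear map. -/
def contrL (n k : ℕ) : (Model n [⋀^Fin (k + 1)]→L[ℝ] ℂ) →L[ℝ] Model n →L[ℝ]
    (Model n [⋀^Fin k]→L[ℝ] ℂ) :=
  (ContinuousAlternatingMap.curryLeftLI (𝕜 := ℝ) (E := Model n) (F := ℂ)
    (n := k)).toContinuousLinearMap

lemma contrL_apply (k : ℕ) (v : Model n) (ρ : MF n) :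
    contrL n k (ρ (k + 1)) v = contr v ρ k := rfl

/-- The directional derivative of a family of mixed forms. -/
def dMF (ρ : Model n → MF n) (p v : Model n) : MF n := fun k => fderiv ℝ (fun y => ρ y k) p v

/-- Differentiability of a family of mixed forms. -/
def DiffMF (ρ : Model n → MF n) (p : Model n) : Prop :=
  ∀ k, DifferentiableAt ℝ (fun y => ρ y k) p

lemma cliffR_apply_zero (a : GT n) (ρ : MF n) : cliffR a ρ 0 = contrL n 0 (ρ 1) a.1 := by
  rw [cliffR_apply, MF.add_apply, contrL_apply]
  simp [wedgeOne]

lemma cliffR_apply_succ (a : GT n) (ρ : MF n) (k : ℕ) :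
    cliffR a ρ (k + 1) = contrL n (k + 1) (ρ (k + 2)) a.1 + wedgeL n k a.2 (ρ k) := by
  rw [cliffR_apply, MF.add_apply, contrL_apply, wedgeL_apply]

lemma contDiffAt_cliffR {m : WithTop ℕ∞} {a : Model n → GT n} {ρ : Model n → MF n} {p : Model n}
    (ha : ContDiffAt ℝ m a p) (hρ : ∀ k, ContDiffAt ℝ m (fun y => ρ y k) p) (k : ℕ) :
    ContDiffAt ℝ m (fun y => cliffR (a y) (ρ y) k) p := by
  have hc : ∀ k, ContDiffAt ℝ m (fun y => contrL n k (ρ y (k + 1)) (a y).1) p := fun k =>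
    contDiffAt_bilin (contrL n k) (hρ (k + 1)) ha.fst
  cases k with
  | zero =>
    simp only [cliffR_apply_zero]
    exact hc 0
  | succ k =>
    simp only [cliffR_apply_succ]
    exact (hc (k + 1)).add (contDiffAt_bilin (wedgeL n k) ha.snd (hρ k))

lemma hasFDerivAt_contr {a : Model n → GT n} {ρ : Model n → MF n} {p : Model n}
    (ha : DifferentiableAt ℝ a p) (hρ : DiffMF ρ p) (k : ℕ) :
    ∃ F : Model n →L[ℝ] Model n [⋀^Fin k]→L[ℝ] ℂ,
      HasFDerivAt (fun y => contrL n k (ρ y (k + 1)) (a y).1) F p ∧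
      ∀ v, F v = contrL n k (ρ p (k + 1)) (fderiv ℝ a p v).1 +
        contrL n k (dMF ρ p v (k + 1)) (a p).1 := by
  obtain ⟨D, h1, h2⟩ := hasFDerivAt_bilin (contrL n k) (hρ (k + 1)) ha.fst
  refine ⟨D, h1, fun v => ?_⟩
  rw [h2, ha.hasFDerivAt.fst.fderiv]
  rfl

lemma hasFDerivAt_wedge {a : Model n → GT n} {ρ : Model n → MF n} {p : Model n}
    (ha : DifferentiableAt ℝ a p) (hρ : DiffMF ρ p) (k : ℕ) :
    ∃ F : Model n →L[ℝ] Model n [⋀^Fin (k + 1)]→L[ℝ] ℂ,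
      HasFDerivAt (fun y => wedgeL n k (a y).2 (ρ y k)) F p ∧
      ∀ v, F v = wedgeL n k (a p).2 (dMF ρ p v k) + wedgeL n k (fderiv ℝ a p v).2 (ρ p k) := by
  obtain ⟨D, h1, h2⟩ := hasFDerivAt_bilin (wedgeL n k) ha.snd (hρ k)
  refine ⟨D, h1, fun v => ?_⟩
  rw [h2, ha.hasFDerivAt.snd.fderiv]
  rfl

lemma diffMF_cliffR {a : Model n → GT n} {ρ : Model n → MF n} {p : Model n}
    (ha : DifferentiableAt ℝ a p) (hρ : DiffMF ρ p) :
    DiffMF (fun y => cliffR (a y) (ρ y)) p := by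
  intro k
  cases k with
  | zero =>
    simp only [cliffR_apply_zero]
    obtain ⟨F, hF, -⟩ := hasFDerivAt_contr ha hρ 0
    exact hF.differentiableAt
  | succ k =>
    simp only [cliffR_apply_succ]
    obtain ⟨F, hF, -⟩ := hasFDerivAt_contr ha hρ (k + 1)
    obtain ⟨F', hF', -⟩ := hasFDerivAt_wedge ha hρ k
    exact (hF.add hF').differentiableAt

lemma dMF_cliffR {a : Model n → GT n} {ρ : Model n → MF n} {p : Model n}
    (ha : DifferentiableAt ℝ a p) (hρ : DiffMF ρ p) (v : Model n) :
    dMF (fun y => cliffR (a y) (ρ y)) p v =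
      cliffR (fderiv ℝ a p v) (ρ p) + cliffR (a p) (dMF ρ p v) := by
  funext k
  cases k with
  | zero =>
    obtain ⟨F, hF, hFv⟩ := hasFDerivAt_contr ha hρ 0
    simp only [dMF, MF.add_apply, cliffR_apply_zero]
    rw [hF.fderiv]
    exact hFv v
  | succ k =>
    obtain ⟨F, hF, hFv⟩ := hasFDerivAt_contr ha hρ (k + 1)
    obtain ⟨F', hF', hFv'⟩ := hasFDerivAt_wedge ha hρ k
    have h2 : dMF (fun y => cliffR (a y) (ρ y)) p v (k + 1) = F v + F' v := by
      simp only [dMF, cliffR_apply_succ]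
      rw [(hF.fun_add hF').fderiv]
      rfl
    rw [h2, hFv, hFv', MF.add_apply, cliffR_apply_succ, cliffR_apply_succ]
    abel

/-- The exterior derivative of a family of mixed forms. -/
def dExt (ρ : Model n → MF n) (p : Model n) : MF n
  | 0 => 0
  | k + 1 => extDeriv (fun y => ρ y k) p

/-- The coordinate vectors of the model space. -/
def basisE (i : Fin (2 * n)) : Model n := EuclideanSpace.single i 1

lemma sum_coord_basisE (v : Model n) : ∑ i, v i • basisE i = v := by
  have := (EuclideanSpace.basisFun (Fin (2 * n)) ℝ).sum_repr v
  simpa [basisE] using this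

lemma cliffR_covE (i : Fin (2 * n)) (ρ : MF n) :
    cliffR (covE i) ρ = wedgeOne (EuclideanSpace.proj i) ρ := by
  rw [cliffR_apply]
  have : contr (covE i).1 ρ = 0 := by
    funext k
    ext w
    simp [contr, covE]
  rw [this, zero_add]
  rfl

lemma MF.sum_apply {ι : Type*} (s : Finset ι) (f : ι → MF n) (k : ℕ) :
    (∑ i ∈ s, f i) k = ∑ i ∈ s, f i k :=
  Finset.sum_apply k s f

/-- Writing `d` as the sum of `dx^i ∧ ∂_i` reduces identities for the exterior derivative to the
Leibniz rule and Clifford algebra. -/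
lemma dExt_eq (ρ : Model n → MF n) (p : Model n) :
    dExt ρ p = ∑ i, cliffR (covE i) (dMF ρ p (basisE i)) := by
  funext k
  rw [MF.sum_apply]
  simp only [cliffR_covE]
  cases k with
  | zero => simp [dExt, wedgeOne]
  | succ k =>
    simp only [← wedgeL_apply]
    rw [dExt, extDeriv]
    have : fderiv ℝ (fun y => ρ y k) p =
        ∑ i : Fin (2 * n), (EuclideanSpace.proj i : Model n →L[ℝ] ℝ).smulRight
          (dMF ρ p (basisE i) k) := by
      refine ContinuousLinearMap.ext fun v => ?_
      conv_lhs => rw [← sum_coord_basisE v]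
      simp [dMF]
    rw [this, ← ContinuousAlternatingMap.alternatizeUncurryFinCLM_apply (𝕜 := ℝ), map_sum]
    rfl

/-- The Dorfman bracket on the model space. -/
def dorfman (a b : Model n → GT n) (p : Model n) : GT n :=
  fderiv ℝ b p (a p).1 - fderiv ℝ a p (b p).1 +
    ∑ i, pair (fderiv ℝ a p (basisE i)) (b p) • covE i

lemma pair_covE (i : Fin (2 * n)) (a : GT n) : pair (covE i) a = a.1 i := by
  simp [pair_apply, covE]

lemma cliffR_apply_apply (a b : GT n) (ρ : MF n) :
    cliffR a (cliffR b ρ) = (pair a b : ℂ) • ρ - cliffR b (cliffR a ρ) := by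
  have := congrArg (fun f : Module.End ℂ (MF n) => f ρ) (cliffR_mul_add a b)
  simp only [LinearMap.add_apply, Module.End.mul_apply, LinearMap.smul_apply,
    Module.End.one_apply] at this
  exact eq_sub_of_add_eq this

/-- The left side is `[{d, a}, b]` applied to `ρ`. With `d = ∑ c(dx^i) ∂_i`, all terms with a
derivative of `ρ` cancel by the Clifford relation, and those with derivatives of `a` and `b` form
the Dorfman bracket. -/
lemma dExt_cliffR_cliffR {a b : Model n → GT n} {ρ : Model n → MF n} {p : Model n}
    (ha : DifferentiableAt ℝ a p) (hb : DifferentiableAt ℝ b p) (hρ : DiffMF ρ p) :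
    dExt (fun y => cliffR (a y) (cliffR (b y) (ρ y))) p
      + cliffR (a p) (dExt (fun y => cliffR (b y) (ρ y)) p)
      - cliffR (b p) (dExt (fun y => cliffR (a y) (ρ y)) p)
      - cliffR (b p) (cliffR (a p) (dExt ρ p)) = cliffR (dorfman a b p) (ρ p) := by
  have hD : dorfman a b p = ∑ i, ((a p).1 i • fderiv ℝ b p (basisE i)
      - (b p).1 i • fderiv ℝ a p (basisE i)
      + pair (fderiv ℝ a p (basisE i)) (b p) • covE i) := by
    rw [dorfman, Finset.sum_add_distrib, Finset.sum_sub_distrib]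
    congr 2
    · conv_lhs => rw [← sum_coord_basisE (a p).1, map_sum]
      simp only [map_smul]
    · conv_lhs => rw [← sum_coord_basisE (b p).1, map_sum]
      simp only [map_smul]
  rw [hD]
  simp only [dExt_eq]
  rw [map_sum, map_sum, map_sum, map_sum, map_sum, LinearMap.sum_apply, ← Finset.sum_add_distrib,
    ← Finset.sum_sub_distrib, ← Finset.sum_sub_distrib]
  refine Finset.sum_congr rfl fun i _ => ?_
  rw [dMF_cliffR ha (diffMF_cliffR hb hρ), dMF_cliffR hb hρ, dMF_cliffR ha hρ]
  set a' := fderiv ℝ a p (basisE i)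
  set b' := fderiv ℝ b p (basisE i)
  set ρ' := dMF ρ p (basisE i)
  simp only [map_add, map_sub, map_smul, LinearMap.add_apply, LinearMap.sub_apply,
    LinearMap.smul_apply]
  rw [cliffR_apply_apply (a p) (covE i) (cliffR b' (ρ p)),
    cliffR_apply_apply (a p) (covE i) (cliffR (b p) ρ'),
    cliffR_apply_apply (b p) (covE i) (cliffR a' (ρ p)),
    cliffR_apply_apply (b p) (covE i) (cliffR (a p) ρ'),
    cliffR_apply_apply (b p) a' (ρ p),
    cliffR_apply_apply (a p) (covE i) ρ', map_sub, map_sub, map_smul, map_smul,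
    cliffR_apply_apply (b p) (covE i) (cliffR (a p) ρ'),
    pair_comm (a p) (covE i), pair_comm (b p) (covE i), pair_covE, pair_covE, pair_comm a']
  have hr : ∀ (r : ℝ) (τ : MF n), r • τ = (r : ℂ) • τ := fun r τ => rfl
  simp only [hr]
  abel

/-- Multiplication by a three-form, as a Clifford operator. -/
def threeOp (h : Model n [⋀^Fin 3]→L[ℝ] ℝ) : Module.End ℂ (MF n) :=
  (1 / 6 : ℂ) • ∑ i : Fin (2 * n), ∑ j : Fin (2 * n), ∑ k : Fin (2 * n),
    ((h ![basisE i, basisE j, basisE k] : ℝ) : ℂ) •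
      (cliffR (covE i) * cliffR (covE j) * cliffR (covE k))

lemma threeOp_apply (h : Model n [⋀^Fin 3]→L[ℝ] ℝ) (ρ : MF n) :
    threeOp h ρ = wedgeThree h ρ := by
  simp only [threeOp, wedgeThree, LinearMap.smul_apply, LinearMap.sum_apply, Module.End.mul_apply,
    cliffR_covE, basisE]

/-- The covector `h(v, w, ·)`. -/
def contrTwo (h : Model n [⋀^Fin 3]→L[ℝ] ℝ) (v w : Model n) : Model n →L[ℝ] ℝ :=
  ofForm ((h.curryLeft v).curryLeft w)

lemma contrTwo_apply (h : Model n [⋀^Fin 3]→L[ℝ] ℝ) (v w u : Model n) :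
    contrTwo h v w u = h ![v, w, u] := by
  have : ofForm ((h.curryLeft v).curryLeft w) u = ((h.curryLeft v).curryLeft w) (fun _ => u) := rfl
  rw [contrTwo, this]
  simp only [ContinuousAlternatingMap.curryLeft_apply_apply]
  congr 1
  funext i
  fin_cases i <;> rfl

/-- Trilinear expansion of a three-form in the coordinate basis. -/
lemma sum_threeForm (h : Model n [⋀^Fin 3]→L[ℝ] ℝ) (v w : Model n) (k : Fin (2 * n)) :
    ∑ i, ∑ j, h ![basisE i, basisE j, basisE k] * v i * w j = h ![v, w, basisE k] := by
  have h1 : ∀ v w u, h ![v, w, u] = ((h.curryLeft v).curryLeft w) ![u] := fun v w u => rfl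
  conv_rhs => rw [← sum_coord_basisE v, ← sum_coord_basisE w, h1]
  have h2 : ∀ (s : Fin (2 * n) → Model n [⋀^Fin 2]→L[ℝ] ℝ) (x : Model n),
      (∑ i, s i).curryLeft x = ∑ i, (s i).curryLeft x := fun s x => by
    ext y
    simp [ContinuousAlternatingMap.sum_apply]
  simp only [map_sum, map_smul, h2]
  rw [ContinuousAlternatingMap.sum_apply]
  refine Finset.sum_congr rfl fun i _ => ?_
  rw [ContinuousAlternatingMap.sum_apply]
  refine Finset.sum_congr rfl fun j _ => ?_
  rw [h1]
  simp
  ring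

/-- The six orders of the summation indices; this count cancels the `1 / 6` in `threeOp`. -/
lemma sum_perm_add {ι M : Type*} [Fintype ι] [AddCommMonoid M] (g : ι → ι → ι → M) :
    ∑ i, ∑ j, ∑ k, (g i k j + g i j k + g j k i + g j i k + g k j i + g k i j) =
      6 • ∑ i, ∑ j, ∑ k, g i j k := by
  have s1 : ∀ f : ι → ι → ι → M, ∑ i, ∑ j, ∑ k, f i k j = ∑ i, ∑ j, ∑ k, f i j k := fun f =>
    Finset.sum_congr rfl fun i _ => Finset.sum_comm
  have s2 : ∀ f : ι → ι → ι → M, ∑ i, ∑ j, ∑ k, f j i k = ∑ i, ∑ j, ∑ k, f i j k := fun f =>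
    Finset.sum_comm
  have s3 : ∑ i, ∑ j, ∑ k, g j k i = ∑ i, ∑ j, ∑ k, g i j k :=
    (s2 fun i j k => g i k j).trans (s1 g)
  have s4 : ∑ i, ∑ j, ∑ k, g k i j = ∑ i, ∑ j, ∑ k, g i j k :=
    (s1 fun i j k => g j i k).trans (s2 g)
  have s5 : ∑ i, ∑ j, ∑ k, g k j i = ∑ i, ∑ j, ∑ k, g i j k :=
    (s1 fun i j k => g j k i).trans s3
  simp only [Finset.sum_add_distrib]
  rw [s1 g, s2 g, s3, s4, s5]
  abel

lemma threeForm_swap_left (h : Model n [⋀^Fin 3]→L[ℝ] ℝ) (u v w : Model n) :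
    h ![v, u, w] = -h ![u, v, w] := by
  have := h.toAlternatingMap.map_swap ![u, v, w] (i := 0) (j := 1) (by decide)
  rw [← ContinuousAlternatingMap.coe_toAlternatingMap, ← this]
  congr 1
  funext i
  fin_cases i <;> rfl

lemma threeForm_swap_right (h : Model n [⋀^Fin 3]→L[ℝ] ℝ) (u v w : Model n) :
    h ![u, w, v] = -h ![u, v, w] := by
  have := h.toAlternatingMap.map_swap ![u, v, w] (i := 1) (j := 2) (by decide)
  rw [← ContinuousAlternatingMap.coe_toAlternatingMap, ← this]
  congr 1
  funext i
  fin_cases i <;> rfl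

/-- The same double bracket with `h ∧` in place of `d`: the anticommutator with `a` contracts one
slot and the commutator with `b` another. The minus sign here and the one in `d - H ∧` together give
`+ i_b i_a H` in the bracket. -/
lemma threeOp_bracket (h : Model n [⋀^Fin 3]→L[ℝ] ℝ) (a b : GT n) :
    threeOp h * cliffR a * cliffR b + cliffR a * threeOp h * cliffR b
      - cliffR b * threeOp h * cliffR a - cliffR b * cliffR a * threeOp h =
    -cliffR (0, contrTwo h a.1 b.1) := by
  set c : Fin (2 * n) → Module.End ℂ (MF n) := fun i => cliffR (covE i) with hc
  set A := cliffR a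
  set B := cliffR b
  have hA : ∀ i, c i * A = ((a.1 i : ℝ) : ℂ) • (1 : Module.End ℂ (MF n)) - A * c i := fun i => by
    rw [← pair_covE]; exact eq_sub_of_add_eq (cliffR_mul_add _ _)
  have hB : ∀ i, c i * B = ((b.1 i : ℝ) : ℂ) • (1 : Module.End ℂ (MF n)) - B * c i := fun i => by
    rw [← pair_covE]; exact eq_sub_of_add_eq (cliffR_mul_add _ _)
  have key : ∀ i j k, c i * c j * c k * A * B + A * (c i * c j * c k) * B
      - B * (c i * c j * c k) * A - B * A * (c i * c j * c k) =
      ((a.1 i * b.1 k : ℝ) : ℂ) • c j - ((a.1 i * b.1 j : ℝ) : ℂ) • c k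
      - ((a.1 j * b.1 k : ℝ) : ℂ) • c i + ((a.1 j * b.1 i : ℝ) : ℂ) • c k
      + ((a.1 k * b.1 j : ℝ) : ℂ) • c i - ((a.1 k * b.1 i : ℝ) : ℂ) • c j := by
    intro i j k
    have e1 : c i * c j * c k * A = ((a.1 k : ℝ) : ℂ) • (c i * c j) - ((a.1 j : ℝ) : ℂ) • (c i * c k)
        + ((a.1 i : ℝ) : ℂ) • (c j * c k) - A * (c i * c j * c k) := by
      rw [mul_assoc _ (c k) A, hA, mul_sub, ← mul_assoc, mul_assoc (c i) (c j) A, hA, mul_sub,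
        ← mul_assoc, hA]
      simp only [sub_mul, mul_smul_comm, smul_mul_assoc, mul_one, one_mul, mul_assoc]
      abel
    have e2 : ∀ i j, c i * c j * B = ((b.1 j : ℝ) : ℂ) • c i - ((b.1 i : ℝ) : ℂ) • c j
        + B * (c i * c j) := by
      intro i j
      rw [mul_assoc, hB, mul_sub, ← mul_assoc, hB]
      simp only [sub_mul, mul_smul_comm, smul_mul_assoc, mul_one, one_mul, mul_assoc]
      abel
    have e3 : c i * c j * c k * A * B + A * (c i * c j * c k) * B
      - B * (c i * c j * c k) * A - B * A * (c i * c j * c k) =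
      (c i * c j * c k * A + A * (c i * c j * c k)) * B
      - B * (c i * c j * c k * A + A * (c i * c j * c k)) := by noncomm_ring
    rw [e3, e1, sub_add_cancel, add_mul, sub_mul, mul_add, mul_sub]
    simp only [smul_mul_assoc, mul_smul_comm, e2, smul_add, smul_sub, smul_smul]
    push_cast
    abel
  set f : Fin (2 * n) → Fin (2 * n) → Fin (2 * n) → ℝ :=
    fun i j k => h ![basisE i, basisE j, basisE k] with hf
  have f1 : ∀ i j k, f i k j = -f i j k := fun i j k => threeForm_swap_right h _ _ _
  have f2 : ∀ i j k, f j i k = -f i j k := fun i j k => threeForm_swap_left h _ _ _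
  set g : Fin (2 * n) → Fin (2 * n) → Fin (2 * n) → Module.End ℂ (MF n) :=
    fun i j k => ((f i j k * (a.1 i * b.1 j) : ℝ) : ℂ) • c k with hg
  have hS : cliffR (0, contrTwo h a.1 b.1) = ∑ i, ∑ j, ∑ k, g i j k := by
    have h1 : ((0, contrTwo h a.1 b.1) : GT n) = ∑ k, h ![a.1, b.1, basisE k] • covE k := by
      refine Prod.ext (by simp [Prod.fst_sum, covE]) ?_
      refine ContinuousLinearMap.ext fun u => ?_
      rw [contrTwo_apply]
      conv_lhs => rw [← sum_coord_basisE u]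
      have h3 : ∀ v w u, h ![v, w, u] = contrTwo h v w u := fun v w u =>
        (contrTwo_apply h v w u).symm
      simp only [h3, map_sum, map_smul, Prod.snd_sum]
      simp [covE, mul_comm]
    rw [h1, map_sum]
    have h4 : ∑ i, ∑ j, ∑ k, g i j k = ∑ k, ∑ i, ∑ j, g i j k :=
      (Finset.sum_congr rfl fun i _ => Finset.sum_comm).trans Finset.sum_comm
    rw [h4]
    refine Finset.sum_congr rfl fun k _ => ?_
    rw [← sum_threeForm, map_smul]
    change ((∑ i, ∑ j, h ![basisE i, basisE j, basisE k] * a.1 i * b.1 j : ℝ) : ℂ) • c k = _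
    push_cast
    simp only [Finset.sum_smul, hg, hf]
    push_cast
    simp only [mul_assoc]
  -- The signs of the six contractions in `key` match the signs of the permutations of the skew
  -- coefficient `f`, so they become six relabelled copies of `g` with a common sign.
  have hT : ∀ i j k, (f i j k : ℂ) • (c i * c j * c k * A * B + A * (c i * c j * c k) * B
      - B * (c i * c j * c k) * A - B * A * (c i * c j * c k)) =
      -(g i k j + g i j k + g j k i + g j i k + g k j i + g k i j) := by
    intro i j k
    rw [key]
    simp only [hg]
    have e3 : f j k i = f i j k := by rw [f1 j i k, f2 i j k, neg_neg]
    have e4 : f k i j = f i j k := by rw [f2 i k j, f1 i j k, neg_neg]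
    have e5 : f k j i = -f i j k := by rw [f1 k i j, e4]
    rw [f1 i j k, f2 i j k, e3, e4, e5]
    push_cast
    module
  have hU : threeOp h * A * B + A * threeOp h * B - B * threeOp h * A - B * A * threeOp h =
      (1 / 6 : ℂ) • ∑ i, ∑ j, ∑ k, (f i j k : ℂ) • (c i * c j * c k * A * B
      + A * (c i * c j * c k) * B - B * (c i * c j * c k) * A - B * A * (c i * c j * c k)) := by
    simp only [threeOp, smul_mul_assoc, mul_smul_comm, Finset.sum_mul, Finset.mul_sum, smul_add,
      smul_sub, Finset.sum_add_distrib, Finset.sum_sub_distrib]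
    rfl
  rw [hU, hS]
  simp only [hT, Finset.sum_neg_distrib]
  rw [sum_perm_add g, smul_neg, ← Nat.cast_smul_eq_nsmul ℂ, smul_smul]
  norm_num

end

noncomputable section

open Filter Topology

variable {n : ℕ} {X : Type*} [TopologicalSpace X] [ChartedSpace (Model n) X]

/-! ### Charts -/

/-- The image of `x` in the chart at `x`. -/
abbrev cpt (n : ℕ) {X : Type*} [TopologicalSpace X] [ChartedSpace (Model n) X] (x : X) : Model n :=
  extChartAt 𝓘(ℝ, Model n) x x

/-- The inverse of the chart at `x`. -/
abbrev cinv (x : X) (y : Model n) : X := (extChartAt 𝓘(ℝ, Model n) x).symm y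

lemma eventually_target (x : X) : ∀ᶠ y in 𝓝 (cpt n x), y ∈ (extChartAt 𝓘(ℝ, Model n) x).target :=
  extChartAt_target_mem_nhds x

lemma eventually_of_chart {x : X} {P : X → Prop} (h : ∀ᶠ y in 𝓝 (cpt n x), P (cinv x y)) :
    ∀ᶠ z in 𝓝 x, P z := by
  have h1 : ∀ᶠ z in 𝓝 x, P (cinv x (extChartAt 𝓘(ℝ, Model n) x z)) :=
    (continuousAt_extChartAt x).eventually h
  filter_upwards [h1, extChartAt_source_mem_nhds (I := 𝓘(ℝ, Model n)) x] with z hz hz'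
  rwa [cinv, (extChartAt 𝓘(ℝ, Model n) x).left_inv hz'] at hz

lemma eventually_chart {x : X} {P : X → Prop} (h : ∀ᶠ z in 𝓝 x, P z) :
    ∀ᶠ y in 𝓝 (cpt n x), P (cinv x y) := by
  have : Tendsto (cinv x) (𝓝 (cpt n x)) (𝓝 x) := by
    have := continuousAt_extChartAt_symm (I := 𝓘(ℝ, Model n)) x
    rwa [ContinuousAt, extChartAt_to_inv] at this
  exact this.eventually h

variable [IsManifold 𝓘(ℝ, Model n) ∞ X]

lemma isManifold_one : IsManifold 𝓘(ℝ, Model n) 1 X :=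
  IsManifold.of_le (n := ∞) (by exact_mod_cast le_top)

lemma isInvertible_chartD {x : X} {y : Model n} (hy : y ∈ (extChartAt 𝓘(ℝ, Model n) x).target) :
    (chartD x y).IsInvertible := by
  have := isManifold_one (n := n) (X := X)
  have h := isInvertible_mfderivWithin_extChartAt_symm (I := 𝓘(ℝ, Model n)) hy
  rw [ModelWithCorners.range_eq_univ, mfderivWithin_univ] at h
  exact h

/-- The tangent space at `x` is identified with the model through the preferred chart at `x`, so
formulas at the centre of the chart carry no Jacobian. -/
lemma mfderiv_extChartAt_self (x : X) :
    mfderiv 𝓘(ℝ, Model n) 𝓘(ℝ, Model n) (extChartAt 𝓘(ℝ, Model n) x) x =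
      ContinuousLinearMap.id ℝ (Model n) := by
  have := isManifold_one (n := n) (X := X)
  have h := (hasMFDerivAt_extChartAt (I := 𝓘(ℝ, Model n)) (mem_chart_source (Model n) x)).mfderiv
  rw [h, mfderiv_chartAt_eq_tangentCoordChange (mem_chart_source (Model n) x)]
  refine ContinuousLinearMap.ext fun v => ?_
  exact tangentCoordChange_self (mem_extChartAt_source x)

lemma chartD_self (x : X) : chartD x (cpt n x) = ContinuousLinearMap.id ℝ (Model n) := by
  have := isManifold_one (n := n) (X := X)
  have h := mfderiv_extChartAt_comp_mfderivWithin_extChartAt_symm (I := 𝓘(ℝ, Model n))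
    (mem_extChartAt_target (I := 𝓘(ℝ, Model n)) x)
  rw [ModelWithCorners.range_eq_univ, mfderivWithin_univ, extChartAt_to_inv,
    mfderiv_extChartAt_self] at h
  exact h

lemma eventually_invertible (x : X) : ∀ᶠ y in 𝓝 (cpt n x), (chartD x y).IsInvertible := by
  filter_upwards [eventually_target x] with y hy using isInvertible_chartD hy

lemma dFun_eq {x : X} {f : X → ℝ} {g : Model n → ℝ} (hg : DifferentiableAt ℝ g (cpt n x))
    (h : ∀ᶠ y in 𝓝 (cpt n x), f (cinv x y) = g y) : dFun f x = fderiv ℝ g (cpt n x) := by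
  have := isManifold_one (n := n) (X := X)
  have h1 : f =ᶠ[𝓝 x] g ∘ extChartAt 𝓘(ℝ, Model n) x := by
    refine eventually_of_chart (n := n) ?_
    filter_upwards [h, eventually_target x] with y hy hy'
    rw [hy, Function.comp_apply, cinv, (extChartAt 𝓘(ℝ, Model n) x).right_inv hy']
  have h2 : mfderiv 𝓘(ℝ, Model n) 𝓘(ℝ, ℝ) (g ∘ extChartAt 𝓘(ℝ, Model n) x) x =
      (mfderiv 𝓘(ℝ, Model n) 𝓘(ℝ, ℝ) g (cpt n x)).comp
        (mfderiv 𝓘(ℝ, Model n) 𝓘(ℝ, Model n) (extChartAt 𝓘(ℝ, Model n) x) x) :=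
    mfderiv_comp x hg.mdifferentiableAt
      (mdifferentiableAt_extChartAt (mem_chart_source (Model n) x))
  rw [dFun, h1.mfderiv_eq, h2, mfderiv_extChartAt_self, mfderiv_eq_fderiv]
  exact ContinuousLinearMap.comp_id _

/-! ### Mixed forms in charts -/

/-- The expression of a mixed form in the chart at `x`. -/
def localMF (ρ : X → MF n) (x : X) (y : Model n) : MF n :=
  fun k => localForm (fun z => ρ z k) x y

/-- The mixed form `ρ` is smooth at `x`. -/
def MFSmoothAt (ρ : X → MF n) (x : X) : Prop := ∀ k, FormSmoothAt (fun z => ρ z k) x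

lemma localForm_self {F : Type*} [NormedAddCommGroup F] [NormedSpace ℝ F] {k : ℕ}
    (θ : X → Model n [⋀^Fin k]→L[ℝ] F) (x : X) : localForm θ x (cpt n x) = θ x := by
  rw [localForm, chartD_self, extChartAt_to_inv]
  ext v
  rfl

lemma localMF_self (ρ : X → MF n) (x : X) : localMF ρ x (cpt n x) = ρ x :=
  funext fun _ => localForm_self _ x

lemma localGT_self (a : X → GT n) (x : X) : localGT a x (cpt n x) = a x := by
  rw [localGT, chartD_self, extChartAt_to_inv]
  refine Prod.ext ?_ ?_
  · simp
  · exact ContinuousLinearMap.comp_id _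

omit [IsManifold 𝓘(ℝ, Model n) ∞ X] in
lemma MFSmoothAt.diffMF {ρ : X → MF n} {x : X} (h : MFSmoothAt ρ x) :
    DiffMF (localMF ρ x) (cpt n x) := fun k =>
  (h k).differentiableAt (by simp)

omit [IsManifold 𝓘(ℝ, Model n) ∞ X] in
lemma GTSmoothAt.differentiableAt {a : X → GT n} {x : X} (h : GTSmoothAt a x) :
    DifferentiableAt ℝ (localGT a x) (cpt n x) :=
  ContDiffAt.differentiableAt h (by simp)

lemma extD_eq {F : Type*} [NormedAddCommGroup F] [NormedSpace ℝ F] {k : ℕ}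
    (θ : X → Model n [⋀^Fin k]→L[ℝ] F) (x : X) :
    extD θ x = extDeriv (localForm θ x) (cpt n x) := by
  rw [extD, mfderiv_extChartAt_self]
  ext v
  rfl

lemma dH_eq (H : X → Model n [⋀^Fin 3]→L[ℝ] ℝ) (ρ : X → MF n) (x : X) :
    dH H ρ x = dExt (localMF ρ x) (cpt n x) - threeOp (H x) (ρ x) := by
  funext k
  rw [threeOp_apply]
  cases k with
  | zero => simp [dH, dExt]
  | succ k =>
    rw [dH, extD_eq]
    rfl

omit [IsManifold 𝓘(ℝ, Model n) ∞ X] in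
lemma pair_localGT (a b : X → GT n) {x : X} {y : Model n} (hy : (chartD x y).IsInvertible) :
    pair (localGT a x y) (localGT b x y) = pair (a (cinv x y)) (b (cinv x y)) := by
  simp only [pair_apply, localGT, ContinuousLinearMap.comp_apply, hy.self_apply_inverse]

lemma alternatize_comp {k : ℕ} (D : Model n →L[ℝ] Model n) (ξ : Model n →L[ℝ] ℝ) (ρ : MF n) :
    (wedgeOne ξ ρ (k + 1)).compContinuousLinearMap D =
      wedgeOne (ξ.comp D) (fun k => (ρ k).compContinuousLinearMap D) (k + 1) := by
  ext v
  simp [wedgeOne, ContinuousAlternatingMap.alternatizeUncurryFin_apply]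
  rfl

omit [IsManifold 𝓘(ℝ, Model n) ∞ X] in
lemma localMF_cliffR (a : X → GT n) (ρ : X → MF n) {x : X} {y : Model n}
    (hy : (chartD x y).IsInvertible) :
    localMF (fun z => cliffR (a z) (ρ z)) x y = cliffR (localGT a x y) (localMF ρ x y) := by
  have hc : ∀ k, (contr (a (cinv x y)).1 (ρ (cinv x y)) k).compContinuousLinearMap (chartD x y) =
      contr (localGT a x y).1 (localMF ρ x y) k := by
    intro k
    ext v
    have : (chartD x y) ((chartD x y).inverse (a (cinv x y)).1) = (a (cinv x y)).1 :=
      hy.self_apply_inverse _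
    simp only [contr, localMF, localForm, localGT,
      ContinuousAlternatingMap.compContinuousLinearMap_apply,
      ContinuousAlternatingMap.curryLeft_apply_apply]
    congr 1
    funext i
    refine Fin.cases ?_ (fun i => ?_) i
    · exact this.symm
    · simp
  have hw : ∀ k, (wedgeOne (a (cinv x y)).2 (ρ (cinv x y)) k).compContinuousLinearMap
      (chartD x y) = wedgeOne (localGT a x y).2 (localMF ρ x y) k := by
    intro k
    cases k with
    | zero => ext v; simp [wedgeOne]
    | succ k => exact alternatize_comp _ _ _
  funext k
  rw [cliffR_apply, MF.add_apply, ← hc, ← hw]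
  rfl

/-! ### Smooth sections and the derived bracket -/

lemma GTSmoothAt.cliffR {a : X → GT n} {ρ : X → MF n} {x : X} (ha : GTSmoothAt a x)
    (hρ : MFSmoothAt ρ x) : MFSmoothAt (fun z => cliffR (a z) (ρ z)) x := by
  intro k
  refine (contDiffAt_cliffR ha hρ k).congr_of_eventuallyEq ?_
  filter_upwards [eventually_invertible x] with y hy
  exact congrFun (localMF_cliffR a ρ hy) k

lemma dExt_congr {ρ τ : Model n → MF n} {p : Model n} (h : ρ =ᶠ[𝓝 p] τ) :
    dExt ρ p = dExt τ p := by
  funext k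
  cases k with
  | zero => rfl
  | succ k => exact (h.fun_comp (fun σ : MF n => σ k)).extDeriv_eq

lemma localMF_cliffR_eventually (a : X → GT n) (ρ : X → MF n) (x : X) :
    localMF (fun z => cliffR (a z) (ρ z)) x =ᶠ[𝓝 (cpt n x)]
      fun y => cliffR (localGT a x y) (localMF ρ x y) := by
  filter_upwards [eventually_invertible x] with y hy using localMF_cliffR a ρ hy

/-- The derived bracket formula for the Dorfman bracket. -/
lemma dH_cliffR_cliffR (H : X → Model n [⋀^Fin 3]→L[ℝ] ℝ) {a b : X → GT n} {ρ : X → MF n} {x : X}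
    (ha : GTSmoothAt a x) (hb : GTSmoothAt b x) (hρ : MFSmoothAt ρ x) :
    cliffR (b x) (cliffR (a x) (dH H ρ x)) =
      dH H (fun z => cliffR (a z) (cliffR (b z) (ρ z))) x
      + cliffR (a x) (dH H (fun z => cliffR (b z) (ρ z)) x)
      - cliffR (b x) (dH H (fun z => cliffR (a z) (ρ z)) x)
      - cliffR (dorfman (localGT a x) (localGT b x) (cpt n x) + (0, contrTwo (H x) (a x).1 (b x).1))
        (ρ x) := by
  have h1 := dExt_cliffR_cliffR ha.differentiableAt hb.differentiableAt hρ.diffMF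
  have h2 := LinearMap.congr_fun (threeOp_bracket (H x) (a x) (b x)) (ρ x)
  simp only [localGT_self, localMF_self] at h1
  simp only [LinearMap.sub_apply, LinearMap.add_apply, Module.End.mul_apply,
    LinearMap.neg_apply] at h2
  have e1 : dExt (localMF (fun z => cliffR (a z) (cliffR (b z) (ρ z))) x) (cpt n x) =
      dExt (fun y => cliffR (localGT a x y) (cliffR (localGT b x y) (localMF ρ x y))) (cpt n x) := by
    refine dExt_congr ((localMF_cliffR_eventually a _ x).trans ?_)
    filter_upwards [localMF_cliffR_eventually b ρ x] with y hy
    rw [hy]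
  rw [map_add, LinearMap.add_apply, ← h1, ← neg_eq_iff_eq_neg.2 h2]
  simp only [dH_eq, map_sub]
  rw [e1, dExt_congr (localMF_cliffR_eventually b ρ x),
    dExt_congr (localMF_cliffR_eventually a ρ x)]
  abel

lemma fderiv_pair {a b : Model n → GT n} {p : Model n} (ha : DifferentiableAt ℝ a p)
    (hb : DifferentiableAt ℝ b p) (u : Model n) :
    DifferentiableAt ℝ (fun y => (b y).2 (a y).1) p ∧
    fderiv ℝ (fun y => (b y).2 (a y).1) p u =
      (b p).2 (fderiv ℝ a p u).1 + (fderiv ℝ b p u).2 (a p).1 := by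
  have h := hb.hasFDerivAt.snd.clm_apply ha.hasFDerivAt.fst
  refine ⟨h.differentiableAt, ?_⟩
  rw [h.fderiv]
  rfl

omit [IsManifold 𝓘(ℝ, Model n) ∞ X] in
lemma localForm_toForm (b : X → GT n) (x : X) (y : Model n) :
    localForm (fun z => toForm (b z).2) x y = toForm (localGT b x y).2 := by
  ext v
  rfl

lemma extD_toForm {b : X → GT n} {x : X} (hb : GTSmoothAt b x) (v u : Model n) :
    ofForm ((extD (fun z => toForm (b z).2) x).curryLeft v) u =
      (fderiv ℝ (localGT b x) (cpt n x) v).2 u - (fderiv ℝ (localGT b x) (cpt n x) u).2 v := by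
  have h0 : ∀ θ : Model n [⋀^Fin 1]→L[ℝ] ℝ, ofForm θ u = θ (fun _ => u) := fun θ => rfl
  have h1 : localForm (fun z => toForm (b z).2) x = fun y => toForm (localGT b x y).2 :=
    funext fun y => localForm_toForm b x y
  let T : (Model n →L[ℝ] ℝ) →ₗ[ℝ] (Model n [⋀^Fin 1]→L[ℝ] ℝ) :=
    { toFun := toForm
      map_add' := fun _ _ => rfl
      map_smul' := fun _ _ => rfl }
  have hT : HasFDerivAt (fun y => toForm (localGT b x y).2)
      (T.toContinuousLinearMap.comp ((ContinuousLinearMap.snd ℝ _ _).comp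
        (fderiv ℝ (localGT b x) (cpt n x)))) (cpt n x) :=
    T.toContinuousLinearMap.hasFDerivAt.comp (cpt n x) hb.differentiableAt.hasFDerivAt.snd
  rw [h0, extD_eq, h1, extDeriv, hT.fderiv, ContinuousAlternatingMap.curryLeft_apply_apply,
    ContinuousAlternatingMap.alternatizeUncurryFin_apply, Fin.sum_univ_two]
  simp only [Fin.val_zero, pow_zero, one_smul, Fin.val_one, pow_one, neg_smul]
  exact (sub_eq_add_neg _ _).symm

lemma dFun_pairing {a b : X → GT n} {x : X} (ha : GTSmoothAt a x) (hb : GTSmoothAt b x) :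
    dFun (fun z => (b z).2 (a z).1) x =
      fderiv ℝ (fun y => (localGT b x y).2 (localGT a x y).1) (cpt n x) := by
  refine dFun_eq (fderiv_pair ha.differentiableAt hb.differentiableAt 0).1 ?_
  filter_upwards [eventually_invertible x] with y hy
  simp only [localGT, ContinuousLinearMap.comp_apply, hy.self_apply_inverse]

lemma lieOne_apply {a b : X → GT n} {x : X}
    (ha : GTSmoothAt a x) (hb : GTSmoothAt b x) (u : Model n) :
    lieOne (fun z => (a z).1) (fun z => (b z).2) x u = (b x).2 (fderiv ℝ (localGT a x) (cpt n x) u).1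
      + (fderiv ℝ (localGT b x) (cpt n x) (a x).1).2 u := by
  rw [lieOne, add_apply, extD_toForm hb, dFun_pairing ha hb,
    (fderiv_pair ha.differentiableAt hb.differentiableAt u).2, localGT_self, localGT_self]
  ring

lemma mlieBracket_apply (V W : Π z : X, TangentSpace 𝓘(ℝ, Model n) z) (x : X) :
    VectorField.mlieBracket 𝓘(ℝ, Model n) V W x =
      VectorField.lieBracket ℝ (fun y => (chartD x y).inverse (V (cinv x y)))
        (fun y => (chartD x y).inverse (W (cinv x y))) (cpt n x) := by
  have hV : ∀ V : Π z : X, TangentSpace 𝓘(ℝ, Model n) z,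
      VectorField.mpullbackWithin 𝓘(ℝ, Model n) 𝓘(ℝ, Model n)
        (extChartAt 𝓘(ℝ, Model n) x).symm V (Set.range 𝓘(ℝ, Model n)) =
      fun y => (chartD x y).inverse (V (cinv x y)) := by
    intro V
    funext y
    rw [VectorField.mpullbackWithin_apply, ModelWithCorners.range_eq_univ, mfderivWithin_univ]
    rfl
  rw [← VectorField.mlieBracketWithin_univ, VectorField.mlieBracketWithin_def]
  simp only []
  refine (VectorField.mpullback_apply ..).trans ?_
  rw [mfderiv_extChartAt_self]
  refine (congrFun (congrArg DFunLike.coe ContinuousLinearMap.inverse_id) _).trans ?_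
  refine (congrArg₂ (fun V W : Model n → Model n => VectorField.lieBracketWithin ℝ V W _ _)
    (hV V) (hV W)).trans ?_
  simp only [ModelWithCorners.range_eq_univ, Set.preimage_univ, Set.inter_self,
    VectorField.lieBracketWithin_univ]

lemma mlieBracket_eq {a b : X → GT n} {x : X} (ha : GTSmoothAt a x) (hb : GTSmoothAt b x) :
    VectorField.mlieBracket 𝓘(ℝ, Model n) (fun z => (a z).1) (fun z => (b z).1) x =
      (fderiv ℝ (localGT b x) (cpt n x) (a x).1).1 -
        (fderiv ℝ (localGT a x) (cpt n x) (b x).1).1 := by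
  have hd : ∀ {a : X → GT n}, GTSmoothAt a x → ∀ v,
      fderiv ℝ (fun y => (localGT a x y).1) (cpt n x) v =
        (fderiv ℝ (localGT a x) (cpt n x) v).1 := by
    intro a ha v
    rw [ha.differentiableAt.hasFDerivAt.fst.fderiv]
    rfl
  refine (mlieBracket_apply _ _ x).trans ?_
  change VectorField.lieBracket ℝ (fun y => (localGT a x y).1) (fun y => (localGT b x y).1)
    (cpt n x) = _
  rw [VectorField.lieBracket_eq]
  simp only []
  rw [hd ha, hd hb, localGT_self, localGT_self]

/-- The Courant bracket is the Dorfman bracket with the symmetric part removed, and this part is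
half the differential of the pairing. -/
lemma courant_eq (H : X → Model n [⋀^Fin 3]→L[ℝ] ℝ) {a b : X → GT n} {x : X}
    (ha : GTSmoothAt a x) (hb : GTSmoothAt b x) :
    courant H a b x = dorfman (localGT a x) (localGT b x) (cpt n x)
      - (0, (1 / 2 : ℝ) • fderiv ℝ (fun y => pair (localGT a x y) (localGT b x y)) (cpt n x))
      + (0, contrTwo (H x) (a x).1 (b x).1) := by
  have hfst : ∀ s : Fin (2 * n) → ℝ, (∑ i, s i • (covE i : GT n)).1 = 0 := fun s => by
    simp [Prod.fst_sum, covE]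
  have hab := fderiv_pair ha.differentiableAt hb.differentiableAt
  have hba := fderiv_pair hb.differentiableAt ha.differentiableAt
  refine Prod.ext ?_ (ContinuousLinearMap.ext fun u => ?_)
  · simp only [courant, dorfman, Prod.fst_add, Prod.fst_sub, hfst, localGT_self]
    rw [mlieBracket_eq ha hb]
    abel
  · have hsnd : (∑ i, pair (fderiv ℝ (localGT a x) (cpt n x) (basisE i)) (b x) •
        (covE i : GT n)).2 u = pair (fderiv ℝ (localGT a x) (cpt n x) u) (b x) := by
      conv_rhs => rw [← sum_coord_basisE u]
      rw [map_sum, map_sum, LinearMap.sum_apply, Prod.snd_sum, sum_apply]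
      refine Finset.sum_congr rfl fun i _ => ?_
      simp [covE, mul_comm]
    have hd1 : fderiv ℝ (fun y => pair (localGT a x y) (localGT b x y)) (cpt n x) u =
        fderiv ℝ (fun y => (localGT a x y).2 (localGT b x y).1) (cpt n x) u +
        fderiv ℝ (fun y => (localGT b x y).2 (localGT a x y).1) (cpt n x) u := by
      simp only [pair_apply]
      rw [fderiv_fun_add (hba 0).1 (hab 0).1]
      rfl
    have hd2 : dFun (fun z => (b z).2 (a z).1 - (a z).2 (b z).1) x u =
        fderiv ℝ (fun y => (localGT b x y).2 (localGT a x y).1) (cpt n x) u -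
        fderiv ℝ (fun y => (localGT a x y).2 (localGT b x y).1) (cpt n x) u := by
      rw [dFun_eq ((hab 0).1.fun_sub (hba 0).1), fderiv_fun_sub (hab 0).1 (hba 0).1]
      · rfl
      · filter_upwards [eventually_invertible x] with y hy
        simp only [localGT, ContinuousLinearMap.comp_apply, hy.self_apply_inverse]
    simp only [courant, dorfman, Prod.snd_add, Prod.snd_sub, add_apply,
      sub_apply, smul_apply, localGT_self, hsnd, hd1, hd2,
      lieOne_apply ha hb, lieOne_apply hb ha, contrTwo]
    rw [(hab u).2, (hba u).2]
    simp only [localGT_self, pair_apply, smul_eq_mul]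
    ring

end

noncomputable section

open Filter Topology

variable {n : ℕ} {X : Type*} [TopologicalSpace X] [ChartedSpace (Model n) X]

/-! ### Smooth mixed forms -/

lemma localMF_add (ρ τ : X → MF n) (x : X) :
    localMF (fun z => ρ z + τ z) x = fun y => localMF ρ x y + localMF τ x y := by
  funext y k
  ext v
  rfl

lemma localMF_smul (c : ℂ) (ρ : X → MF n) (x : X) :
    localMF (fun z => c • ρ z) x = fun y => c • localMF ρ x y := by
  funext y k
  ext v
  rfl

lemma localMF_zero (x : X) : localMF (fun _ => (0 : MF n)) x = fun _ => 0 := by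
  funext y k
  ext v
  rfl

lemma MFSmoothAt.congr {ρ τ : X → MF n} {x : X} (h : MFSmoothAt ρ x)
    (he : ∀ᶠ z in 𝓝 x, τ z = ρ z) : MFSmoothAt τ x := by
  intro k
  refine (h k).congr_of_eventuallyEq ?_
  filter_upwards [eventually_chart he] with y hy
  simp only [localForm]
  rw [hy]

lemma MFSmoothAt.zero (x : X) : MFSmoothAt (fun _ => (0 : MF n)) x := by
  intro k
  refine (contDiffAt_const (c := (0 : Model n [⋀^Fin k]→L[ℝ] ℂ))).congr_of_eventuallyEq ?_
  exact Eventually.of_forall fun y => congrFun (congrFun (localMF_zero x) y) k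

lemma MFSmoothAt.add {ρ τ : X → MF n} {x : X} (hρ : MFSmoothAt ρ x) (hτ : MFSmoothAt τ x) :
    MFSmoothAt (fun z => ρ z + τ z) x := by
  intro k
  refine ((hρ k).add (hτ k)).congr_of_eventuallyEq ?_
  exact Eventually.of_forall fun y => congrFun (congrFun (localMF_add ρ τ x) y) k

lemma MFSmoothAt.smul {ρ : X → MF n} {x : X} (c : ℂ) (hρ : MFSmoothAt ρ x) :
    MFSmoothAt (fun z => c • ρ z) x := by
  intro k
  refine (ContDiffAt.const_smul c (hρ k)).congr_of_eventuallyEq ?_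
  exact Eventually.of_forall fun y => congrFun (congrFun (localMF_smul c ρ x) y) k

lemma MFSmoothAt.sum {ι : Type*} {s : Finset ι} {ρ : ι → X → MF n} {x : X}
    (h : ∀ i ∈ s, MFSmoothAt (ρ i) x) : MFSmoothAt (fun z => ∑ i ∈ s, ρ i z) x := by
  classical
  induction s using Finset.induction_on with
  | empty => simpa using MFSmoothAt.zero x
  | insert i s hi ih =>
    simp only [Finset.sum_insert hi]
    exact (h i (by simp)).add (ih fun j hj => h j (by simp [hj]))

variable [IsManifold 𝓘(ℝ, Model n) ∞ X]

lemma dH_add (H : X → Model n [⋀^Fin 3]→L[ℝ] ℝ) {ρ τ : X → MF n} {x : X}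
    (hρ : MFSmoothAt ρ x) (hτ : MFSmoothAt τ x) :
    dH H (fun z => ρ z + τ z) x = dH H ρ x + dH H τ x := by
  have : dExt (fun y => localMF ρ x y + localMF τ x y) (cpt n x) =
      dExt (localMF ρ x) (cpt n x) + dExt (localMF τ x) (cpt n x) := by
    funext k
    cases k with
    | zero => simp [dExt]
    | succ k => exact extDeriv_fun_add (hρ.diffMF k) (hτ.diffMF k)
  rw [dH_eq, dH_eq, dH_eq, localMF_add, this, map_add]
  abel

lemma dMF_smul (c : ℂ) {ρ : Model n → MF n} {p : Model n} (hρ : DiffMF ρ p) (v : Model n) :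
    dMF (fun y => c • ρ y) p v = c • dMF ρ p v := by
  funext k
  simp only [dMF, MF.smul_apply]
  rw [fderiv_fun_const_smul (hρ k)]
  rfl

lemma dH_smul (H : X → Model n [⋀^Fin 3]→L[ℝ] ℝ) (c : ℂ) {ρ : X → MF n} {x : X}
    (hρ : MFSmoothAt ρ x) : dH H (fun z => c • ρ z) x = c • dH H ρ x := by
  rw [dH_eq, dH_eq, localMF_smul, map_smul, smul_sub, dExt_eq, dExt_eq, Finset.smul_sum]
  simp only [dMF_smul c hρ.diffMF, map_smul]

lemma dH_zero (H : X → Model n [⋀^Fin 3]→L[ℝ] ℝ) (x : X) :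
    dH H (fun _ => (0 : MF n)) x = 0 := by
  have := dH_smul H 0 (MFSmoothAt.zero (n := n) x)
  simpa using this

lemma dH_sum (H : X → Model n [⋀^Fin 3]→L[ℝ] ℝ) {ι : Type*} {s : Finset ι} {ρ : ι → X → MF n}
    {x : X} (h : ∀ i ∈ s, MFSmoothAt (ρ i) x) :
    dH H (fun z => ∑ i ∈ s, ρ i z) x = ∑ i ∈ s, dH H (ρ i) x := by
  classical
  induction s using Finset.induction_on with
  | empty => simpa using dH_zero H x
  | insert i s hi ih =>
    simp only [Finset.sum_insert hi]
    rw [dH_add H (h i (by simp)) (MFSmoothAt.sum fun j hj => h j (by simp [hj])),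
      ih fun j hj => h j (by simp [hj])]

/-! ### The derived bracket on complex sections -/

lemma cliff_eq_re_im (a : GTC n) (ρ : MF n) :
    cliff a ρ = cliffR (reGT a) ρ + Complex.I • cliffR (imGT a) ρ := by
  conv_lhs => rw [← re_add_im a, map_add, cliff_tmul, cliff_tmul, one_smul]
  rfl

lemma GTCSmoothAt.cliff {a : X → GTC n} {ρ : X → MF n} {x : X} (ha : GTCSmoothAt a x)
    (hρ : MFSmoothAt ρ x) : MFSmoothAt (fun z => cliff (a z) (ρ z)) x := by
  simp only [cliff_eq_re_im]
  exact (ha.1.cliffR hρ).add ((ha.2.cliffR hρ).smul _)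

lemma dH_cliff (H : X → Model n [⋀^Fin 3]→L[ℝ] ℝ) {a : X → GTC n} {ρ : X → MF n} {x : X}
    (ha : GTCSmoothAt a x) (hρ : MFSmoothAt ρ x) :
    dH H (fun z => cliff (a z) (ρ z)) x = dH H (fun z => cliffR (reGT (a z)) (ρ z)) x
      + Complex.I • dH H (fun z => cliffR (imGT (a z)) (ρ z)) x := by
  simp only [cliff_eq_re_im]
  rw [dH_add H (ha.1.cliffR hρ) ((ha.2.cliffR hρ).smul _), dH_smul H _ (ha.2.cliffR hρ)]

lemma dH_cliffR_add (H : X → Model n [⋀^Fin 3]→L[ℝ] ℝ) {a : X → GT n} {ρ τ : X → MF n} {x : X}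
    (ha : GTSmoothAt a x) (hρ : MFSmoothAt ρ x) (hτ : MFSmoothAt τ x) (c : ℂ) :
    dH H (fun z => cliffR (a z) (ρ z + c • τ z)) x = dH H (fun z => cliffR (a z) (ρ z)) x
      + c • dH H (fun z => cliffR (a z) (τ z)) x := by
  simp only [map_add, map_smul]
  rw [dH_add H (ha.cliffR hρ) ((ha.cliffR hτ).smul _), dH_smul H _ (ha.cliffR hτ)]

/-- The Dorfman bracket of smooth sections, read in the chart. -/
def dorfmanH (H : X → Model n [⋀^Fin 3]→L[ℝ] ℝ) (a b : X → GT n) (x : X) : GT n :=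
  dorfman (localGT a x) (localGT b x) (cpt n x) + (0, contrTwo (H x) (a x).1 (b x).1)

lemma pairC_re_im (a b : GTC n) : pairC a b =
    ((pair (reGT a) (reGT b) - pair (imGT a) (imGT b) : ℝ) : ℂ) +
      Complex.I * ((pair (reGT a) (imGT b) + pair (imGT a) (reGT b) : ℝ) : ℂ) := by
  conv_lhs => rw [← re_add_im a, ← re_add_im b]
  simp only [map_add, LinearMap.add_apply, pairC_tmul]
  push_cast
  linear_combination (pair (imGT a) (imGT b) : ℂ) * Complex.I_mul_I

omit [IsManifold 𝓘(ℝ, Model n) ∞ X] in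
lemma differentiableAt_pair {a b : X → GT n} {x : X} (ha : GTSmoothAt a x) (hb : GTSmoothAt b x) :
    DifferentiableAt ℝ (fun y => pair (localGT a x y) (localGT b x y)) (cpt n x) :=
  (fderiv_pair hb.differentiableAt ha.differentiableAt 0).1.add
    (fderiv_pair ha.differentiableAt hb.differentiableAt 0).1

/-- The correction terms `½ d⟨a, b⟩` vanish since the complex pairing is identically zero. For real
and imaginary parts separately they need not vanish; only the two combinations `e1` and `e2` do. -/
lemma courantC_eq_dorfmanH (H : X → Model n [⋀^Fin 3]→L[ℝ] ℝ) {a b : X → GTC n} {x : X}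
    (ha : GTCSmoothAt a x) (hb : GTCSmoothAt b x) (h0 : ∀ z, pairC (a z) (b z) = 0) :
    courantC H a b x =
      (1 : ℂ) ⊗ₜ[ℝ] (dorfmanH H (fun z => reGT (a z)) (fun z => reGT (b z)) x
        - dorfmanH H (fun z => imGT (a z)) (fun z => imGT (b z)) x)
      + Complex.I ⊗ₜ[ℝ] (dorfmanH H (fun z => reGT (a z)) (fun z => imGT (b z)) x
        + dorfmanH H (fun z => imGT (a z)) (fun z => reGT (b z)) x) := by
  have hre : ∀ z, pair (reGT (a z)) (reGT (b z)) - pair (imGT (a z)) (imGT (b z)) = 0 := fun z => by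
    have := congrArg Complex.re (h0 z)
    rw [pairC_re_im] at this
    simpa using this
  have him : ∀ z, pair (reGT (a z)) (imGT (b z)) + pair (imGT (a z)) (reGT (b z)) = 0 := fun z => by
    have := congrArg Complex.im (h0 z)
    rw [pairC_re_im] at this
    simpa using this
  set d : (X → GT n) → (X → GT n) → Model n →L[ℝ] ℝ := fun a b =>
    fderiv ℝ (fun y => pair (localGT a x y) (localGT b x y)) (cpt n x) with hd
  have key : ∀ {a b : X → GT n}, GTSmoothAt a x → GTSmoothAt b x →
      courant H a b x = dorfmanH H a b x - (0, (1 / 2 : ℝ) • d a b) := by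
    intro a b ha hb
    rw [courant_eq H ha hb, dorfmanH]
    abel
  have e1 : d (fun z => reGT (a z)) (fun z => reGT (b z)) -
      d (fun z => imGT (a z)) (fun z => imGT (b z)) = 0 := by
    rw [hd]
    simp only []
    rw [← fderiv_fun_sub (differentiableAt_pair ha.1 hb.1) (differentiableAt_pair ha.2 hb.2),
      ← fderiv_const_apply (𝕜 := ℝ) (x := cpt n x) (0 : ℝ)]
    refine EventuallyEq.fderiv_eq ?_
    filter_upwards [eventually_invertible x] with y hy
    rw [pair_localGT _ _ hy, pair_localGT _ _ hy]
    exact hre _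
  have e2 : d (fun z => reGT (a z)) (fun z => imGT (b z)) +
      d (fun z => imGT (a z)) (fun z => reGT (b z)) = 0 := by
    rw [hd]
    simp only []
    rw [← fderiv_fun_add (differentiableAt_pair ha.1 hb.2) (differentiableAt_pair ha.2 hb.1),
      ← fderiv_const_apply (𝕜 := ℝ) (x := cpt n x) (0 : ℝ)]
    refine EventuallyEq.fderiv_eq ?_
    filter_upwards [eventually_invertible x] with y hy
    rw [pair_localGT _ _ hy, pair_localGT _ _ hy]
    exact him _
  rw [courantC, key ha.1 hb.1, key ha.1 hb.2, key ha.2 hb.1, key ha.2 hb.2]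
  congr 2
  · rw [sub_sub_sub_comm, sub_eq_self, Prod.mk_sub_mk, sub_eq_zero.1 e1, sub_self, sub_self]
    rfl
  · rw [sub_add_sub_comm, sub_eq_self, Prod.mk_add_mk, eq_neg_of_add_eq_zero_left e2, smul_neg,
      add_zero, neg_add_cancel]
    rfl

/-- The derived bracket formula for the Courant bracket of orthogonal complex sections. -/
lemma cliff_cliff_dH (H : X → Model n [⋀^Fin 3]→L[ℝ] ℝ) {a b : X → GTC n} {ρ : X → MF n} {x : X}
    (ha : GTCSmoothAt a x) (hb : GTCSmoothAt b x) (hρ : MFSmoothAt ρ x)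
    (h0 : ∀ z, pairC (a z) (b z) = 0) :
    cliff (b x) (cliff (a x) (dH H ρ x)) =
      dH H (fun z => cliff (a z) (cliff (b z) (ρ z))) x
      + cliff (a x) (dH H (fun z => cliff (b z) (ρ z)) x)
      - cliff (b x) (dH H (fun z => cliff (a z) (ρ z)) x)
      - cliff (courantC H a b x) (ρ x) := by
  have hB : ∀ {a b : X → GT n}, GTSmoothAt a x → GTSmoothAt b x →
      cliffR (b x) (cliffR (a x) (dH H ρ x)) =
      dH H (fun z => cliffR (a z) (cliffR (b z) (ρ z))) x
      + cliffR (a x) (dH H (fun z => cliffR (b z) (ρ z)) x)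
      - cliffR (b x) (dH H (fun z => cliffR (a z) (ρ z)) x)
      - cliffR (dorfmanH H a b x) (ρ x) := fun ha hb => dH_cliffR_cliffR H ha hb hρ
  have hab : dH H (fun z => cliff (a z) (cliff (b z) (ρ z))) x =
      (dH H (fun z => cliffR (reGT (a z)) (cliffR (reGT (b z)) (ρ z))) x
        + Complex.I • dH H (fun z => cliffR (reGT (a z)) (cliffR (imGT (b z)) (ρ z))) x)
      + Complex.I • (dH H (fun z => cliffR (imGT (a z)) (cliffR (reGT (b z)) (ρ z))) x
        + Complex.I • dH H (fun z => cliffR (imGT (a z)) (cliffR (imGT (b z)) (ρ z))) x) := by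
    rw [dH_cliff H ha (hb.cliff hρ)]
    simp only [cliff_eq_re_im (b _)]
    rw [dH_cliffR_add H ha.1 (hb.1.cliffR hρ) (hb.2.cliffR hρ),
      dH_cliffR_add H ha.2 (hb.1.cliffR hρ) (hb.2.cliffR hρ)]
  have hC : ∀ u v : GT n, cliff ((1 : ℂ) ⊗ₜ[ℝ] u + Complex.I ⊗ₜ[ℝ] v) (ρ x) =
      cliffR u (ρ x) + Complex.I • cliffR v (ρ x) := fun u v => by
    rw [map_add, cliff_tmul, cliff_tmul, one_smul]
    rfl
  rw [hab, dH_cliff H ha hρ, dH_cliff H hb hρ, courantC_eq_dorfmanH H ha hb h0, hC]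
  simp only [cliff_eq_re_im, map_add, map_sub, map_smul, LinearMap.add_apply, LinearMap.sub_apply,
    hB ha.1 hb.1, hB ha.1 hb.2, hB ha.2 hb.1, hB ha.2 hb.2, smul_add,
    smul_sub, smul_smul, Complex.I_mul_I]
  module

/-! ### Integrable isotropic subbundles and the filtration by annihilators -/

/-- Local smooth sections of a family of subspaces span the fibre at `x`. -/
def HasSmoothSections (L : X → Submodule ℂ (GTC n)) (x : X) : Prop :=
  ∀ a ∈ L x, ∃ s : X → GTC n, (∀ z, s z ∈ L z) ∧ GTCSmoothAt s x ∧ s x = a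

/-- In the derived bracket formula `a · b · ρ` loses two levels and `d` restores at most one, while
`a · ρ` and `b · ρ` lose one level, `d` restores it, and the outer factor removes one again. The
bracket lies in `L` and lowers `ρ` itself. The drop by two is why the induction is strong. -/
lemma dH_mem_kerFil {H : X → Model n [⋀^Fin 3]→L[ℝ] ℝ} {L : X → Submodule ℂ (GTC n)}
    (hL : Involutive H L) (hiso : ∀ z, ∀ a ∈ L z, ∀ b ∈ L z, pairC a b = 0) {x : X}
    (hs : HasSmoothSections L x) (m : ℕ) : ∀ {ρ : X → MF n}, MFSmoothAt ρ x →
      (∀ z, ρ z ∈ kerFil cliff (L z) m) → dH H ρ x ∈ kerFil cliff (L x) (m + 1) := by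
  induction m using Nat.strong_induction_on with
  | _ m ih =>
    intro ρ hρ hm
    match m with
    | 0 =>
      have : ρ = fun _ => 0 := funext fun z => by simpa [kerFil] using hm z
      rw [this, dH_zero]
      exact zero_mem _
    | m + 1 =>
      refine mem_kerFil_succ.2 fun a ha => mem_kerFil_succ.2 fun b hb => ?_
      obtain ⟨a, haL, haS, rfl⟩ := hs a ha
      obtain ⟨b, hbL, hbS, rfl⟩ := hs b hb
      rw [cliff_cliff_dH H haS hbS hρ fun z => hiso z _ (haL z) _ (hbL z)]
      have h1 : ∀ {s : X → GTC n}, (∀ z, s z ∈ L z) → GTCSmoothAt s x →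
          dH H (fun z => cliff (s z) (ρ z)) x ∈ kerFil cliff (L x) (m + 1) := fun hsL hsS =>
        ih m (by omega) (hsS.cliff hρ) fun z => mem_kerFil_succ.1 (hm z) _ (hsL z)
      refine sub_mem (sub_mem (add_mem ?_ ?_) ?_) ?_
      · match m with
        -- At level one `ρ` is killed by a single element, so `a · b · ρ` is already zero and no
        -- lower level is needed.
        | 0 =>
          have : (fun z => cliff (a z) (cliff (b z) (ρ z))) = fun _ => 0 := funext fun z => by
            rw [mem_kerFil_one.1 (hm z) _ (hbL z), map_zero]
          rw [this, dH_zero]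
          exact zero_mem _
        | m + 1 =>
          exact ih m (by omega) (haS.cliff (hbS.cliff hρ)) fun z =>
            mem_kerFil_succ.1 (mem_kerFil_succ.1 (hm z) _ (hbL z)) _ (haL z)
      · exact mem_kerFil_succ.1 (h1 hbL hbS) _ ha
      · exact mem_kerFil_succ.1 (h1 haL haS) _ hb
      · exact mem_kerFil_succ.1 (hm x) _ (hL a b haL hbL x haS hbS)

end

noncomputable section

open Filter Topology

variable {n : ℕ} {X : Type*} [TopologicalSpace X] [ChartedSpace (Model n) X]

/-! ### Smooth functions and sections -/

/-- The function `f` is smooth at `x`, in the chart at `x`. -/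
def FnSmoothAt (f : X → ℝ) (x : X) : Prop :=
  ContDiffAt ℝ ∞ (fun y => f (cinv x y)) (cpt n x)

lemma GTSmoothAt.congr {a b : X → GT n} {x : X} (h : GTSmoothAt a x)
    (he : ∀ᶠ z in 𝓝 x, b z = a z) : GTSmoothAt b x := by
  refine ContDiffAt.congr_of_eventuallyEq h ?_
  filter_upwards [eventually_chart he] with y hy
  simp only [localGT]
  rw [hy]

lemma localGT_add (a b : X → GT n) (x : X) (y : Model n) :
    localGT (fun z => a z + b z) x y = localGT a x y + localGT b x y :=
  Prod.ext (map_add _ _ _) (ContinuousLinearMap.add_comp _ _ _)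

lemma localGT_smul (f : X → ℝ) (a : X → GT n) (x : X) (y : Model n) :
    localGT (fun z => f z • a z) x y = f (cinv x y) • localGT a x y :=
  Prod.ext (map_smul _ _ _) (ContinuousLinearMap.smul_comp _ _ _)

lemma GTSmoothAt.add {a b : X → GT n} {x : X} (ha : GTSmoothAt a x) (hb : GTSmoothAt b x) :
    GTSmoothAt (fun z => a z + b z) x :=
  (ContDiffAt.add ha hb).congr_of_eventuallyEq (Eventually.of_forall fun y => localGT_add a b x y)

lemma GTSmoothAt.smul {f : X → ℝ} {a : X → GT n} {x : X} (hf : FnSmoothAt (n := n) f x)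
    (ha : GTSmoothAt a x) : GTSmoothAt (fun z => f z • a z) x :=
  (ContDiffAt.smul hf ha).congr_of_eventuallyEq (Eventually.of_forall fun y => localGT_smul f a x y)

lemma FnSmoothAt.const (c : ℝ) (x : X) : FnSmoothAt (n := n) (fun _ => c) x := contDiffAt_const

lemma GTSmoothAt.neg {a : X → GT n} {x : X} (ha : GTSmoothAt a x) :
    GTSmoothAt (fun z => -a z) x := by
  have h : (fun z => -a z) = fun z => (-1 : ℝ) • a z :=
    funext fun z => (neg_one_smul ℝ (a z)).symm
  rw [h]
  exact GTSmoothAt.smul (FnSmoothAt.const (-1) x) ha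

lemma GTSmoothAt.sum {ι : Type*} {s : Finset ι} {a : ι → X → GT n} {x : X}
    (h : ∀ i ∈ s, GTSmoothAt (a i) x) : GTSmoothAt (fun z => ∑ i ∈ s, a i z) x := by
  classical
  induction s using Finset.induction_on with
  | empty =>
    refine (contDiffAt_const (c := (0 : GT n))).congr_of_eventuallyEq
      (Eventually.of_forall fun y => ?_)
    exact Prod.ext (map_zero _) (ContinuousLinearMap.zero_comp _)
  | insert i s hi ih =>
    simp only [Finset.sum_insert hi]
    exact (h i (by simp)).add (ih fun j hj => h j (by simp [hj]))

lemma GTCSmoothAt.congr {a b : X → GTC n} {x : X} (h : GTCSmoothAt a x)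
    (he : ∀ᶠ z in 𝓝 x, b z = a z) : GTCSmoothAt b x :=
  ⟨h.1.congr (he.mono fun z hz => by rw [hz]), h.2.congr (he.mono fun z hz => by rw [hz])⟩

lemma GTCSmoothAt.add {a b : X → GTC n} {x : X} (ha : GTCSmoothAt a x) (hb : GTCSmoothAt b x) :
    GTCSmoothAt (fun z => a z + b z) x := by
  simp only [GTCSmoothAt, map_add]
  exact ⟨ha.1.add hb.1, ha.2.add hb.2⟩

lemma reGT_smul (c : ℂ) (a : GTC n) : reGT (c • a) = c.re • reGT a + -(c.im • imGT a) := by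
  induction a using TensorProduct.induction_on with
  | zero => simp
  | add a a' ha ha' => simp only [smul_add, map_add, ha, ha']; module
  | tmul z a =>
    rw [TensorProduct.smul_tmul', reGT_tmul, reGT_tmul, imGT_tmul, smul_eq_mul, Complex.mul_re]
    module

lemma imGT_smul (c : ℂ) (a : GTC n) : imGT (c • a) = c.re • imGT a + c.im • reGT a := by
  induction a using TensorProduct.induction_on with
  | zero => simp
  | add a a' ha ha' => simp only [smul_add, map_add, ha, ha']; module
  | tmul z a =>
    rw [TensorProduct.smul_tmul', imGT_tmul, reGT_tmul, imGT_tmul, smul_eq_mul, Complex.mul_im]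
    module

lemma GTCSmoothAt.smul {f : X → ℂ} {a : X → GTC n} {x : X}
    (hf : FnSmoothAt (n := n) (fun z => (f z).re) x)
    (hf' : FnSmoothAt (n := n) (fun z => (f z).im) x)
    (ha : GTCSmoothAt a x) : GTCSmoothAt (fun z => f z • a z) x := by
  simp only [GTCSmoothAt, reGT_smul, imGT_smul]
  exact ⟨(GTSmoothAt.smul hf ha.1).add (GTSmoothAt.smul hf' ha.2).neg,
    (GTSmoothAt.smul hf ha.2).add (GTSmoothAt.smul hf' ha.1)⟩

lemma GTCSmoothAt.const_smul {a : X → GTC n} {x : X} (c : ℂ) (ha : GTCSmoothAt a x) :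
    GTCSmoothAt (fun z => c • a z) x :=
  GTCSmoothAt.smul (f := fun _ => c) (FnSmoothAt.const _ x) (FnSmoothAt.const _ x) ha

lemma GTCSmoothAt.sum {ι : Type*} {s : Finset ι} {a : ι → X → GTC n} {x : X}
    (h : ∀ i ∈ s, GTCSmoothAt (a i) x) : GTCSmoothAt (fun z => ∑ i ∈ s, a i z) x := by
  simp only [GTCSmoothAt, map_sum]
  exact ⟨GTSmoothAt.sum fun i hi => (h i hi).1, GTSmoothAt.sum fun i hi => (h i hi).2⟩

lemma GTCSmoothAt.conj {a : X → GTC n} {x : X} (ha : GTCSmoothAt a x) :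
    GTCSmoothAt (fun z => conjGT (a z)) x := by
  simp only [GTCSmoothAt, reGT_conjGT, imGT_conjGT]
  exact ⟨ha.1, ha.2.neg⟩

lemma GTSmoothAt.tmul {a : X → GT n} {x : X} (ha : GTSmoothAt a x) :
    GTCSmoothAt (fun z => (1 : ℂ) ⊗ₜ[ℝ] a z) x := by
  have h0 : GTSmoothAt (fun z => (0 : ℝ) • a z) x := GTSmoothAt.smul (FnSmoothAt.const 0 x) ha
  simp only [GTCSmoothAt, reGT_tmul, imGT_tmul, Complex.one_re, Complex.one_im, one_smul]
  exact ⟨ha, h0⟩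

variable [IsManifold 𝓘(ℝ, Model n) ∞ X]

lemma GTSmoothAt.pair {a b : X → GT n} {x : X} (ha : GTSmoothAt a x) (hb : GTSmoothAt b x) :
    FnSmoothAt (n := n) (fun z => GenCx.pair (a z) (b z)) x := by
  have h : ContDiffAt ℝ ∞ (fun y => GenCx.pair (localGT a x y) (localGT b x y)) (cpt n x) := by
    simp only [pair_apply]
    exact (ha.snd.clm_apply hb.fst).add (hb.snd.clm_apply ha.fst)
  refine h.congr_of_eventuallyEq ?_
  filter_upwards [eventually_invertible x] with y hy
  exact (pair_localGT a b hy).symm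

/-! ### Coordinate frames -/

omit [IsManifold 𝓘(ℝ, Model n) ∞ X] in
lemma constSec_add (x z : X) (v w : GT n) :
    constSec x (v + w) z = constSec x v z + constSec x w z :=
  Prod.ext (map_add _ _ _) (ContinuousLinearMap.add_comp _ _ _)

omit [IsManifold 𝓘(ℝ, Model n) ∞ X] in
lemma constSec_smul (x z : X) (r : ℝ) (w : GT n) :
    constSec x (r • w) z = r • constSec x w z :=
  Prod.ext (map_smul _ _ _) (ContinuousLinearMap.smul_comp _ _ _)

/-- Evaluation of coordinate sections, as a linear map. -/
def constSecL (x z : X) : GT n →ₗ[ℝ] GT n where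
  toFun w := constSec x w z
  map_add' := constSec_add x z
  map_smul' := constSec_smul x z

omit [IsManifold 𝓘(ℝ, Model n) ∞ X] in
lemma constSecL_apply (x z : X) (w : GT n) : constSecL x z w = constSec x w z := rfl

lemma constSec_self (x : X) (w : GT n) : constSec x w x = w := by
  rw [constSec, chartD_self]
  exact Prod.ext rfl (by
    simp only [ContinuousLinearMap.inverse_id]
    exact ContinuousLinearMap.comp_id _)

lemma constSec_smoothAt (x : X) (w : GT n) : GTSmoothAt (constSec x w) x := by
  refine (contDiffAt_const (c := w)).congr_of_eventuallyEq ?_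
  filter_upwards [eventually_invertible x, eventually_target x] with y hy hy'
  have h : extChartAt 𝓘(ℝ, Model n) x (cinv x y) = y :=
    (extChartAt 𝓘(ℝ, Model n) x).right_inv hy'
  simp only [localGT, constSec]
  rw [h]
  refine Prod.ext (hy.inverse_apply_self _) (ContinuousLinearMap.ext fun v => ?_)
  exact congrArg w.2 (hy.inverse_apply_self v)

lemma eventually_invertible_chart (x : X) :
    ∀ᶠ z in 𝓝 x, (chartD x (extChartAt 𝓘(ℝ, Model n) x z)).IsInvertible :=
  (continuousAt_extChartAt x).eventually (eventually_invertible x)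

omit [IsManifold 𝓘(ℝ, Model n) ∞ X] in
lemma pair_constSec {x z : X} (h : (chartD x (extChartAt 𝓘(ℝ, Model n) x z)).IsInvertible)
    (v w : GT n) : pair (constSec x v z) (constSec x w z) = pair v w := by
  simp only [pair_apply, constSec, ContinuousLinearMap.comp_apply, h.inverse_apply_self]

omit [IsManifold 𝓘(ℝ, Model n) ∞ X] in
lemma exists_constSec_eq {x z : X}
    (h : (chartD x (extChartAt 𝓘(ℝ, Model n) x z)).IsInvertible) (a : GT n) :
    ∃ w, constSec x w z = a := by
  refine ⟨((chartD x (extChartAt 𝓘(ℝ, Model n) x z)).inverse a.1,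
    a.2.comp (chartD x (extChartAt 𝓘(ℝ, Model n) x z))), ?_⟩
  refine Prod.ext (h.self_apply_inverse _) (ContinuousLinearMap.ext fun v => ?_)
  exact congrArg a.2 (h.self_apply_inverse v)

lemma eventually_isDualPair (x : X) : ∀ᶠ z in 𝓝 x,
    IsDualPair (pairC (n := n)) (fun i => (1 : ℂ) ⊗ₜ[ℝ] constSec x (coordE i) z)
      (fun i => (1 : ℂ) ⊗ₜ[ℝ] constSec x (coordF i) z) := by
  filter_upwards [eventually_invertible_chart (n := n) x] with z hz
  have key : ∀ {e f : Fin (2 * n) ⊕ Fin (2 * n) → GT n}, (∀ a, ∑ i, pair (f i) a • e i = a) →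
      ∀ a, ∑ i, pair (constSec x (f i) z) a • constSec x (e i) z = a := by
    intro e f h a
    obtain ⟨w, rfl⟩ := exists_constSec_eq hz a
    simp only [pair_constSec hz]
    simp only [← constSecL_apply, ← map_smul]
    rw [← map_sum, h]
  exact isDualPair_complexify (key sum_coordE) (key sum_coordF)

/-! ### Smooth bundle endomorphisms -/

/-- The bundle endomorphism `A` is smooth at `x`. -/
def EndCSmoothAt (A : X → GTC n →ₗ[ℂ] GTC n) (x : X) : Prop :=
  ∀ w : GT n, GTCSmoothAt (fun z => A z (1 ⊗ₜ[ℝ] constSec x w z)) x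

/-- Expansion of `a` in the chart frame: the coefficients are pairings with smooth sections, and `A`
has smooth values on the frame. -/
lemma EndCSmoothAt.apply {A : X → GTC n →ₗ[ℂ] GTC n} {a : X → GTC n} {x : X}
    (hA : EndCSmoothAt A x) (ha : GTCSmoothAt a x) : GTCSmoothAt (fun z => A z (a z)) x := by
  have h : GTCSmoothAt (fun z => ∑ i, pairC (1 ⊗ₜ[ℝ] constSec x (coordF i) z) (a z) •
      A z (1 ⊗ₜ[ℝ] constSec x (coordE i) z)) x := by
    have hr : ∀ (w : GT n) (a : GTC n), (pairC ((1 : ℂ) ⊗ₜ[ℝ] w) a).re = pair w (reGT a) ∧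
        (pairC ((1 : ℂ) ⊗ₜ[ℝ] w) a).im = pair w (imGT a) := by
      intro w a
      rw [pairC_re_im]
      simp [reGT_tmul, imGT_tmul]
    refine GTCSmoothAt.sum fun i _ => GTCSmoothAt.smul ?_ ?_ (hA _)
    · simp only [(hr _ _).1]
      exact (constSec_smoothAt x _).pair ha.1
    · simp only [(hr _ _).2]
      exact (constSec_smoothAt x _).pair ha.2
  refine h.congr ?_
  filter_upwards [eventually_isDualPair (n := n) x] with z hz
  conv_lhs => rw [← hz.left (a z), map_sum]
  simp only [map_smul]

lemma EndCSmoothAt.id (x : X) :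
    EndCSmoothAt (fun _ : X => (LinearMap.id : GTC n →ₗ[ℂ] GTC n)) x :=
  fun w => (constSec_smoothAt x w).tmul

lemma EndCSmoothAt.comp {A B : X → GTC n →ₗ[ℂ] GTC n} {x : X} (hA : EndCSmoothAt A x)
    (hB : EndCSmoothAt B x) : EndCSmoothAt (fun z => A z ∘ₗ B z) x :=
  fun w => hA.apply (hB w)

omit [IsManifold 𝓘(ℝ, Model n) ∞ X] in
lemma EndCSmoothAt.smul {A : X → GTC n →ₗ[ℂ] GTC n} {x : X} (c : ℂ) (hA : EndCSmoothAt A x) :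
    EndCSmoothAt (fun z => c • A z) x :=
  fun w => (hA w).const_smul c

omit [IsManifold 𝓘(ℝ, Model n) ∞ X] in
lemma EndCSmoothAt.add {A B : X → GTC n →ₗ[ℂ] GTC n} {x : X} (hA : EndCSmoothAt A x)
    (hB : EndCSmoothAt B x) : EndCSmoothAt (fun z => A z + B z) x :=
  fun w => (hA w).add (hB w)

omit [IsManifold 𝓘(ℝ, Model n) ∞ X] in
lemma EndCSmoothAt.neg {A : X → GTC n →ₗ[ℂ] GTC n} {x : X} (hA : EndCSmoothAt A x) :
    EndCSmoothAt (fun z => -A z) x := by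
  have h : (fun z => -A z) = fun z => (-1 : ℂ) • A z :=
    funext fun z => (neg_one_smul ℂ (A z)).symm
  rw [h]
  exact hA.smul (-1)

omit [IsManifold 𝓘(ℝ, Model n) ∞ X] in
lemma EndCSmoothAt.sub {A B : X → GTC n →ₗ[ℂ] GTC n} {x : X} (hA : EndCSmoothAt A x)
    (hB : EndCSmoothAt B x) : EndCSmoothAt (fun z => A z - B z) x := by
  simp only [sub_eq_add_neg]
  exact hA.add hB.neg

omit [IsManifold 𝓘(ℝ, Model n) ∞ X] in
lemma EndCSmoothAt.epsStar {A : X → GTC n →ₗ[ℂ] GTC n} {x : X} (hA : EndCSmoothAt A x) :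
    EndCSmoothAt (fun z => epsStar (A z)) x := by
  intro w
  simp only [epsStar_apply, conjGT_tmul, map_one]
  exact (hA w).conj

omit [IsManifold 𝓘(ℝ, Model n) ∞ X] in
lemma EndSmooth.projL {J : X → GT n →ₗ[ℝ] GT n} (hJ : EndSmooth J) (x : X)
    (hid : EndCSmoothAt (fun _ : X => (LinearMap.id : GTC n →ₗ[ℂ] GTC n)) x) :
    EndCSmoothAt (fun z => projL (J z)) x := by
  have h : EndCSmoothAt (fun z => (J z).baseChange ℂ) x := fun w => by
    simp only [LinearMap.baseChange_tmul]
    exact (hJ x w).tmul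
  exact (hid.sub (h.smul _)).smul _

/-! ### Smooth sections of the eigenbundles -/

/-- The complex section with constant expression in the chart at `x`. -/
def constSecC (x : X) (a : GTC n) (z : X) : GTC n :=
  (1 : ℂ) ⊗ₜ[ℝ] constSec x (reGT a) z + Complex.I • ((1 : ℂ) ⊗ₜ[ℝ] constSec x (imGT a) z)

lemma constSecC_self (x : X) (a : GTC n) : constSecC x a x = a := by
  rw [constSecC, constSec_self, constSec_self, smul_one_tmul, re_add_im]

lemma constSecC_smoothAt (x : X) (a : GTC n) : GTCSmoothAt (constSecC x a) x :=
  (constSec_smoothAt x _).tmul.add ((constSec_smoothAt x _).tmul.const_smul _)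

omit [IsManifold 𝓘(ℝ, Model n) ∞ X] in
lemma HasSmoothSections.conj {L : X → Submodule ℂ (GTC n)} {x : X} (h : HasSmoothSections L x) :
    HasSmoothSections (fun z => (L z).map conjGT) x := by
  rintro _ ⟨a, ha, rfl⟩
  obtain ⟨s, hs, hsx, rfl⟩ := h a ha
  exact ⟨fun z => conjGT (s z), fun z => ⟨s z, hs z, rfl⟩, hsx.conj, rfl⟩

/-- A chart-constant section is projected to the eigenbundle. The projection has values in the
eigenspace at every point, while smoothness is asked for only at `x`, so no cutoff function is
needed. -/
lemma hasSmoothSections_eigL {J : X → GT n →ₗ[ℝ] GT n} (hJ : EndSmooth J)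
    (hsq : ∀ x a, J x (J x a) = -a) (x : X) : HasSmoothSections (fun z => eigL (J z)) x :=
  fun a ha => ⟨fun z => projL (J z) (constSecC x a z), fun z => projL_mem (hsq z) _,
    (hJ.projL x (EndCSmoothAt.id x)).apply (constSecC_smoothAt x a), by
      simp only [constSecC_self, projL_of_mem ha]⟩

lemma HasSmoothSections.defL {L : X → Submodule ℂ (GTC n)} {x : X} (h : HasSmoothSections L x)
    {ε : X → GTC n →ₗ[ℂ] GTC n} (hε : EndCSmoothAt ε x) :
    HasSmoothSections (fun z => defL (L z) (ε z)) x := by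
  rintro _ ⟨a, ha, rfl⟩
  obtain ⟨s, hs, hsx, rfl⟩ := h a ha
  exact ⟨fun z => (LinearMap.id + ε z : GTC n →ₗ[ℂ] GTC n) (s z), fun z => ⟨s z, hs z, rfl⟩,
    hsx.add (hε.apply hsx), rfl⟩

/-! ### Conjugation of the Courant bracket -/

omit [IsManifold 𝓘(ℝ, Model n) ∞ X] in
lemma localGT_neg (a : X → GT n) (x : X) : localGT (fun z => -a z) x = fun y => -localGT a x y :=
  funext fun _ => Prod.ext (map_neg _ _) (ContinuousLinearMap.neg_comp _ _)

lemma contrTwo_neg_left (h : Model n [⋀^Fin 3]→L[ℝ] ℝ) (v w : Model n) :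
    contrTwo h (-v) w = -contrTwo h v w := by
  rw [contrTwo, map_neg]
  rfl

lemma contrTwo_neg_right (h : Model n [⋀^Fin 3]→L[ℝ] ℝ) (v w : Model n) :
    contrTwo h v (-w) = -contrTwo h v w := by
  rw [contrTwo, map_neg]
  rfl

lemma dorfman_neg_left {a b : Model n → GT n} {p : Model n} :
    dorfman (fun y => -a y) b p = -dorfman a b p := by
  have hs : ∀ (r : ℝ) (c : GT n), (-r) • c = -(r • c) := fun r c =>
    Prod.ext (neg_smul r c.1) (neg_smul r c.2)
  simp only [dorfman, fderiv_fun_neg, neg_apply, Prod.fst_neg, map_neg, LinearMap.neg_apply, hs,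
    Finset.sum_neg_distrib]
  abel

lemma dorfman_neg_right {a b : Model n → GT n} {p : Model n} :
    dorfman a (fun y => -b y) p = -dorfman a b p := by
  have hs : ∀ (r : ℝ) (c : GT n), (-r) • c = -(r • c) := fun r c =>
    Prod.ext (neg_smul r c.1) (neg_smul r c.2)
  simp only [dorfman, fderiv_fun_neg, neg_apply, Prod.fst_neg, map_neg, hs,
    Finset.sum_neg_distrib]
  abel

lemma courant_neg_left (H : X → Model n [⋀^Fin 3]→L[ℝ] ℝ) {a b : X → GT n} {x : X}
    (ha : GTSmoothAt a x) (hb : GTSmoothAt b x) :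
    courant H (fun z => -a z) b x = -courant H a b x := by
  rw [courant_eq H ha.neg hb, courant_eq H ha hb, localGT_neg, dorfman_neg_left]
  simp only [map_neg, LinearMap.neg_apply, fderiv_fun_neg, Prod.fst_neg, contrTwo_neg_left]
  refine Prod.ext ?_ ?_
  · simp
  · simp only [Prod.snd_add, Prod.snd_sub, Prod.snd_neg, smul_neg, neg_add, neg_sub]
    abel

lemma courant_neg_right (H : X → Model n [⋀^Fin 3]→L[ℝ] ℝ) {a b : X → GT n} {x : X}
    (ha : GTSmoothAt a x) (hb : GTSmoothAt b x) :
    courant H a (fun z => -b z) x = -courant H a b x := by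
  rw [courant_eq H ha hb.neg, courant_eq H ha hb, localGT_neg, dorfman_neg_right]
  simp only [map_neg, fderiv_fun_neg, Prod.fst_neg, contrTwo_neg_right]
  refine Prod.ext ?_ ?_
  · simp
  · simp only [Prod.snd_add, Prod.snd_sub, Prod.snd_neg, smul_neg, neg_add, neg_sub]
    abel

lemma courantC_conj (H : X → Model n [⋀^Fin 3]→L[ℝ] ℝ) {a b : X → GTC n} {x : X}
    (ha : GTCSmoothAt a x) (hb : GTCSmoothAt b x) :
    courantC H (fun z => conjGT (a z)) (fun z => conjGT (b z)) x = conjGT (courantC H a b x) := by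
  simp only [courantC, reGT_conjGT, imGT_conjGT, map_add, conjGT_tmul, map_one, Complex.conj_I]
  rw [courant_neg_left H ha.2 hb.2.neg, courant_neg_right H ha.2 hb.2,
    courant_neg_right H ha.1 hb.2, courant_neg_left H ha.2 hb.1, neg_neg, ← neg_add,
    TensorProduct.tmul_neg, TensorProduct.neg_tmul]

/-- The bracket is real. Involutivity of the conjugate bundle is what bounds the degrees of `dρ`
from below. -/
lemma Involutive.conj {H : X → Model n [⋀^Fin 3]→L[ℝ] ℝ} {L : X → Submodule ℂ (GTC n)}
    (hL : Involutive H L) : Involutive H fun z => (L z).map conjGT := by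
  intro a b ha hb x hax hbx
  have h := hL (fun z => conjGT (a z)) (fun z => conjGT (b z))
    (fun z => mem_map_conjGT.1 (ha z)) (fun z => mem_map_conjGT.1 (hb z)) x hax.conj hbx.conj
  rw [courantC_conj H hax hbx] at h
  exact mem_map_conjGT.2 h

/-! ### Smooth families of operators on forms -/

/-- The family of operators `Φ` preserves smoothness at `x`. -/
def OpSmoothAt (Φ : X → Module.End ℂ (MF n)) (x : X) : Prop :=
  ∀ ρ : X → MF n, MFSmoothAt ρ x → MFSmoothAt (fun z => Φ z (ρ z)) x

omit [IsManifold 𝓘(ℝ, Model n) ∞ X] in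
lemma OpSmoothAt.mul {Φ Ψ : X → Module.End ℂ (MF n)} {x : X} (hΦ : OpSmoothAt Φ x)
    (hΨ : OpSmoothAt Ψ x) : OpSmoothAt (fun z => Φ z * Ψ z) x :=
  fun _ hρ => hΦ _ (hΨ _ hρ)

omit [IsManifold 𝓘(ℝ, Model n) ∞ X] in
lemma OpSmoothAt.one (x : X) : OpSmoothAt (fun _ : X => (1 : Module.End ℂ (MF n))) x :=
  fun _ hρ => hρ

omit [IsManifold 𝓘(ℝ, Model n) ∞ X] in
lemma OpSmoothAt.smul {Φ : X → Module.End ℂ (MF n)} {x : X} (c : ℂ) (hΦ : OpSmoothAt Φ x) :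
    OpSmoothAt (fun z => c • Φ z) x :=
  fun ρ hρ => (hΦ ρ hρ).smul c

omit [IsManifold 𝓘(ℝ, Model n) ∞ X] in
lemma OpSmoothAt.sum {ι : Type*} {s : Finset ι} {Φ : ι → X → Module.End ℂ (MF n)} {x : X}
    (h : ∀ i ∈ s, OpSmoothAt (Φ i) x) : OpSmoothAt (fun z => ∑ i ∈ s, Φ i z) x := fun ρ hρ => by
  simp only [LinearMap.sum_apply]
  exact MFSmoothAt.sum fun i hi => h i hi ρ hρ

omit [IsManifold 𝓘(ℝ, Model n) ∞ X] in
lemma OpSmoothAt.pow {Φ : X → Module.End ℂ (MF n)} {x : X} (hΦ : OpSmoothAt Φ x) (m : ℕ) :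
    OpSmoothAt (fun z => Φ z ^ m) x := by
  induction m with
  | zero => exact OpSmoothAt.one x
  | succ m ih =>
    simp only [pow_succ]
    exact ih.mul hΦ

omit [IsManifold 𝓘(ℝ, Model n) ∞ X] in
lemma OpSmoothAt.texp {Φ : X → Module.End ℂ (MF n)} {x : X} (hΦ : OpSmoothAt Φ x) (N : ℕ) :
    OpSmoothAt (fun z => texp N (Φ z)) x :=
  OpSmoothAt.sum fun m _ => (hΦ.pow m).smul _

omit [IsManifold 𝓘(ℝ, Model n) ∞ X] in
lemma OpSmoothAt.congr {Φ Ψ : X → Module.End ℂ (MF n)} {x : X} (hΦ : OpSmoothAt Φ x)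
    (h : ∀ᶠ z in 𝓝 x, Ψ z = Φ z) : OpSmoothAt Ψ x :=
  fun ρ hρ => (hΦ ρ hρ).congr (h.mono fun z hz => by rw [hz])

lemma GTCSmoothAt.opSmoothAt {a : X → GTC n} {x : X} (ha : GTCSmoothAt a x) :
    OpSmoothAt (fun z => GenCx.cliff (a z)) x :=
  fun _ hρ => ha.cliff hρ

/-- The frame `coordE` in the fibre at `z` refers to the preferred chart at `z` and need not vary
smoothly. Near `x` it is replaced by the frame constant in the chart at `x`, which gives the same
operator. -/
lemma EndCSmoothAt.twoAct {A : X → GTC n →ₗ[ℂ] GTC n} {x : X} (hA : EndCSmoothAt A x) :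
    OpSmoothAt (fun z => twoAct (A z)) x := by
  refine OpSmoothAt.congr (OpSmoothAt.smul (1 / 2 : ℂ) (OpSmoothAt.sum (s := Finset.univ)
    fun i _ => (hA (coordE i)).opSmoothAt.mul (constSec_smoothAt x (coordF i)).tmul.opSmoothAt)) ?_
  filter_upwards [eventually_isDualPair (n := n) x] with z hz
  rw [twoAct_eq, isDualPair_coord.twoOp_eq pairC_comm hz]
  rfl

lemma EndCSmoothAt.nTerm {A : X → GTC n →ₗ[ℂ] GTC n} {x : X} (hA : EndCSmoothAt A x) (m : ℕ) :
    OpSmoothAt (fun z => nTerm cliff (fun i => (1 : ℂ) ⊗ₜ[ℝ] coordE i)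
      (fun i => (1 : ℂ) ⊗ₜ[ℝ] coordF i) (A z) m) x := by
  suffices h : OpSmoothAt (fun z => GenCx.nTerm cliff
      (fun i => (1 : ℂ) ⊗ₜ[ℝ] constSec x (coordE i) z)
      (fun i => (1 : ℂ) ⊗ₜ[ℝ] constSec x (coordF i) z) (A z) m) x by
    refine h.congr ?_
    filter_upwards [eventually_isDualPair (n := n) x] with z hz
    rw [isDualPair_coord.nTerm_eq pairC_comm hz]
  induction m with
  | zero => exact OpSmoothAt.one x
  | succ m ih =>
    exact OpSmoothAt.sum fun i _ => ((hA (coordE i)).opSmoothAt.mul ih).mul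
      (constSec_smoothAt x (coordF i)).tmul.opSmoothAt

lemma EndCSmoothAt.nOrd {A : X → GTC n →ₗ[ℂ] GTC n} {x : X} (hA : EndCSmoothAt A x) (N : ℕ) :
    OpSmoothAt (fun z => nOrd cliff (fun i => (1 : ℂ) ⊗ₜ[ℝ] coordE i)
      (fun i => (1 : ℂ) ⊗ₜ[ℝ] coordF i) (A z) N) x :=
  OpSmoothAt.sum fun m _ => (hA.nTerm m).smul _

end

noncomputable section

open Filter Topology

variable {n : ℕ}

/-! ### The operators of the theorem on forms of all degrees -/

/-- The operator `e^ε` on all mixed forms. -/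
def expOp (ε : GTC n →ₗ[ℂ] GTC n) : Module.End ℂ (MF n) := texp (n + 2) (twoAct ε)

/-- The operator `1 - εε*` on all mixed forms. -/
def oneSubEnd (ε : GTC n →ₗ[ℂ] GTC n) : Module.End ℂ (MF n) :=
  oneSubOp cliff (fun i => (1 : ℂ) ⊗ₜ[ℝ] coordE i) (fun i => (1 : ℂ) ⊗ₜ[ℝ] coordF i) ε (epsStar ε)
    (2 * n + 1)

section Pointwise

variable {L : Submodule ℂ (GTC n)} {ε : GTC n →ₗ[ℂ] GTC n}

lemma oneSubMap_eq (hiso : ∀ a ∈ L, ∀ b ∈ L, pairC a b = 0) (hL : IsCompl L (L.map conjGT))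
    (hε : IsTwoVector L ε) {k : ℕ} {σ : MF n} (hσ : σ ∈ U L ((k : ℤ) - n)) :
    oneSubMap L ε k σ = oneSubEnd ε σ := by
  obtain ⟨-, -, l, l', h⟩ := exists_polarization hiso (pairC_conj_isotropic hiso) hL
  exact multExt_eq
    (fun a ha => h.oneSubOp_mul isDualPair_coord (hε.isSkewMap hL) (hε.isSkewMap_epsStar hL)
      (Nat.lt_succ_self _) ha)
    (fun ρ hρ => h.oneSubOp_of_mem_kerFil_one isDualPair_coord (hε.isSkewMap_epsStar hL)
      (Nat.succ_pos _) hρ) hσ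

lemma twoAct_pow_eq_zero (hiso : ∀ a ∈ L, ∀ b ∈ L, pairC a b = 0) (hL : IsCompl L (L.map conjGT))
    (hε : IsTwoVector L ε) {N : ℕ} (hN : n < N) : twoAct ε ^ N = 0 := by
  obtain ⟨-, -, l, l', h⟩ := exists_polarization hiso (pairC_conj_isotropic hiso) hL
  rw [twoAct_eq]
  exact h.twoOp_pow_eq_zero_of_left isDualPair_coord (hε.isSkewMap hL).ker (hε.isSkewMap hL).mem
    (by omega)

/-- The product on the right obeys the multiplicative rule of `𝓔` and equals `e^ε` on pure spinors,
since its two inner factors fix them. The formula also gives the smoothness of `𝓔(σ)`. -/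
lemma extMap_eq (hiso : ∀ a ∈ L, ∀ b ∈ L, pairC a b = 0) (hL : IsCompl L (L.map conjGT))
    (hε : IsTwoVector L ε) {k : ℕ} {σ : MF n} (hσ : σ ∈ U L ((k : ℤ) - n)) :
    extMap L ε k σ = expOp ε (oneSubEnd ε (expOp (contrMap ε (epsStar ε)) σ)) := by
  obtain ⟨-, -, l, l', h⟩ := exists_polarization hiso (pairC_conj_isotropic hiso) hL
  have h1 := hε.isSkewMap hL
  have h2 := hε.isSkewMap_epsStar hL
  refine multExt_eq
    (Φ := expOp ε * (oneSubEnd ε * expOp (contrMap ε (epsStar ε)))) (fun a ha => ?_)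
    (fun ρ hρ => ?_) hσ
  · rw [expOp, expOp, twoAct_eq, twoAct_eq, oneSubEnd]
    exact h.texp_oneSubOp_texp_mul isDualPair_coord h1 h2 (by omega) (by omega) ha
  · have e1 : expOp (contrMap ε (epsStar ε)) ρ = ρ := by
      rw [expOp, twoAct_eq]
      exact h.texp_contrMap_of_mem_kerFil_one isDualPair_coord h1 h2 (by omega) hρ
    have e2 : oneSubEnd ε ρ = ρ :=
      h.oneSubOp_of_mem_kerFil_one isDualPair_coord h2 (Nat.succ_pos _) hρ
    -- `expOp` has one term more than `expAct`, and it vanishes because `ε^{n+1} = 0`.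
    rw [Module.End.mul_apply, Module.End.mul_apply, e1, e2, expAct_eq, expOp, texp,
      Finset.sum_range_succ, twoAct_pow_eq_zero hiso hL hε (Nat.lt_succ_self n), smul_zero,
      add_zero]
    rfl

lemma expOp_mem_kerFil_iff (hiso : ∀ a ∈ L, ∀ b ∈ L, pairC a b = 0)
    (hL : IsCompl L (L.map conjGT)) (hε : IsTwoVector L ε) (m : ℕ) (ρ : MF n) :
    expOp ε ρ ∈ kerFil cliff (defL L ε) m ↔ ρ ∈ kerFil cliff L m := by
  obtain ⟨-, -, l, l', h⟩ := exists_polarization hiso (pairC_conj_isotropic hiso) hL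
  rw [expOp, twoAct_eq]
  exact h.texp_mem_kerFil_iff isDualPair_coord (hε.isSkewMap hL) (by omega) m ρ

lemma mem_kerFil_of_mem_U (hiso : ∀ a ∈ L, ∀ b ∈ L, pairC a b = 0)
    (hL : IsCompl L (L.map conjGT)) {k : ℕ} {σ : MF n} (hσ : σ ∈ U L ((k : ℤ) - n)) :
    σ ∈ kerFil cliff L (k + 1) := by
  obtain ⟨-, -, l, l', h⟩ := exists_polarization hiso (pairC_conj_isotropic hiso) hL
  rw [U_eq_grade, sub_add_cancel] at hσ
  exact h.grade_le_kerFil k hσ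

lemma oneSubEnd_mem_kerFil (hiso : ∀ a ∈ L, ∀ b ∈ L, pairC a b = 0)
    (hL : IsCompl L (L.map conjGT)) (hε : IsTwoVector L ε) {m : ℕ} {ρ : MF n}
    (hρ : ρ ∈ kerFil cliff L m) : oneSubEnd ε ρ ∈ kerFil cliff L m := by
  obtain ⟨-, -, l, l', h⟩ := exists_polarization hiso (pairC_conj_isotropic hiso) hL
  exact h.oneSubOp_mem_kerFil isDualPair_coord (hε.isSkewMap hL) (hε.isSkewMap_epsStar hL)
    (Nat.lt_succ_self _) hρ

/-- The extension map agrees with `e^ε ∘ (1 - εε*)` up to terms of lower filtration. -/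
lemma extMap_sub_mem (hiso : ∀ a ∈ L, ∀ b ∈ L, pairC a b = 0)
    (hL : IsCompl L (L.map conjGT)) (hε : IsTwoVector L ε) {k : ℕ} {σ : MF n}
    (hσ : σ ∈ U L ((k : ℤ) - n)) :
    extMap L ε k σ - expOp ε (oneSubMap L ε k σ) ∈ kerFil cliff (defL L ε) (k - 1) := by
  obtain ⟨-, -, l, l', h⟩ := exists_polarization hiso (pairC_conj_isotropic hiso) hL
  rw [extMap_eq hiso hL hε hσ, oneSubMap_eq hiso hL hε hσ, ← map_sub, ← map_sub,
    expOp_mem_kerFil_iff hiso hL hε]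
  refine oneSubEnd_mem_kerFil hiso hL hε ?_
  have hc := (hε.isSkewMap hL).contrMap (hε.isSkewMap_epsStar hL)
  rw [expOp, twoAct_eq]
  exact h.texp_twoOp_sub_mem isDualPair_coord hc.ker hc.mem (by omega)
    (mem_kerFil_of_mem_U hiso hL hσ)

end Pointwise

variable {X : Type*} [TopologicalSpace X] [ChartedSpace (Model n) X]
  [IsManifold 𝓘(ℝ, Model n) ∞ X]

lemma EndCSmoothAt.expOp {A : X → GTC n →ₗ[ℂ] GTC n} {x : X} (hA : EndCSmoothAt A x) :
    OpSmoothAt (fun z => expOp (A z)) x := hA.twoAct.texp _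

lemma EndCSmoothAt.oneSubEnd {A : X → GTC n →ₗ[ℂ] GTC n} {x : X} (hA : EndCSmoothAt A x) :
    OpSmoothAt (fun z => oneSubEnd (A z)) x := (hA.comp hA.epsStar).neg.nOrd _

lemma EndCSmoothAt.contrMap {A : X → GTC n →ₗ[ℂ] GTC n} {x : X} (hA : EndCSmoothAt A x) :
    EndCSmoothAt (fun z => contrMap (A z) (GenCx.epsStar (A z))) x :=
  hA.epsStar.sub (hA.epsStar.comp (hA.comp hA.epsStar))

/-- The components of `dρ` of degree less than `p - 1` vanish for `ρ` of degree `p`. -/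
lemma comp_dH_eq_zero {H : X → Model n [⋀^Fin 3]→L[ℝ] ℝ} {L M : X → Submodule ℂ (GTC n)}
    (hM : Involutive H M) {d : ℕ} (hP : ∀ z, ∃ l l' : Fin d → GTC n,
      Polarization pairC cliff (L z) (M z) l l') {x : X} (hs : HasSmoothSections M x)
    {l l' : Fin d → GTC n} (h : Polarization pairC cliff (L x) (M x) l l') {p : ℕ}
    {ρ : X → MF n} (hρ : MFSmoothAt ρ x) (hp : ∀ z, ρ z ∈ grade cliff (L z) (M z) p) {j : ℤ}
    (hj : j < p - 1) : h.comp j (dH H ρ x) = 0 := by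
  -- Degree `p` leaves room for `d - p` creations, so `d + 1 - p` elements of `M` kill `ρ`. After
  -- `d` it takes `d + 2 - p` of them, which excludes components of degree at most `p - 2`. For `p >
  -- d` the truncated level is `0` and `ρ` vanishes.
  have hr : ∀ z, ρ z ∈ kerFil cliff (M z) (d + 1 - p) := fun z => by
    obtain ⟨l, l', h⟩ := hP z
    exact h.grade_le_kerFil_right (by omega) (hp z)
  by_cases hpd : p ≤ d
  · have hiso : ∀ z, ∀ a ∈ M z, ∀ b ∈ M z, pairC a b = 0 := fun z => by
      obtain ⟨l, l', h⟩ := hP z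
      exact h.iso_right
    exact h.comp_eq_zero_of_mem_kerFil_right (dH_mem_kerFil hM hiso hs _ hρ hr) (by omega)
  · have h0 : ρ = fun _ => 0 := funext fun z => by
      have := hr z
      rwa [Nat.sub_eq_zero_of_le (by omega)] at this
    rw [h0, dH_zero, map_zero]

end

end GenCx

/-! ### The equivalence, point by point -/

theorem theorem3p7 {n : ℕ} {X : Type*} [TopologicalSpace X] [ChartedSpace (Model n) X]
    [IsManifold 𝓘(ℝ, Model n) ∞ X] [T2Space X] [CompactSpace X]
    (H : X → Model n [⋀^Fin 3]→L[ℝ] ℝ) (hH : IsClosedThreeForm H)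
    (J : X → GT n →ₗ[ℝ] GT n) (hJ : IsGenComplex H J)
    (G : X → GT n →ₗ[ℝ] GT n) (hG : IsGenHermitian J G)
    (ε : X → GTC n →ₗ[ℂ] GTC n) (hε : IsBeltrami H J ε) (hε1 : linfNorm J G ε < 1)
    (k : ℕ) (hk : k ≤ 2 * n)
    (σ : X → MF n) (hσ : MFSmooth σ) (hσU : ∀ x, σ x ∈ U (eigL (J x)) ((k : ℤ) - n)) :
    (∀ x, delbar H (fun z => defL (eigL (J z)) (ε z)) ((k : ℤ) - n)
        (fun z => extMap (eigL (J z)) (ε z) k (σ z)) x = 0) ↔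
      ∀ x, commDel H (fun z => eigL (J z)) ε ((k : ℤ) - n)
            (fun z => oneSubMap (eigL (J z)) (ε z) k (σ z)) x
          + delbar H (fun z => eigL (J z)) ((k : ℤ) - n)
            (fun z => oneSubMap (eigL (J z)) (ε z) k (σ z)) x = 0 := by
  have hiso : ∀ z, ∀ a ∈ eigL (J z), ∀ b ∈ eigL (J z), pairC a b = 0 :=
    fun z a ha b hb => pairC_eigL (hJ.orth z) ha hb
  have hcompl : ∀ z, IsCompl (eigL (J z)) ((eigL (J z)).map conjGT) :=
    fun z => isCompl_eigL (hJ.sq z)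
  have hskew : ∀ z, IsSkewMap pairC ((eigL (J z)).map conjGT) (ε z) :=
    fun z => (hε.two z).isSkewMap (hcompl z)
  have hiso' := fun z => pairC_defL (hskew z) (hiso z)
  have hcompl' : ∀ z, IsCompl (defL (eigL (J z)) (ε z)) ((defL (eigL (J z)) (ε z)).map conjGT) :=
    fun z => isCompl_defL (hiso z) (hcompl z) (hε.two z) (hG.symm z)
      fun l hl h0 => normG_lt_of_linfNorm hε1 z (hG.symm z) (hG.pos z) hl h0
  have hP := fun z => (exists_polarization (hiso z) (pairC_conj_isotropic (hiso z))
    (hcompl z)).2.2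
  refine forall_congr' fun x => ?_
  obtain ⟨l, l', h⟩ := hP x
  obtain ⟨-, -, m, m', h'⟩ := exists_polarization (hiso' x) (pairC_conj_isotropic (hiso' x))
    (hcompl' x)
  have hεx : EndCSmoothAt ε x := hε.smooth x
  have hsL := hasSmoothSections_eigL hJ.smooth hJ.sq x
  have hsLε := hsL.defL hεx
  set τ : X → MF n := fun z => oneSubMap (eigL (J z)) (ε z) k (σ z) with hτ
  set η : X → MF n := fun z => extMap (eigL (J z)) (ε z) k (σ z) with hη
  have hτS : MFSmoothAt τ x := by
    rw [hτ]
    simp only [fun z => oneSubMap_eq (hiso z) (hcompl z) (hε.two z) (hσU z)]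
    exact hεx.oneSubEnd _ (hσ x)
  have hηS : MFSmoothAt η x := by
    rw [hη]
    simp only [fun z => extMap_eq (hiso z) (hcompl z) (hε.two z) (hσU z)]
    exact hεx.expOp _ (hεx.oneSubEnd _ (hεx.contrMap.expOp _ (hσ x)))
  have hτk : ∀ z, τ z ∈ grade cliff (eigL (J z)) ((eigL (J z)).map conjGT) k := fun z => by
    obtain ⟨l, l', h⟩ := hP z
    have h1 := hσU z
    rw [U_eq_grade, sub_add_cancel] at h1
    simp only [hτ]
    rw [oneSubMap_eq (hiso z) (hcompl z) (hε.two z) (hσU z)]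
    exact h.oneSubOp_mem_grade isDualPair_coord (hskew z)
      ((hε.two z).isSkewMap_epsStar (hcompl z)) _ h1
  have hq : ∀ (q : ℕ) z, (twoAct (ε z) ^ q) (τ z) ∈
      grade cliff (eigL (J z)) ((eigL (J z)).map conjGT) ((k + 2 * q : ℕ) : ℤ) := by
    intro q z
    obtain ⟨l, l', h⟩ := hP z
    induction q with
    | zero => simpa using hτk z
    | succ q ih =>
      rw [pow_succ', Module.End.mul_apply, twoAct_eq]
      rw [twoAct_eq] at ih
      have i : ((k + 2 * (q + 1) : ℕ) : ℤ) = ((k + 2 * q : ℕ) : ℤ) + 2 := by push_cast; ring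
      rw [i]
      exact h.twoOp_raise isDualPair_coord (hskew z).ker (hskew z).mem _ _ ih
  set δ : ℕ → MF n := fun q =>
    dH H (fun z => ((q.factorial : ℂ)⁻¹) • (twoAct (ε z) ^ q) (τ z)) x with hδ
  have hqS : ∀ q : ℕ, MFSmoothAt (fun z => ((q.factorial : ℂ)⁻¹) • (twoAct (ε z) ^ q) (τ z)) x :=
    fun q => (hεx.twoAct.pow q _ hτS).smul _
  have hlow : ∀ (q : ℕ) (j : ℤ), j < k + 2 * q - 1 → h.comp j (δ q) = 0 := fun q j hj =>
    comp_dH_eq_zero hJ.integrable.conj hP hsL.conj h (hqS q)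
      (fun z => Submodule.smul_mem _ _ (hq q z)) (by push_cast; exact hj)
  have hΔ : dH H (fun z => expOp (ε z) (τ z)) x = ∑ q ∈ Finset.range (n + 2), δ q := by
    rw [hδ, ← dH_sum H fun q _ => hqS q]
    simp only [expOp, texp, LinearMap.sum_apply, LinearMap.smul_apply]
  have hexpS : MFSmoothAt (fun z => expOp (ε z) (τ z)) x := hεx.expOp _ hτS
  have hexp_mem : ∀ z, expOp (ε z) (τ z) ∈ kerFil cliff (defL (eigL (J z)) (ε z)) (k + 1) :=
    fun z => by
      obtain ⟨l, l', h⟩ := hP z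
      exact (expOp_mem_kerFil_iff (hiso z) (hcompl z) (hε.two z) _ _).2
        (h.grade_le_kerFil k (hτk z))
  -- For `k = 0` the truncated level `k - 1` is `0`, and the two forms agree.
  have hsub : ∀ z, η z - expOp (ε z) (τ z) ∈ kerFil cliff (defL (eigL (J z)) (ε z)) (k - 1) :=
    fun z => extMap_sub_mem (hiso z) (hcompl z) (hε.two z) (hσU z)
  have hinv := hε.integrable
  have hsubS : MFSmoothAt (fun z => η z - expOp (ε z) (τ z)) x := by
    have := hηS.add (hexpS.smul (-1))
    simpa only [neg_one_smul, ← sub_eq_add_neg] using this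
  have hη_eq : dH H η x = dH H (fun z => η z - expOp (ε z) (τ z)) x +
      dH H (fun z => expOp (ε z) (τ z)) x := by
    rw [← dH_add H hsubS hexpS]
    simp only [sub_add_cancel]
  -- The error has level `k - 1`, and `d` raises it to at most `k + 1` even when the subtraction is
  -- truncated; so it does not reach degree `k + 1`.
  have hsub_mem : dH H (fun z => η z - expOp (ε z) (τ z)) x ∈
      kerFil cliff (defL (eigL (J x)) (ε x)) (k + 1) :=
    kerFil_mono cliff _ (by omega) (dH_mem_kerFil hinv hiso' hsLε _ hsubS hsub)
  have hΔ_mem : dH H (fun z => expOp (ε z) (τ z)) x ∈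
      kerFil cliff (defL (eigL (J x)) (ε x)) (k + 1 + 1) :=
    dH_mem_kerFil hinv hiso' hsLε _ hexpS hexp_mem
  have hη_mem : dH H η x ∈ kerFil cliff (defL (eigL (J x)) (ε x)) (k + 1 + 1) :=
    hη_eq ▸ add_mem (kerFil_le_succ _ _ _ hsub_mem) hΔ_mem
  have hinverse : ∀ ρ, expOp (ε x) (texp (n + 2) (-twoAct (ε x)) ρ) = ρ := fun ρ =>
    LinearMap.congr_fun (texp_mul_texp_neg
      (twoAct_pow_eq_zero (hiso x) (hcompl x) (hε.two x) (by omega))) ρ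
  -- The comparison of filtrations, read backwards: a form has level `m` for `L_ε` exactly if
  -- `e^{-ε}` brings it to level `m` for `L`.
  have hiff := fun m ρ => (hinverse ρ) ▸ expOp_mem_kerFil_iff (hiso x) (hcompl x) (hε.two x) m
    (texp (n + 2) (-twoAct (ε x)) ρ)
  have e0 : (fun z => (((0 : ℕ).factorial : ℂ)⁻¹) • (twoAct (ε z) ^ 0) (τ z)) = τ := by
    funext z
    simp
  have e1 : (fun z => (((1 : ℕ).factorial : ℂ)⁻¹) • (twoAct (ε z) ^ 1) (τ z)) =
      fun z => twoAct (ε z) (τ z) := by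
    funext z
    simp
  have hcomp := h.comp_texp_neg isDualPair_coord (hskew x) n k δ hlow
  rw [← hΔ, ← twoAct_eq] at hcomp
  simp only [hδ, e0, e1] at hcomp
  have hlhs : delbar H (fun z => defL (eigL (J z)) (ε z)) ((k : ℤ) - n) η x =
      h'.comp ((k + 1 : ℕ) : ℤ) (dH H η x) := by
    have i : (k : ℤ) - n + 1 + n = (k + 1 : ℕ) := by push_cast; ring
    rw [delbar, proj_eq_comp h', i]
  have hrhs : commDel H (fun z => eigL (J z)) ε ((k : ℤ) - n) τ x +
      delbar H (fun z => eigL (J z)) ((k : ℤ) - n) τ x =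
      h.comp ((k + 1 : ℕ) : ℤ)
        (texp (n + 2) (-twoAct (ε x)) (dH H (fun z => expOp (ε z) (τ z)) x)) := by
    push_cast
    rw [hcomp, commDel, del, del, delbar, proj_eq_comp h, proj_eq_comp h, proj_eq_comp h]
    have i1 : (k : ℤ) - n + 2 - 1 + n = k + 1 := by ring
    have i2 : (k : ℤ) - n - 1 + n = k - 1 := by ring
    have i3 : (k : ℤ) - n + 1 + n = k + 1 := by ring
    rw [i1, i2, i3]
  -- Both components of degree `k + 1` become membership in level `k + 1` for `L_ε`; the two
  -- conditions then differ by the error term, which has this level.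
  rw [hlhs, hrhs, ← h'.mem_kerFil_iff_comp hη_mem, hη_eq,
    ← h.mem_kerFil_iff_comp ((hiff _ _).1 hΔ_mem), ← hiff]
  exact Submodule.add_mem_iff_right _ hsub_mem
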